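/- **Proposition (block-encoding symmetric Kronecker products).** Let $n=2^m$. For $G,K\in\mathbb R^{n\times n}$ put $G\otimes_s K=\tfrac12 V(G\otimes K+K\otimes G)V^{\top}$, where $V$ is the $\frac{n(n+1)}2\times n^2$ matrix with rows indexed by the pairs $(i,j)$, $i\ge j$, columns indexed by all pairs $(k,l)$, and $$V_{(i,j),(k,l)}=\begin{cases}1 & i=j=k=l,\\ 1/\sqrt2 & i=k\neq j=l\ \text{ or }\ i=l\neq j=k,\\ 0&\text{otherwise.}\end{cases}$$ View $G\otimes_s K$ as an operator on $2m$ qubits, the pair $(i,j)$ being the basis state $|i\rangle|j\rangle$, padded with zero rows and columns for $i<j$. A unitary $U$ on $a+2m$ qubits is an $(\alpha,a,\xi)$-block-encoding of an operator $A$ on $2m$ qubits if $\|\alpha(\langle 0|^{\otimes a}\otimes I)U(|0\rangle^{\otimes a}\otimes I)-A\|\le\xi$ in spectral norm. A vector $v\in\mathbb R^{n}$ is stored in a QRAM data structure as a complete binary tree: each node holds the sum of the squares of the coordinates below it and the rotation angle $\theta\in[0,\pi/2]$ for which $\cos^2\theta$ is the fraction of that sum lying below its left child; each leaf also holds the sign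 of its coordinate. A matrix is stored as the trees of its rows and the tree of the vector of its row norms. A query maps $|j\rangle|z\rangle\mapsto|j\rangle|z\oplus d_j\rangle$, where $j$ is the address of a node and $d_j$ is a $b$-bit binary description of the addressed content; $b$ may be chosen freely, and the query takes time equal to the number of qubits it acts on. An arbitrary one- or two-qubit gate takes unit time. There are absolute constants $C,k$ such that for all $m\ge 0$, $\xi>0$ and $N\ge1$ there is a quantum circuit with QRAM queries that runs in time at most $$C\Bigl(1+\log_2 n+\log_2\bigl(1+\tfrac{N}{\xi}\bigr)\Bigr)^{k},$$ uses at most that many workspace qubits, which start in $|0\rangle$ and are returned to $|0\rangle$, and has the following property: for all $G,K\in\mathbb R^{n\times n}$ stored in the QRAM with $\|G\otimes K\|_F=N$, it implements a unitary that is a $(\|G\otimes K\|_F^2,\,a,\,\xi)$-block-encoding of $G\otimes_s K$, where $a\le C(1+\log_2 n)$. In short: if $\|G\otimes K\|_F\ge 1$, a $(\|G\otimes K\|_F^2,O(\log n),\xi)$-block-encoding of $G\otimes_s K$ can be implemented in time $\mathrm{poly}(\log n,\log(\|G\otimes K\|_F/\xi))$. -/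

import Mathlib

open scoped Kronecker

noncomputable section

/-! ### Symmetric Kronecker product -/

/-- Frobenius norm of a real matrix. -/
def frobNorm {ι κ : Type*} [Fintype ι] [Fintype κ] (A : Matrix ι κ ℝ) : ℝ :=
  Real.sqrt (∑ i, ∑ j, A i j ^ 2)

/-- The `n (n + 1) / 2` index pairs `(i, j)` with `i ≥ j` (entries of the lower triangle). -/
abbrev LowerPair (n : ℕ) : Type := {p : Fin n × Fin n // p.2 ≤ p.1}

/-- The `n (n + 1) / 2 × n ^ 2` matrix `V`, which maps `vec X` to `svec X` for symmetric `X`. -/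
def symKronV (n : ℕ) : Matrix (LowerPair n) (Fin n × Fin n) ℝ := Matrix.of fun p q =>
  if p.1.1 = p.1.2 ∧ p.1.2 = q.1 ∧ q.1 = q.2 then 1
  else if (p.1.1 = q.1 ∧ p.1.2 = q.2 ∧ p.1.1 ≠ p.1.2) ∨
      (p.1.1 = q.2 ∧ p.1.2 = q.1 ∧ p.1.1 ≠ p.1.2) then 1 / Real.sqrt 2
  else 0

/-- `G ⊗ₛ K = ½ V (G ⊗ K + K ⊗ G) Vᵀ`. -/
def symKron {n : ℕ} (G K : Matrix (Fin n) (Fin n) ℝ) :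
    Matrix (LowerPair n) (LowerPair n) ℝ :=
  (1 / 2 : ℝ) • (symKronV n * (G ⊗ₖ K + K ⊗ₖ G) * (symKronV n).transpose)

/-! ### Qubit registers

A register with wire set `ι` has the computational basis `ι → Fin 2`. -/

/-- The integer held by an `m`-qubit register in a basis state; wire `l` has weight `2 ^ l`. -/
def regVal {m : ℕ} (x : Fin m → Fin 2) : Fin (2 ^ m) := finFunctionFinEquiv x

/-- A matrix on lower-triangular pairs as an operator on two `m`-qubit registers: the pair `(i, j)`
is the basis state `|i⟩|j⟩`, and rows and columns of all other basis states are zero. -/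
def padLower {m : ℕ} (S : Matrix (LowerPair (2 ^ m)) (LowerPair (2 ^ m)) ℝ) :
    Matrix (Fin m ⊕ Fin m → Fin 2) (Fin m ⊕ Fin m → Fin 2) ℂ := Matrix.of fun x y =>
  if hx : regVal (fun l => x (Sum.inr l)) ≤ regVal (fun l => x (Sum.inl l)) then
    if hy : regVal (fun l => y (Sum.inr l)) ≤ regVal (fun l => y (Sum.inl l)) then
      ((S ⟨(regVal (fun l => x (Sum.inl l)), regVal (fun l => x (Sum.inr l))), hx⟩
          ⟨(regVal (fun l => y (Sum.inl l)), regVal (fun l => y (Sum.inr l))), hy⟩ : ℝ) : ℂ)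
    else 0
  else 0

/-- The block `(⟨0|^{⊗ a} ⊗ I) U (|0⟩^{⊗ a} ⊗ I)` of an operator on `a` ancillas and a system. -/
def ancillaBlock {a : ℕ} {σ : Type*} (U : Matrix (Fin a ⊕ σ → Fin 2) (Fin a ⊕ σ → Fin 2) ℂ) :
    Matrix (σ → Fin 2) (σ → Fin 2) ℂ := Matrix.of fun x y =>
  U (Sum.elim (fun _ => 0) x) (Sum.elim (fun _ => 0) y)

open scoped Matrix.Norms.L2Operator in
/-- `U` is an `(α, a, ξ)`-block-encoding of `A`; the norm is the spectral norm. -/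
def IsBlockEncoding (α : ℝ) (a : ℕ) (ξ : ℝ) {σ : Type*} [Fintype σ] [DecidableEq σ]
    (U : Matrix (Fin a ⊕ σ → Fin 2) (Fin a ⊕ σ → Fin 2) ℂ)
    (A : Matrix (σ → Fin 2) (σ → Fin 2) ℂ) : Prop :=
  U ∈ Matrix.unitaryGroup (Fin a ⊕ σ → Fin 2) ℂ ∧ ‖(α : ℂ) • ancillaBlock U - A‖ ≤ ξ

/-! ### The QRAM data structure

A vector `v` of length `2 ^ m` is stored in a complete binary tree with nodes numbered as in a heap:
the root is `1`, the children of `h` are `2 * h` and `2 * h + 1`, and the leaf of coordinate `j` is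
`2 ^ m + j`. -/

/-- Sum of the squares of the coordinates of `v` below the node `h`. -/
def treeMass {m : ℕ} (v : Fin (2 ^ m) → ℝ) (h : ℕ) : ℝ :=
  ∑ j : Fin (2 ^ m), if ∃ e ∈ Finset.range (m + 1), (2 ^ m + (j : ℕ)) / 2 ^ e = h then v j ^ 2
    else 0

/-- The rotation angle in `[0, π / 2]` of the node `h`: the squared cosine is the fraction of the
mass of `h` that lies below its left child (any value would do where that mass is zero). -/
def treeAngle {m : ℕ} (v : Fin (2 ^ m) → ℝ) (h : ℕ) : ℝ :=
  Real.arccos (Real.sqrt (treeMass v (2 * h) / treeMass v h))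

/-- Sign bit of a leaf: `1` if its coordinate is negative. -/
def treeSign {m : ℕ} (v : Fin (2 ^ m) → ℝ) (h : ℕ) : ℕ :=
  if ∃ j : Fin (2 ^ m), h = 2 ^ m + (j : ℕ) ∧ v j < 0 then 1 else 0

/-- What is stored in a node: its mass in fixed point with `p` fractional bits, its angle, and its
sign bit. -/
inductive NodeField
  | mass (p : ℕ)
  | angle
  | sign

/-- The `b`-bit word read from a node, least significant bit first. Masses are rounded down to a
multiple of `2 ^ (-p)`, angles to a multiple of `π / 2 ^ b`. -/
def nodeWord {m : ℕ} (v : Fin (2 ^ m) → ℝ) (fld : NodeField) (b h : ℕ) : Fin b → Fin 2 :=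
  fun l => Fin.ofNat 2 ((match fld with
    | NodeField.mass p => ⌊(2 : ℝ) ^ p * treeMass v h⌋₊
    | NodeField.angle => ⌊(2 : ℝ) ^ b * (treeAngle v h / Real.pi)⌋₊
    | NodeField.sign => treeSign v h) / 2 ^ (l : ℕ))

/-- The vector of Euclidean norms of the rows. -/
def rowNorms {m : ℕ} (A : Matrix (Fin (2 ^ m)) (Fin (2 ^ m)) ℝ) : Fin (2 ^ m) → ℝ :=
  fun i => Real.sqrt (∑ j, A i j ^ 2)

/-! ### Quantum circuits with QRAM access -/

/-- The elementary operations on the wires `ι`, given a QRAM that holds a family, indexed by `s`,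
of `2 ^ m × 2 ^ m` matrices: arbitrary gates on at most two qubits, and queries to the data
structure. A matrix is stored as one tree for each row and one tree for the vector of row norms.
The matrices themselves are not part of an operation. -/
inductive QOp (s : Type) (m : ℕ) (ι : Type) : Type
  | gate (k : ℕ) (hk : k ≤ 2) (q : Fin k ↪ ι) (u : Matrix.unitaryGroup (Fin k → Fin 2) ℂ)
  | rowQuery (r : s) (fld : NodeField) (b : ℕ) (q : (Fin m ⊕ Fin (m + 1)) ⊕ Fin b ↪ ι)
  | normQuery (r : s) (fld : NodeField) (b : ℕ) (q : Fin (m + 1) ⊕ Fin b ↪ ι)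

/-- Time of an operation: one for a gate, and for a query the number of qubits it acts on. -/
def QOp.time {s : Type} {m : ℕ} {ι : Type} : QOp s m ι → ℕ
  | .gate _ _ _ _ => 1
  | .rowQuery _ _ b _ => m + (m + 1) + b
  | .normQuery _ _ b _ => (m + 1) + b

/-- `u` on the wires `q` and the identity on all others. -/
def gateMatrix {ι κ : Type} [Fintype ι] [DecidableEq ι] [Fintype κ] (q : κ ↪ ι)
    (u : Matrix (κ → Fin 2) (κ → Fin 2) ℂ) : Matrix (ι → Fin 2) (ι → Fin 2) ℂ := Matrix.of fun x y =>
  if ∀ i, (∀ c, q c ≠ i) → x i = y i then u (fun c => x (q c)) (fun c => y (q c)) else 0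

/-- `|j⟩|z⟩ ↦ |j⟩|z ⊕ f j⟩` on the wires `q` and the identity on all others. -/
def queryMatrix {ι κ : Type} [Fintype ι] [DecidableEq ι] {b : ℕ} (q : κ ⊕ Fin b ↪ ι)
    (f : (κ → Fin 2) → Fin b → Fin 2) : Matrix (ι → Fin 2) (ι → Fin 2) ℂ := Matrix.of fun x y =>
  if ∀ i, x i = y i + ∑ l, (if q (Sum.inr l) = i then f (fun c => y (q (Sum.inl c))) l else 0)
    then 1 else 0

/-- The unitary of an operation when the QRAM holds the matrices `A`. -/
def QOp.matrix {s : Type} {m : ℕ} {ι : Type} [Fintype ι] [DecidableEq ι]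
    (A : s → Matrix (Fin (2 ^ m)) (Fin (2 ^ m)) ℝ) :
    QOp s m ι → Matrix (ι → Fin 2) (ι → Fin 2) ℂ
  | .gate _ _ q u => gateMatrix q u.1
  | .rowQuery r fld b q => queryMatrix q fun j =>
      nodeWord (A r (regVal fun l => j (Sum.inl l))) fld b (regVal fun l => j (Sum.inr l))
  | .normQuery r fld b q => queryMatrix q fun j => nodeWord (rowNorms (A r)) fld b (regVal j)

/-- A circuit is a list of operations; the head is applied first. -/
abbrev QCircuit (s : Type) (m : ℕ) (ι : Type) : Type := List (QOp s m ι)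

def QCircuit.time {s : Type} {m : ℕ} {ι : Type} (c : QCircuit s m ι) : ℕ :=
  (List.map QOp.time c).sum

def QCircuit.matrix {s : Type} {m : ℕ} {ι : Type} [Fintype ι] [DecidableEq ι]
    (A : s → Matrix (Fin (2 ^ m)) (Fin (2 ^ m)) ℝ) :
    QCircuit s m ι → Matrix (ι → Fin 2) (ι → Fin 2) ℂ
  | [] => 1
  | g :: c => QCircuit.matrix A c * g.matrix A

/-- `M` implements `U` with `t` workspace qubits that start in `|0⟩` and are returned to `|0⟩`. -/
def ImplementsClean {ι : Type} {t : ℕ} (M : Matrix (ι ⊕ Fin t → Fin 2) (ι ⊕ Fin t → Fin 2) ℂ)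
    (U : Matrix (ι → Fin 2) (ι → Fin 2) ℂ) : Prop :=
  ∀ (x y : ι → Fin 2) (z : Fin t → Fin 2),
    M (Sum.elim x z) (Sum.elim y fun _ => 0) = if z = fun _ => 0 then U x y else 0

end

/-! The rows of `symKronV` are unchanged when a column pair is swapped, so `V(G ⊗ K)Vᵀ = V(K ⊗ G)Vᵀ`
and the symmetric product is just `V(G ⊗ K)Vᵀ` (`symKron_apply`). Its entries are realised as
overlaps of quickly preparable states: a unitary `star R * L` has as its entries the inner products
of the columns of `R` and `L`.

Both `R` and `L` begin with a symmetrizer, which sends `|i⟩|j⟩` with `j ≤ i` to the state whose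
amplitudes form the row `(i, j)` of `V`, and raises a flag if `i < j` (`symmetrizer_apply`). Then
`L` keeps the column pair in the system registers and loads the row norms, with amplitudes `‖G_i‖ /
‖G‖_F` and `‖K_j‖ / ‖K‖_F`, into the ancilla registers. `R` moves the row pair to the ancilla
registers and loads the normalized rows of `G` and `K` into the system registers. In the overlap the
row norms cancel, leaving `G_{ik} K_{jl} / N` (`overlap`, `exact_entry`). A further ancilla rotated
by `arccos (1 / N)`, which needs `N ≥ 1`, contributes another `1 / N`, so the scale is exactly `N ^
2`. The flags of `R` and `L` are different qubits, so forbidden rows and columns give zero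
(`symKronCircuit_apply`).

A vector is loaded by descending its tree: the next qubit is rotated by the angle read at the node
that the qubits prepared so far address. The product of cosines and sines telescopes to `|v j| /
‖v‖` (`treeAmp_treeAngle`); signs enter as phases. Each query is undone after use, so every step is
an operator on one wire controlled by the others (`conj_mux`), and an entry of a whole sequence is a
product of 2 × 2 entries (`seqMat_apply`). No workspace wire changes, so the block with zero
workspace is itself unitary (`cleanBlock_mem_unitaryGroup`).

The only error is the rounding of angles, at most `π / 2 ^ b` per rotation. Crude bounds on the sums
over indices lose a factor `2 ^ (8 * m)`, which costs only `O(m)` further bits. Hence `b = log₂(1 +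
N / ξ) + O(m)` suffices, and the time is quadratic in `m + b`. -/

noncomputable section

set_option linter.unusedSectionVars false

/-! ### Operators on registers -/

section Operators

variable {ι : Type} [Fintype ι] [DecidableEq ι]

/-- The operator that sends the basis state `y` to the basis state `π y`. -/
def permMat (π : (ι → Fin 2) → ι → Fin 2) : Matrix (ι → Fin 2) (ι → Fin 2) ℂ :=
  Matrix.of fun x y => if x = π y then 1 else 0

/-- The operator that acts on the wire `w` by a matrix controlled by the basis state of all other
wires. -/
def mux (w : ι) (R : (ι → Fin 2) → Matrix (Fin 2) (Fin 2) ℂ) :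
    Matrix (ι → Fin 2) (ι → Fin 2) ℂ :=
  Matrix.of fun x y => ∑ b, if x = Function.update y w b then R y b (y w) else 0

/-- `R` does not depend on the wire `w`. -/
def Ignores {α : Type*} (R : (ι → Fin 2) → α) (w : ι) : Prop :=
  ∀ y b, R (Function.update y w b) = R y

/-- `M` preserves the value of the wire `i`. -/
def Fixes (M : Matrix (ι → Fin 2) (ι → Fin 2) ℂ) (i : ι) : Prop :=
  ∀ x y, x i ≠ y i → M x y = 0

/-- The Boolean matrix that adds `b` to the value of a qubit. -/
def flipM (b : Fin 2) : Matrix (Fin 2) (Fin 2) ℂ :=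
  Matrix.of fun x y => if x = y + b then 1 else 0

theorem mux_eq_permMat (w : ι) (f : (ι → Fin 2) → Fin 2) :
    mux w (fun y => flipM (f y)) = permMat fun y => Function.update y w (y w + f y) := by
  ext x y
  simp only [mux, permMat, flipM, Matrix.of_apply]
  rw [Finset.sum_eq_single (y w + f y)]
  · simp
  · intro b _ hb
    simp [hb]
  · simp

theorem mul_mux_apply (A : Matrix (ι → Fin 2) (ι → Fin 2) ℂ) (w : ι)
    (R : (ι → Fin 2) → Matrix (Fin 2) (Fin 2) ℂ) (x y : ι → Fin 2) :
    (A * mux w R) x y = ∑ b, A x (Function.update y w b) * R y b (y w) := by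
  simp only [Matrix.mul_apply, mux, Matrix.of_apply, Finset.mul_sum]
  rw [Finset.sum_comm]
  simp

theorem mul_permMat_apply (A : Matrix (ι → Fin 2) (ι → Fin 2) ℂ)
    (π : (ι → Fin 2) → ι → Fin 2) (x y : ι → Fin 2) : (A * permMat π) x y = A x (π y) := by
  simp [Matrix.mul_apply, permMat]

theorem permMat_mul (π ρ : (ι → Fin 2) → ι → Fin 2) :
    permMat π * permMat ρ = permMat (π ∘ ρ) := by
  ext x y
  rw [mul_permMat_apply]
  rfl

theorem star_permMat_mul_apply (A : Matrix (ι → Fin 2) (ι → Fin 2) ℂ)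
    (π : (ι → Fin 2) → ι → Fin 2) (x y : ι → Fin 2) : (star (permMat π) * A) x y = A (π x) y := by
  rw [Matrix.star_eq_conjTranspose]
  simp [Matrix.mul_apply, permMat, Matrix.conjTranspose_apply, apply_ite]

/-- `R` does not see the change that the right factor makes to `w`, so both factors use the same
control values and their 2 × 2 operators multiply. -/
theorem mux_mul {w : ι} {R : (ι → Fin 2) → Matrix (Fin 2) (Fin 2) ℂ} (hR : Ignores R w)
    (R' : (ι → Fin 2) → Matrix (Fin 2) (Fin 2) ℂ) :
    mux w R * mux w R' = mux w fun y => R y * R' y := by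
  ext x y
  rw [mul_mux_apply]
  simp only [mux, Matrix.of_apply, Function.update_idem, Function.update_self, hR y,
    Matrix.mul_apply, Finset.sum_mul]
  rw [Finset.sum_comm]
  refine Finset.sum_congr rfl fun b _ => ?_
  by_cases h : x = Function.update y w b <;> simp [h]

/-- Two basis states with the same image would give columns with inner product one. Thus
reversibility of a computation on basis states is read off from the unitarity of its circuit. -/
theorem injective_of_permMat_unitary {π : (ι → Fin 2) → ι → Fin 2}
    (h : permMat π ∈ Matrix.unitaryGroup (ι → Fin 2) ℂ) : Function.Injective π := by
  intro x y hxy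
  by_contra hne
  have h1 := congrFun (congrFun (Matrix.mem_unitaryGroup_iff'.1 h) x) y
  rw [star_permMat_mul_apply] at h1
  simp [permMat, hxy, hne] at h1

/-- The principle of uncomputation: since `π` commutes with changes of `w`, undoing `π` after the
controlled operator restores all other wires, and only the computed control values survive. -/
theorem conj_mux {π : (ι → Fin 2) → ι → Fin 2} (hπ : Function.Injective π) {w : ι}
    (hw : ∀ y b, π (Function.update y w b) = Function.update (π y) w b)
    (R : (ι → Fin 2) → Matrix (Fin 2) (Fin 2) ℂ) :
    star (permMat π) * (mux w R * permMat π) = mux w (R ∘ π) := by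
  ext x y
  rw [star_permMat_mul_apply, mul_permMat_apply]
  have h : π y w = y w := by
    have := congrFun (hw y (y w)) w
    rwa [Function.update_eq_self, Function.update_self] at this
  simp only [mux, Matrix.of_apply, ← hw, hπ.eq_iff, Function.comp, h]

theorem Fixes.mux {w i : ι} (h : i ≠ w) (R : (ι → Fin 2) → Matrix (Fin 2) (Fin 2) ℂ) :
    Fixes (mux w R) i := by
  intro x y hxy
  simp only [_root_.mux, Matrix.of_apply]
  refine Finset.sum_eq_zero fun b _ => if_neg ?_
  rintro rfl
  simp [Function.update_of_ne h] at hxy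

theorem Fixes.mul {A B : Matrix (ι → Fin 2) (ι → Fin 2) ℂ} {i : ι} (hA : Fixes A i)
    (hB : Fixes B i) : Fixes (A * B) i := by
  intro x y hxy
  rw [Matrix.mul_apply]
  refine Finset.sum_eq_zero fun z _ => ?_
  by_cases h : x i = z i
  · rw [hB z y (h ▸ hxy), mul_zero]
  · rw [hA x z h, zero_mul]

theorem Fixes.star {A : Matrix (ι → Fin 2) (ι → Fin 2) ℂ} {i : ι} (hA : Fixes A i) :
    Fixes (star A) i := by
  intro x y hxy
  rw [Matrix.star_eq_conjTranspose, Matrix.conjTranspose_apply, hA y x hxy.symm, star_zero]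

theorem Fixes.permMat {π : (ι → Fin 2) → ι → Fin 2} {i : ι} (h : ∀ y, π y i = y i) :
    Fixes (permMat π) i := by
  intro x y hxy
  simp only [_root_.permMat, Matrix.of_apply]
  rw [if_neg]
  rintro rfl
  exact hxy (h y)

theorem Fixes.one (i : ι) : Fixes (1 : Matrix (ι → Fin 2) (ι → Fin 2) ℂ) i := by
  intro x y hxy
  rw [Matrix.one_apply_ne]
  rintro rfl
  exact hxy rfl

theorem fin_two_add_self (a : Fin 2) : a + a = 0 := by
  revert a; decide

/-- Adds the values `f y l` to the wires `T l` of the basis state `y`. -/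
def xorLayer {κ : Type} [Fintype κ] (T : κ → ι) (f : (ι → Fin 2) → κ → Fin 2)
    (y : ι → Fin 2) : ι → Fin 2 := fun i => y i + ∑ l, if T l = i then f y l else 0

/-! ### Addition of bits to a family of wires -/

section XorLayer

variable {κ : Type} [Fintype κ] {T : κ → ι} {f : (ι → Fin 2) → κ → Fin 2}

theorem xorLayer_apply_target (hT : Function.Injective T) (y : ι → Fin 2) (l : κ) :
    xorLayer T f y (T l) = y (T l) + f y l := by
  classical
  simp [xorLayer, hT.eq_iff]

theorem xorLayer_apply_of_ne {i : ι} (hi : ∀ l, T l ≠ i) (y : ι → Fin 2) :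
    xorLayer T f y i = y i := by
  simp [xorLayer, hi]

/-- The second layer adds the same bits again, and they cancel modulo 2. -/
theorem xorLayer_involutive (h : ∀ y, f (xorLayer T f y) = f y) :
    Function.Involutive (xorLayer T f) := by
  intro y
  funext i
  have : xorLayer T f (xorLayer T f y) i =
      y i + (∑ l, if T l = i then f y l else 0) + ∑ l, if T l = i then f y l else 0 := by
    conv_lhs => rw [xorLayer, h y]
    rfl
  rw [this, add_assoc, fin_two_add_self, add_zero]

theorem xorLayer_update {w : ι} (hT : ∀ l, T l ≠ w) (hf : Ignores f w) (y : ι → Fin 2)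
    (b : Fin 2) :
    xorLayer T f (Function.update y w b) = Function.update (xorLayer T f y) w b := by
  funext i
  by_cases hi : i = w
  · subst hi
    rw [xorLayer_apply_of_ne hT, Function.update_self, Function.update_self]
  · simp only [xorLayer, hf y b, Function.update_of_ne hi]

end XorLayer

end Operators

/-! ### Unitarity and inverses of circuits -/

section Circuits

variable {s : Type} {m : ℕ} {ι : Type} [Fintype ι] [DecidableEq ι]

theorem queryMatrix_eq {κ : Type} [Fintype κ] {b : ℕ} (q : κ ⊕ Fin b ↪ ι)
    (f : (κ → Fin 2) → Fin b → Fin 2) :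
    queryMatrix q f =
      permMat (xorLayer (fun l => q (Sum.inr l)) fun y => f fun c => y (q (Sum.inl c))) := by
  ext x y
  simp only [queryMatrix, permMat, Matrix.of_apply, funext_iff, xorLayer]

theorem queryMap_involutive {κ : Type} [Fintype κ] {b : ℕ} (q : κ ⊕ Fin b ↪ ι)
    (f : (κ → Fin 2) → Fin b → Fin 2) : Function.Involutive
      (xorLayer (fun l => q (Sum.inr l)) fun y => f fun c => y (q (Sum.inl c))) := by
  refine xorLayer_involutive fun y => congrArg f (funext fun c => xorLayer_apply_of_ne ?_ y)
  intro l
  simp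

theorem star_permMat_of_involutive {π : (ι → Fin 2) → ι → Fin 2} (h : Function.Involutive π) :
    star (permMat π) = permMat π := by
  ext x y
  simp only [Matrix.star_apply, permMat, Matrix.of_apply, apply_ite star, star_one, star_zero]
  refine if_congr ⟨?_, ?_⟩ rfl rfl
  · rintro rfl; exact (h x).symm
  · rintro rfl; exact (h y).symm

theorem star_gateMatrix {κ : Type} [Fintype κ] (q : κ ↪ ι)
    (u : Matrix (κ → Fin 2) (κ → Fin 2) ℂ) : star (gateMatrix q u) = gateMatrix q (star u) := by
  ext x y
  simp only [Matrix.star_apply, gateMatrix, Matrix.of_apply, apply_ite star, star_zero]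
  refine if_congr ?_ rfl rfl
  exact forall_congr' fun i => imp_congr_right fun _ => eq_comm

theorem gateMatrix_mul {κ : Type} [Fintype κ] [DecidableEq κ] (q : κ ↪ ι)
    (u v : Matrix (κ → Fin 2) (κ → Fin 2) ℂ) :
    gateMatrix q u * gateMatrix q v = gateMatrix q (u * v) := by
  ext x y
  have hext : ∀ k : κ → Fin 2, (fun c => Function.extend q k y (q c)) = k := fun k =>
    funext fun c => q.injective.extend_apply k y c
  have hoff : ∀ (k : κ → Fin 2) (i : ι), (∀ c, q c ≠ i) → Function.extend q k y i = y i :=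
    fun k i hi => Function.extend_apply' _ _ _ (by rintro ⟨c, hc⟩; exact hi c hc)
  rw [Matrix.mul_apply]
  simp only [gateMatrix, Matrix.of_apply]
  -- Only intermediate states that agree with `y` off the wires `q` contribute; they are the
  -- extensions of `y` by arbitrary values `k` on `q`.
  rw [← Fintype.sum_of_injective (fun k : κ → Fin 2 => Function.extend q k y)
    (f := fun k => if ∀ i, (∀ c, q c ≠ i) → x i = y i then
      u (fun c => x (q c)) k * v k (fun c => y (q c)) else 0)]
  · split_ifs with h
    · rw [Matrix.mul_apply]
    · simp
  · intro k k' h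
    rw [← hext k, ← hext k']
    funext c
    exact congrFun h (q c)
  · intro z hz
    rw [mul_eq_zero]
    right
    refine if_neg fun h => hz ⟨fun c => z (q c), ?_⟩
    funext i
    by_cases hi : ∃ c, q c = i
    · obtain ⟨c, rfl⟩ := hi
      exact congrFun (hext fun c => z (q c)) c
    · rw [not_exists] at hi
      show Function.extend q _ y i = z i
      rw [hoff _ i hi, h i hi]
  · intro k
    rw [hext k, if_pos (hoff k)]
    have : (∀ i, (∀ c, q c ≠ i) → x i = Function.extend q k y i) ↔
        ∀ i, (∀ c, q c ≠ i) → x i = y i :=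
      forall_congr' fun i => imp_congr_right fun hi => by rw [hoff k i hi]
    simp only [this, ite_mul, zero_mul]

theorem gateMatrix_one {κ : Type} [Fintype κ] [DecidableEq κ] (q : κ ↪ ι) :
    gateMatrix q (1 : Matrix (κ → Fin 2) (κ → Fin 2) ℂ) = 1 := by
  ext x y
  simp only [gateMatrix, Matrix.of_apply, Matrix.one_apply]
  by_cases hxy : x = y
  · simp [hxy]
  · rw [if_neg hxy]
    split_ifs with h1 h2
    · refine absurd (funext fun i => ?_) hxy
      by_cases hi : ∃ c, q c = i
      · obtain ⟨c, rfl⟩ := hi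
        exact congrFun h2 c
      · rw [not_exists] at hi
        exact h1 i hi
    · rfl
    · rfl

/-- The inverse of an operation. -/
def QOp.inv : QOp s m ι → QOp s m ι
  | .gate k hk q u => .gate k hk q u⁻¹
  | .rowQuery r fld b q => .rowQuery r fld b q
  | .normQuery r fld b q => .normQuery r fld b q

/-- The inverse of a circuit. -/
def QCircuit.inv (c : QCircuit s m ι) : QCircuit s m ι := (c.map QOp.inv).reverse

theorem star_queryMatrix {κ : Type} [Fintype κ] {b : ℕ} (q : κ ⊕ Fin b ↪ ι)
    (f : (κ → Fin 2) → Fin b → Fin 2) : star (queryMatrix q f) = queryMatrix q f := by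
  rw [queryMatrix_eq]
  exact star_permMat_of_involutive (queryMap_involutive q f)

theorem permMat_mem_unitaryGroup {π : (ι → Fin 2) → ι → Fin 2} (h : Function.Involutive π) :
    permMat π ∈ Matrix.unitaryGroup (ι → Fin 2) ℂ := by
  rw [Matrix.mem_unitaryGroup_iff, star_permMat_of_involutive h, permMat_mul]
  ext x y
  simp [permMat, Matrix.one_apply, h y]

theorem queryMatrix_mem_unitaryGroup {κ : Type} [Fintype κ] {b : ℕ} (q : κ ⊕ Fin b ↪ ι)
    (f : (κ → Fin 2) → Fin b → Fin 2) :
    queryMatrix q f ∈ Matrix.unitaryGroup (ι → Fin 2) ℂ := by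
  rw [queryMatrix_eq]
  exact permMat_mem_unitaryGroup (queryMap_involutive q f)

theorem gateMatrix_mem_unitaryGroup {κ : Type} [Fintype κ] [DecidableEq κ] (q : κ ↪ ι)
    {u : Matrix (κ → Fin 2) (κ → Fin 2) ℂ} (hu : u * star u = 1) :
    gateMatrix q u ∈ Matrix.unitaryGroup (ι → Fin 2) ℂ := by
  rw [Matrix.mem_unitaryGroup_iff, star_gateMatrix, gateMatrix_mul, hu, gateMatrix_one]

/-- The word that a query to the trees of the rows returns. -/
def rowWord (B : Matrix (Fin (2 ^ m)) (Fin (2 ^ m)) ℝ) (fld : NodeField) (b : ℕ)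
    (j : Fin m ⊕ Fin (m + 1) → Fin 2) : Fin b → Fin 2 :=
  nodeWord (B (regVal fun l => j (Sum.inl l))) fld b (regVal fun l => j (Sum.inr l))

/-- The word that a query to the tree of the row norms returns. -/
def normWord (B : Matrix (Fin (2 ^ m)) (Fin (2 ^ m)) ℝ) (fld : NodeField) (b : ℕ)
    (j : Fin (m + 1) → Fin 2) : Fin b → Fin 2 :=
  nodeWord (rowNorms B) fld b (regVal j)

theorem QOp.matrix_rowQuery (A : s → Matrix (Fin (2 ^ m)) (Fin (2 ^ m)) ℝ) (r : s)
    (fld : NodeField) (b : ℕ) (q : (Fin m ⊕ Fin (m + 1)) ⊕ Fin b ↪ ι) :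
    (QOp.rowQuery r fld b q).matrix A = queryMatrix q (rowWord (A r) fld b) := rfl

theorem QOp.matrix_normQuery (A : s → Matrix (Fin (2 ^ m)) (Fin (2 ^ m)) ℝ) (r : s)
    (fld : NodeField) (b : ℕ) (q : Fin (m + 1) ⊕ Fin b ↪ ι) :
    (QOp.normQuery r fld b q).matrix A = queryMatrix q (normWord (A r) fld b) := rfl

theorem QOp.matrix_inv (A : s → Matrix (Fin (2 ^ m)) (Fin (2 ^ m)) ℝ) (g : QOp s m ι) :
    g.inv.matrix A = star (g.matrix A) := by
  cases g with
  | gate k hk q u => exact (star_gateMatrix q u.1).symm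
  | rowQuery r fld b q => simp only [QOp.inv, QOp.matrix_rowQuery, star_queryMatrix]
  | normQuery r fld b q => simp only [QOp.inv, QOp.matrix_normQuery, star_queryMatrix]

theorem QOp.matrix_mem_unitaryGroup (A : s → Matrix (Fin (2 ^ m)) (Fin (2 ^ m)) ℝ)
    (g : QOp s m ι) : g.matrix A ∈ Matrix.unitaryGroup (ι → Fin 2) ℂ := by
  cases g with
  | gate k hk q u => exact gateMatrix_mem_unitaryGroup q (Matrix.mem_unitaryGroup_iff.1 u.2)
  | rowQuery r fld b q =>
    simp only [QOp.matrix_rowQuery, queryMatrix_mem_unitaryGroup]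
  | normQuery r fld b q =>
    simp only [QOp.matrix_normQuery, queryMatrix_mem_unitaryGroup]

namespace QCircuit

variable (A : s → Matrix (Fin (2 ^ m)) (Fin (2 ^ m)) ℝ)

theorem matrix_mem_unitaryGroup (c : QCircuit s m ι) :
    c.matrix A ∈ Matrix.unitaryGroup (ι → Fin 2) ℂ := by
  induction c with
  | nil => exact one_mem _
  | cons g c ih => exact mul_mem ih (g.matrix_mem_unitaryGroup A)

theorem matrix_append (c d : QCircuit s m ι) :
    QCircuit.matrix A (c ++ d) = QCircuit.matrix A d * QCircuit.matrix A c := by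
  induction c with
  | nil => simp [QCircuit.matrix]
  | cons g c ih =>
    rw [List.cons_append, QCircuit.matrix, QCircuit.matrix, ih, Matrix.mul_assoc]

theorem matrix_singleton (g : QOp s m ι) : QCircuit.matrix A [g] = g.matrix A := by
  simp [QCircuit.matrix]

theorem matrix_inv (c : QCircuit s m ι) :
    QCircuit.matrix A (QCircuit.inv c) = star (QCircuit.matrix A c) := by
  induction c with
  | nil => simp [QCircuit.inv, QCircuit.matrix]
  | cons g c ih =>
    have : QCircuit.inv (g :: c) = QCircuit.inv c ++ [g.inv] := by simp [QCircuit.inv]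
    rw [this, matrix_append, matrix_singleton, ih, QCircuit.matrix, star_mul, QOp.matrix_inv]

theorem time_append (c d : QCircuit s m ι) :
    QCircuit.time (c ++ d) = QCircuit.time c + QCircuit.time d := by
  simp [QCircuit.time]

theorem time_cons (g : QOp s m ι) (c : QCircuit s m ι) :
    QCircuit.time (g :: c) = g.time + QCircuit.time c := by
  simp [QCircuit.time]

theorem time_nil : QCircuit.time ([] : QCircuit s m ι) = 0 := rfl

theorem time_inv (c : QCircuit s m ι) : QCircuit.time (QCircuit.inv c) = QCircuit.time c := by
  have : QOp.time ∘ QOp.inv = (QOp.time : QOp s m ι → ℕ) := by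
    funext g
    cases g <;> rfl
  simp [QCircuit.time, QCircuit.inv, this, List.sum_reverse]

theorem time_flatMap_le {α : Type*} (l : List α) (f : α → QCircuit s m ι) (B : ℕ)
    (h : ∀ a ∈ l, QCircuit.time (f a) ≤ B) : QCircuit.time (l.flatMap f) ≤ l.length * B := by
  induction l with
  | nil => simp [QCircuit.time]
  | cons a l ih =>
    rw [List.flatMap_cons, time_append, List.length_cons, Nat.succ_mul, add_comm]
    exact add_le_add (ih fun b hb => h b (List.mem_cons_of_mem _ hb))
      (h a List.mem_cons_self)

/-- Applies `p`, then `c`, then undoes `p`. -/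
def conj (p c : QCircuit s m ι) : QCircuit s m ι := p ++ c ++ QCircuit.inv p

theorem matrix_conj {p c : QCircuit s m ι} {π : (ι → Fin 2) → ι → Fin 2}
    (hp : QCircuit.matrix A p = permMat π) {w : ι}
    (hw : ∀ y b, π (Function.update y w b) = Function.update (π y) w b)
    {R : (ι → Fin 2) → Matrix (Fin 2) (Fin 2) ℂ} (hc : QCircuit.matrix A c = mux w R) :
    QCircuit.matrix A (QCircuit.conj p c) = mux w (R ∘ π) := by
  have hu := matrix_mem_unitaryGroup A p
  rw [hp] at hu
  rw [QCircuit.conj, matrix_append, matrix_append, matrix_inv, hp, hc,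
    conj_mux (injective_of_permMat_unitary hu) hw]

theorem time_conj (p c : QCircuit s m ι) :
    QCircuit.time (QCircuit.conj p c) = 2 * QCircuit.time p + QCircuit.time c := by
  rw [QCircuit.conj, time_append, time_append, time_inv]
  ring

end QCircuit

end Circuits

/-! ### Gates -/

section Gates

/-- Rotation of a qubit by the angle `θ`. -/
def rotM (θ : ℝ) : Matrix (Fin 2) (Fin 2) ℂ :=
  !![(Real.cos θ : ℂ), -(Real.sin θ : ℂ); (Real.sin θ : ℂ), (Real.cos θ : ℂ)]

/-- The Hadamard gate. -/
def hadM : Matrix (Fin 2) (Fin 2) ℂ :=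
  !![((1 / Real.sqrt 2 : ℝ) : ℂ), ((1 / Real.sqrt 2 : ℝ) : ℂ);
    ((1 / Real.sqrt 2 : ℝ) : ℂ), -((1 / Real.sqrt 2 : ℝ) : ℂ)]

/-- A square root of the NOT gate. -/
def sqrtNotM : Matrix (Fin 2) (Fin 2) ℂ :=
  !![(1 + Complex.I) / 2, (1 - Complex.I) / 2; (1 - Complex.I) / 2, (1 + Complex.I) / 2]

theorem rotM_zero : rotM 0 = 1 := by
  ext i j; fin_cases i <;> fin_cases j <;> simp [rotM]

theorem rotM_mul (a b : ℝ) : rotM a * rotM b = rotM (a + b) := by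
  ext i j
  fin_cases i <;> fin_cases j <;>
    simp [rotM, Matrix.mul_apply, Fin.sum_univ_two, Complex.cos_add, Complex.sin_add] <;> ring

theorem star_rotM (a : ℝ) : star (rotM a) = rotM (-a) := by
  ext i j
  fin_cases i <;> fin_cases j <;>
    simp [rotM, Matrix.star_apply, -Complex.ofReal_cos, -Complex.ofReal_sin]

theorem rotM_mem (a : ℝ) : rotM a ∈ Matrix.unitaryGroup (Fin 2) ℂ := by
  rw [Matrix.mem_unitaryGroup_iff, star_rotM, rotM_mul, add_neg_cancel, rotM_zero]

theorem flipM_zero : flipM 0 = 1 := by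
  ext i j; simp [flipM, Matrix.one_apply]

theorem flipM_mul (a b : Fin 2) : flipM a * flipM b = flipM (a + b) := by
  ext i j
  simp only [flipM, Matrix.mul_apply, Fin.sum_univ_two, Matrix.of_apply]
  revert i j a b
  simp [Fin.forall_fin_two]

theorem star_flipM (a : Fin 2) : star (flipM a) = flipM a := by
  ext i j
  simp only [flipM, Matrix.star_apply, Matrix.of_apply, apply_ite star, star_one, star_zero]
  revert i j a
  simp [Fin.forall_fin_two]

theorem flipM_mem (a : Fin 2) : flipM a ∈ Matrix.unitaryGroup (Fin 2) ℂ := by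
  rw [Matrix.mem_unitaryGroup_iff, star_flipM, flipM_mul, fin_two_add_self, flipM_zero]

theorem hadM_mem : hadM ∈ Matrix.unitaryGroup (Fin 2) ℂ := by
  rw [Matrix.mem_unitaryGroup_iff]
  have h : ((√2 : ℝ) : ℂ)⁻¹ * ((√2 : ℝ) : ℂ)⁻¹ = 1 / 2 := by
    rw [← mul_inv, ← Complex.ofReal_mul, Real.mul_self_sqrt (by norm_num)]
    norm_num
  ext i j
  fin_cases i <;> fin_cases j <;>
    simp [hadM, Matrix.mul_apply, Fin.sum_univ_two, Matrix.star_apply, h] <;> norm_num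

theorem sqrtNotM_mul_self : sqrtNotM * sqrtNotM = flipM 1 := by
  ext i j
  fin_cases i <;> fin_cases j <;>
    simp [sqrtNotM, flipM, Matrix.mul_apply, Fin.sum_univ_two] <;> ring_nf <;>
    simp <;> norm_num

theorem sqrtNotM_mem : sqrtNotM ∈ Matrix.unitaryGroup (Fin 2) ℂ := by
  rw [Matrix.mem_unitaryGroup_iff]
  ext i j
  fin_cases i <;> fin_cases j <;>
    simp [sqrtNotM, Matrix.mul_apply, Fin.sum_univ_two, Matrix.star_apply, Complex.conj_ofNat] <;>
    ring_nf <;> simp <;> norm_num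

theorem smul_one_mem {z : ℂ} (h : z * star z = 1) :
    z • (1 : Matrix (Fin 2) (Fin 2) ℂ) ∈ Matrix.unitaryGroup (Fin 2) ℂ := by
  rw [Matrix.mem_unitaryGroup_iff, star_smul, star_one, smul_mul_smul_comm, h, mul_one, one_smul]

/-- The two-qubit operator that applies `R b` to the second qubit if the first qubit is `b`. -/
def ctrlM (R : Fin 2 → Matrix (Fin 2) (Fin 2) ℂ) : Matrix (Fin 2 → Fin 2) (Fin 2 → Fin 2) ℂ :=
  Matrix.of fun x y => if x 0 = y 0 then R (y 0) (x 1) (y 1) else 0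

/-- The operator is block diagonal in the control bit, with unitary blocks. -/
theorem ctrlM_mem {R : Fin 2 → Matrix (Fin 2) (Fin 2) ℂ}
    (hR : ∀ b, R b ∈ Matrix.unitaryGroup (Fin 2) ℂ) :
    ctrlM R ∈ Matrix.unitaryGroup (Fin 2 → Fin 2) ℂ := by
  rw [Matrix.mem_unitaryGroup_iff]
  ext x y
  have h := congrFun (congrFun (Matrix.mem_unitaryGroup_iff.1 (hR (x 0))) (x 1)) (y 1)
  have hx : x = y ↔ x 0 = y 0 ∧ x 1 = y 1 := by simp [funext_iff, Fin.forall_fin_two]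
  rw [Matrix.mul_apply, ← (finTwoArrowEquiv (Fin 2)).symm.sum_comp, Fintype.sum_prod_type]
  rw [Matrix.mul_apply] at h
  simp only [ctrlM, Matrix.star_apply, Matrix.of_apply, finTwoArrowEquiv_symm_apply,
    Matrix.cons_val_zero, Matrix.cons_val_one, Matrix.one_apply, hx] at h ⊢
  by_cases h0 : x 0 = y 0
  · simp only [h0, true_and] at h ⊢
    rw [← h, Finset.sum_eq_single (y 0)]
    · simp
    · intro a _ ha
      simp [ha.symm]
    · simp
  · simp only [h0, false_and, if_false]
    refine Finset.sum_eq_zero fun a _ => Finset.sum_eq_zero fun b _ => ?_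
    by_cases h1 : x 0 = a
    · have : ¬ y 0 = a := fun h2 => h0 (h1.trans h2.symm)
      simp [this]
    · simp [h1]

variable {s : Type} {m : ℕ} {ι : Type} [Fintype ι] [DecidableEq ι]
variable (A : s → Matrix (Fin (2 ^ m)) (Fin (2 ^ m)) ℝ)

theorem mux_apply (w : ι) (R : (ι → Fin 2) → Matrix (Fin 2) (Fin 2) ℂ) (x y : ι → Fin 2) :
    mux w R x y = if ∀ i, i ≠ w → x i = y i then R y (x w) (y w) else 0 := by
  simp only [mux, Matrix.of_apply]
  split_ifs with h
  · rw [Finset.sum_eq_single (x w)]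
    · rw [if_pos]
      funext i
      by_cases hi : i = w
      · subst hi; simp
      · simp [Function.update_of_ne hi, h i hi]
    · intro b _ hb
      rw [if_neg]
      rintro h1
      apply hb
      rw [h1, Function.update_self]
    · simp
  · refine Finset.sum_eq_zero fun b _ => if_neg ?_
    rintro rfl
    exact h fun i hi => Function.update_of_ne hi _ _

theorem mux_one (w : ι) : mux w (fun _ => 1) = 1 := by
  have : (fun _ : ι → Fin 2 => (1 : Matrix (Fin 2) (Fin 2) ℂ)) = fun _ => flipM 0 := by
    rw [flipM_zero]
  rw [this, mux_eq_permMat w fun _ => 0]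
  ext x y
  simp [permMat, Matrix.one_apply]

/-- The two wires `v` and `w`. -/
def pairEmb (v w : ι) (h : v ≠ w) : Fin 2 ↪ ι where
  toFun c := if c = 0 then v else w
  inj' a b := by
    have h' := h.symm
    revert a b
    simp [Fin.forall_fin_two, h, h']

open Classical in
/-- The wire `v` controls which of two unitary operators acts on the wire `w`. -/
def cgate (v w : ι) (R : Fin 2 → Matrix (Fin 2) (Fin 2) ℂ) : QCircuit s m ι :=
  if h : v ≠ w ∧ ∀ b, R b ∈ Matrix.unitaryGroup (Fin 2) ℂ then
    [QOp.gate 2 le_rfl (pairEmb v w h.1) ⟨ctrlM R, ctrlM_mem h.2⟩]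
  else []

theorem matrix_cgate {v w : ι} (hvw : v ≠ w) {R : Fin 2 → Matrix (Fin 2) (Fin 2) ℂ}
    (hR : ∀ b, R b ∈ Matrix.unitaryGroup (Fin 2) ℂ) :
    QCircuit.matrix A (cgate v w R) = mux w fun y => R (y v) := by
  rw [cgate, dif_pos ⟨hvw, hR⟩, QCircuit.matrix_singleton]
  have h0 : pairEmb v w hvw 0 = v := rfl
  have h1 : pairEmb v w hvw 1 = w := rfl
  ext x y
  simp only [QOp.matrix, gateMatrix, Matrix.of_apply, mux_apply, ctrlM, Fin.forall_fin_two, h0, h1]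
  by_cases h : x v = y v
  · rw [if_pos h]
    refine if_congr (forall_congr' fun i => ⟨fun h1 h2 => ?_, fun h1 h2 => h1 h2.2.symm⟩) rfl rfl
    by_cases h3 : v = i
    · exact h3 ▸ h
    · exact h1 ⟨h3, h2.symm⟩
  · rw [if_neg h, ite_self, if_neg fun h2 => h (h2 v hvw)]

theorem time_cgate_le (v w : ι) (R : Fin 2 → Matrix (Fin 2) (Fin 2) ℂ) :
    QCircuit.time (cgate v w R : QCircuit s m ι) ≤ 1 := by
  unfold cgate
  split_ifs <;> simp [QCircuit.time, QOp.time]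

/-- The controlled NOT gate. -/
def cnot (v w : ι) : QCircuit s m ι := cgate v w flipM

/-- The NOT gate on `w`; the wire `v` plays no role. -/
def notGate (v w : ι) : QCircuit s m ι := cgate v w fun _ => flipM 1

/-- The Toffoli gate. -/
def toffoli (u v w : ι) : QCircuit s m ι :=
  cgate v w (fun b => if b = 1 then sqrtNotM else 1) ++
    (QCircuit.conj (cnot u v) (cgate v w fun b => if b = 1 then star sqrtNotM else 1) ++
      cgate u w fun b => if b = 1 then sqrtNotM else 1)

theorem matrix_cnot {v w : ι} (h : v ≠ w) :
    QCircuit.matrix A (cnot v w) = mux w fun y => flipM (y v) :=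
  matrix_cgate A h flipM_mem

theorem matrix_notGate {v w : ι} (h : v ≠ w) :
    QCircuit.matrix A (notGate v w) = mux w fun _ => flipM 1 :=
  matrix_cgate A h fun _ => flipM_mem 1

theorem ite_one_mem {U : Matrix (Fin 2) (Fin 2) ℂ} (hU : U ∈ Matrix.unitaryGroup (Fin 2) ℂ)
    (b : Fin 2) : (if b = 1 then U else 1) ∈ Matrix.unitaryGroup (Fin 2) ℂ := by
  split_ifs
  · exact hU
  · exact one_mem _

/-- With `S` a square root of NOT, the three controlled gates apply `S` to the power `u + v - (u ⊕
v) = 2uv`. -/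
theorem matrix_toffoli {u v w : ι} (huv : u ≠ v) (huw : u ≠ w) (hvw : v ≠ w) :
    QCircuit.matrix A (toffoli u v w) = mux w fun y => flipM (y u * y v) := by
  have hs : star sqrtNotM ∈ Matrix.unitaryGroup (Fin 2) ℂ := 
    Unitary.star_mem sqrtNotM_mem
  have h2 := QCircuit.matrix_conj A (p := cnot u v) (π := fun y => Function.update y v (y v + y u))
    (by rw [matrix_cnot A huv, mux_eq_permMat]) (w := w) (fun y b => by
      rw [Function.update_comm hvw]
      simp [Function.update_of_ne huw, Function.update_of_ne hvw])
    (matrix_cgate A hvw (ite_one_mem hs))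
  rw [toffoli, QCircuit.matrix_append, QCircuit.matrix_append, h2,
    matrix_cgate A hvw (ite_one_mem sqrtNotM_mem), matrix_cgate A huw (ite_one_mem sqrtNotM_mem),
    mux_mul, mux_mul]
  · congr 1
    funext y
    have h1 : star sqrtNotM * sqrtNotM = 1 := Matrix.mem_unitaryGroup_iff'.1 sqrtNotM_mem
    have h3 : sqrtNotM * star sqrtNotM = 1 := Matrix.mem_unitaryGroup_iff.1 sqrtNotM_mem
    simp only [Function.comp, Function.update_self]
    generalize y u = a
    generalize y v = b
    revert a b
    simp [Fin.forall_fin_two, h1, h3, sqrtNotM_mul_self, flipM_zero]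
  · intro y b
    simp [Function.update_of_ne huw, Function.update_of_ne hvw]
  · intro y b
    simp [Function.update_of_ne huw]

theorem time_cnot_le (v w : ι) : QCircuit.time (cnot v w : QCircuit s m ι) ≤ 1 :=
  time_cgate_le _ _ _

theorem time_notGate_le (v w : ι) : QCircuit.time (notGate v w : QCircuit s m ι) ≤ 1 :=
  time_cgate_le _ _ _

theorem time_toffoli_le (u v w : ι) : QCircuit.time (toffoli u v w : QCircuit s m ι) ≤ 5 := by
  have h1 := time_cgate_le (s := s) (m := m) v w (fun b => if b = 1 then sqrtNotM else 1)
  have h2 := time_cgate_le (s := s) (m := m) v w (fun b => if b = 1 then star sqrtNotM else 1)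
  have h3 := time_cgate_le (s := s) (m := m) u w (fun b => if b = 1 then sqrtNotM else 1)
  have h4 := time_cnot_le (s := s) (m := m) u v
  rw [toffoli, QCircuit.time_append, QCircuit.time_append, QCircuit.time_conj]
  omega

/-- Gates that add `f y l` to the wires `T l`, where `f` does not depend on these wires. -/
theorem matrix_flatMap_flip {b : ℕ} {T : Fin b → ι} {f : (ι → Fin 2) → Fin b → Fin 2}
    (hf : ∀ l, Ignores f (T l)) {c : Fin b → QCircuit s m ι}
    (hc : ∀ l, QCircuit.matrix A (c l) = mux (T l) fun y => flipM (f y l)) :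
    QCircuit.matrix A ((List.finRange b).flatMap c) = permMat (xorLayer T f) := by
  have h : ∀ L : List (Fin b), QCircuit.matrix A (L.flatMap c) = permMat fun y i =>
      y i + (L.map fun l => if T l = i then f y l else 0).sum := by
    intro L
    induction L with
    | nil =>
      ext x y
      simp [QCircuit.matrix, permMat, Matrix.one_apply]
    | cons l L ih =>
      rw [List.flatMap_cons, QCircuit.matrix_append, ih, hc, mux_eq_permMat, permMat_mul]
      congr 1
      funext y i
      simp only [Function.comp, hf l y, List.map_cons, List.sum_cons, ← add_assoc]
      congr 1
      by_cases hi : i = T l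
      · subst hi; simp
      · simp [Function.update_of_ne hi, Ne.symm hi]
  rw [h]
  rfl

/-- Rotates `w` by the sum of the angles `θ l` with `D l` set. -/
def wordRot {b : ℕ} (D : Fin b → ι) (w : ι) (θ : Fin b → ℝ) : QCircuit s m ι :=
  (List.finRange b).flatMap fun l => cgate (D l) w fun x => rotM (if x = 1 then θ l else 0)

/-- Rotations in one plane add their angles, so one controlled gate per bit rotates by the value of
a binary word. -/
theorem matrix_wordRot {b : ℕ} {D : Fin b → ι} {w : ι} (hD : ∀ l, D l ≠ w) (θ : Fin b → ℝ) :
    QCircuit.matrix A (wordRot D w θ) =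
      mux w fun y => rotM (∑ l, if y (D l) = 1 then θ l else 0) := by
  have h : ∀ L : List (Fin b), QCircuit.matrix A (L.flatMap fun l => cgate (D l) w fun x =>
      rotM (if x = 1 then θ l else 0)) =
      mux w fun y => rotM (L.map fun l => if y (D l) = 1 then θ l else 0).sum := by
    intro L
    induction L with
    | nil => simp [QCircuit.matrix, rotM_zero, mux_one]
    | cons l L ih =>
      rw [List.flatMap_cons, QCircuit.matrix_append, ih, matrix_cgate A (hD l) fun _ => rotM_mem _,
        mux_mul]
      · congr 1
        funext y
        rw [rotM_mul, List.map_cons, List.sum_cons, add_comm]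
      · intro y b
        simp [Function.update_of_ne (hD _)]
  rw [wordRot, h]
  simp only [Fin.sum_univ_def]

theorem time_wordRot_le {b : ℕ} (D : Fin b → ι) (w : ι) (θ : Fin b → ℝ) :
    QCircuit.time (wordRot D w θ : QCircuit s m ι) ≤ b := by
  have := QCircuit.time_flatMap_le (List.finRange b) (fun l => (cgate (D l) w fun x =>
    rotM (if x = 1 then θ l else 0) : QCircuit s m ι)) 1 fun _ _ => time_cgate_le _ _ _
  simpa [wordRot] using this

end Gates

/-! ### Comparison of registers -/

section Comparison

theorem regVal_div_mod {m : ℕ} (p : Fin m → Fin 2) (l : Fin m) :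
    (regVal p : ℕ) / 2 ^ (l : ℕ) % 2 = p l := by
  have h : finFunctionFinEquiv.symm (finFunctionFinEquiv p) l = p l := by
    rw [Equiv.symm_apply_apply]
  exact congrArg Fin.val h

/-- The bit that tells whether `p` is less than `q` as an integer. -/
def ltBit {m : ℕ} (p q : Fin m → Fin 2) : Fin 2 := if regVal p < regVal q then 1 else 0

/-- The next bit in the comparison of two integers. -/
def cmpBit (i j b : Fin 2) : Fin 2 := i * j + i * b + j * b + b + j

/-- When the bits differ, they decide the comparison and `j = 1` means that the first integer is
smaller; otherwise the verdict `b` on the lower bits stands. The polynomial form splits into Toffoli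
and CNOT gates. -/
theorem cmpBit_eq (i j b : Fin 2) : cmpBit i j b = if i = j then b else j := by
  revert i j b; decide

variable {s : Type} {m : ℕ} {ι : Type} [Fintype ι] [DecidableEq ι]
variable (A : s → Matrix (Fin (2 ^ m)) (Fin (2 ^ m)) ℝ)

/-- Adds `cmpBit i j b` to `b'`. -/
def cmpStep (i j b b' : ι) : QCircuit s m ι :=
  toffoli i j b' ++ (toffoli i b b' ++ (toffoli j b b' ++ (cnot b b' ++ cnot j b')))

theorem matrix_cmpStep {i j b b' : ι} (hij : i ≠ j) (hib : i ≠ b) (hjb : j ≠ b) (hi : i ≠ b')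
    (hj : j ≠ b') (hb : b ≠ b') : QCircuit.matrix A (cmpStep i j b b') =
      permMat fun y => Function.update y b' (y b' + cmpBit (y i) (y j) (y b)) := by
  simp only [cmpStep, QCircuit.matrix_append, matrix_toffoli A hij hi hj,
    matrix_toffoli A hib hi hb, matrix_toffoli A hjb hj hb, matrix_cnot A hb, matrix_cnot A hj]
  have h : ∀ v, v ≠ b' → ∀ (y : ι → Fin 2) a, Function.update y b' a v = y v :=
    fun v hv y a => Function.update_of_ne hv _ _
  rw [mux_mul, mux_mul, mux_mul, mux_mul, ← mux_eq_permMat]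
  · congr 1
    funext y
    simp only [flipM_mul, cmpBit]
    congr 1
    abel
  all_goals
    intro y a
    simp only [h _ hi, h _ hj, h _ hb]

theorem time_cmpStep_le (i j b b' : ι) :
    QCircuit.time (cmpStep i j b b' : QCircuit s m ι) ≤ 17 := by
  have h1 := time_toffoli_le (s := s) (m := m) i j b'
  have h2 := time_toffoli_le (s := s) (m := m) i b b'
  have h3 := time_toffoli_le (s := s) (m := m) j b b'
  have h4 := time_cnot_le (s := s) (m := m) b b'
  have h5 := time_cnot_le (s := s) (m := m) j b'
  simp only [cmpStep, QCircuit.time_append]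
  omega

variable (I J : Fin m → ι) (B : Fin (m + 1) → ι)

/-- Writes into `B` the results of the comparisons of the lowest bits of `I` and `J`. -/
def cmpChain : (k : ℕ) → k ≤ m → QCircuit s m ι
  | 0, _ => []
  | k + 1, h => cmpChain k (Nat.le_of_succ_le h) ++
      cmpStep (I ⟨k, h⟩) (J ⟨k, h⟩) (B ⟨k, Nat.lt_succ_of_lt h⟩) (B ⟨k + 1, Nat.succ_lt_succ h⟩)

/-- The action of `cmpChain` on basis states. -/
def cmpMap : (k : ℕ) → k ≤ m → (ι → Fin 2) → ι → Fin 2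
  | 0, _, y => y
  | k + 1, h, y => let z := cmpMap k (Nat.le_of_succ_le h) y
    Function.update z (B ⟨k + 1, Nat.succ_lt_succ h⟩) (z (B ⟨k + 1, Nat.succ_lt_succ h⟩) +
      cmpBit (z (I ⟨k, h⟩)) (z (J ⟨k, h⟩)) (z (B ⟨k, Nat.lt_succ_of_lt h⟩)))

/-- The wires of a comparison are distinct. -/
structure CmpWires : Prop where
  ij : ∀ l k, I l ≠ J k
  ib : ∀ l k, I l ≠ B k
  jb : ∀ l k, J l ≠ B k
  inj : Function.Injective B

variable {I J B}

theorem CmpWires.symm (h : CmpWires I J B) : CmpWires J I B :=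
  ⟨fun l k => (h.ij k l).symm, h.jb, h.ib, h.inj⟩

theorem matrix_cmpChain (h : CmpWires I J B) (k : ℕ) (hk : k ≤ m) :
    QCircuit.matrix A (cmpChain I J B k hk) = permMat (cmpMap I J B k hk) := by
  induction k with
  | zero =>
    ext x y
    by_cases hxy : x = y <;> simp [cmpChain, cmpMap, QCircuit.matrix, permMat, hxy]
  | succ k ih =>
    rw [cmpChain, QCircuit.matrix_append, ih, matrix_cmpStep A (h.ij _ _) (h.ib _ _) (h.jb _ _)
      (h.ib _ _) (h.jb _ _) (h.inj.ne (by simp)), permMat_mul]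
    rfl

theorem time_cmpChain_le (k : ℕ) (hk : k ≤ m) :
    QCircuit.time (cmpChain I J B k hk : QCircuit s m ι) ≤ 17 * k := by
  induction k with
  | zero => simp [cmpChain, QCircuit.time]
  | succ k ih =>
    rw [cmpChain, QCircuit.time_append, Nat.mul_succ]
    exact add_le_add (ih _) (time_cmpStep_le _ _ _ _)

theorem cmpMap_apply_of_ne {i : ι} (hi : ∀ l, i ≠ B l) (k : ℕ) (hk : k ≤ m) (y : ι → Fin 2) :
    cmpMap I J B k hk y i = y i := by
  induction k with
  | zero => rfl
  | succ k ih => rw [cmpMap, Function.update_of_ne (hi _), ih]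

theorem cmpMap_update {w : ι} (hI : ∀ l, I l ≠ w) (hJ : ∀ l, J l ≠ w) (hB : ∀ l, B l ≠ w)
    (k : ℕ) (hk : k ≤ m) (y : ι → Fin 2) (a : Fin 2) :
    cmpMap I J B k hk (Function.update y w a) = Function.update (cmpMap I J B k hk y) w a := by
  induction k with
  | zero => rfl
  | succ k ih =>
    simp only [cmpMap, ih, Function.update_of_ne (hI _), Function.update_of_ne (hJ _),
      Function.update_of_ne (hB _)]
    rw [Function.update_comm (hB _)]

theorem cmpMap_apply_above (h : CmpWires I J B) (k : ℕ) (hk : k ≤ m) (y : ι → Fin 2)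
    (l : Fin (m + 1)) (hl : k < l) : cmpMap I J B k hk y (B l) = y (B l) := by
  induction k with
  | zero => rfl
  | succ k ih =>
    rw [cmpMap, Function.update_of_ne, ih _ (by omega)]
    refine h.inj.ne fun h1 => ?_
    rw [h1] at hl
    exact lt_irrefl _ hl

/-- Induction from the least significant bit upwards: the target of step `k` is still zero, so it
receives exactly the updated verdict. -/
theorem cmpMap_apply_self (h : CmpWires I J B) (k : ℕ) (hk : k ≤ m) (y : ι → Fin 2)
    (hy : ∀ l, y (B l) = 0) : cmpMap I J B k hk y (B ⟨k, Nat.lt_succ_of_le hk⟩) =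
      if (regVal fun l => y (I l) : ℕ) % 2 ^ k < (regVal fun l => y (J l) : ℕ) % 2 ^ k
        then 1 else 0 := by
  induction k with
  | zero => simp [cmpMap, hy, Nat.mod_one]
  | succ k ih =>
    have hi := regVal_div_mod (fun l => y (I l)) ⟨k, hk⟩
    have hj := regVal_div_mod (fun l => y (J l)) ⟨k, hk⟩
    simp only at hi hj
    rw [cmpMap, Function.update_self, ih, cmpMap_apply_above h _ _ _ _ (by simp), hy, zero_add,
      cmpMap_apply_of_ne (h.ib _), cmpMap_apply_of_ne (h.jb _), cmpBit_eq, Nat.mod_pow_succ,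
      Nat.mod_pow_succ, hi, hj]
    have h1 := Nat.mod_lt (regVal fun l => y (I l) : ℕ) (Nat.two_pow_pos k)
    have h2 := Nat.mod_lt (regVal fun l => y (J l) : ℕ) (Nat.two_pow_pos k)
    generalize (regVal fun l => y (I l) : ℕ) % 2 ^ k = a at *
    generalize (regVal fun l => y (J l) : ℕ) % 2 ^ k = b at *
    generalize y (I ⟨k, hk⟩) = c
    generalize y (J ⟨k, hk⟩) = d
    generalize 2 ^ k = e at *
    revert c d
    simp only [Fin.forall_fin_two]
    refine ⟨⟨?_, ?_⟩, ?_, ?_⟩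
    · simp
    · simp; omega
    · simp; omega
    · simp

theorem cmpMap_apply_last (h : CmpWires I J B) (y : ι → Fin 2) (hy : ∀ l, y (B l) = 0) :
    cmpMap I J B m le_rfl y (B (Fin.last m)) =
      ltBit (fun l => y (I l)) (fun l => y (J l)) := by
  have := cmpMap_apply_self h m le_rfl y hy
  rw [Nat.mod_eq_of_lt (Fin.is_lt _), Nat.mod_eq_of_lt (Fin.is_lt _)] at this
  exact this

end Comparison

/-! ### The isometry onto symmetric pairs -/

section Symmetrizer

variable {s : Type} {m : ℕ} {ι : Type} [Fintype ι] [DecidableEq ι]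
variable (A : s → Matrix (Fin (2 ^ m)) (Fin (2 ^ m)) ℝ)
variable (I J : Fin m → ι) (B : Fin (m + 1) → ι) (c : ι)

/-- Swaps the registers `I` and `J` if the wire `c` is set. -/
def ctrlSwap : QCircuit s m ι :=
  (List.finRange m).flatMap (fun l => cnot (I l) (J l)) ++
    ((List.finRange m).flatMap (fun l => toffoli c (J l) (I l)) ++
      (List.finRange m).flatMap (fun l => cnot (I l) (J l)))

/-- The action of `ctrlSwap` on basis states. -/
def ctrlSwapMap (y : ι → Fin 2) : ι → Fin 2 :=
  xorLayer J (fun y l => y (I l)) (xorLayer I (fun y l => y c * y (J l))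
    (xorLayer J (fun y l => y (I l)) y))

/-- Maps `|i⟩|j⟩` with the wire `c` in `|0⟩` to the symmetrized basis vector if `j ≤ i`, and sets
`c` if `i < j`. -/
def symmetrizer : QCircuit s m ι :=
  QCircuit.conj (cmpChain J I B m le_rfl)
      (cgate (B (Fin.last m)) c fun b => if b = 1 then hadM else 1) ++
    (ctrlSwap I J c ++ QCircuit.conj (cmpChain I J B m le_rfl) (cnot (B (Fin.last m)) c))

/-- The wires of `symmetrizer` are distinct. -/
structure SymWires : Prop extends CmpWires I J B where
  injI : Function.Injective I
  injJ : Function.Injective J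
  ic : ∀ l, I l ≠ c
  jc : ∀ l, J l ≠ c
  bc : ∀ l, B l ≠ c

variable {I J B c}

theorem matrix_ctrlSwap (h : SymWires I J B c) :
    QCircuit.matrix A (ctrlSwap I J c) = permMat (ctrlSwapMap I J c) := by
  have h1 : QCircuit.matrix A ((List.finRange m).flatMap fun l => cnot (I l) (J l)) =
      permMat (xorLayer J fun y l => y (I l)) := by
    refine matrix_flatMap_flip A (fun l y b => ?_) fun l => matrix_cnot A (h.ij l l)
    funext k
    exact Function.update_of_ne (h.ij k l) _ _
  have h2 : QCircuit.matrix A ((List.finRange m).flatMap fun l => toffoli c (J l) (I l)) =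
      permMat (xorLayer I fun y l => y c * y (J l)) := by
    refine matrix_flatMap_flip A (fun l y b => ?_) fun l =>
      matrix_toffoli A (h.jc l).symm (h.ic l).symm (h.ij l l).symm
    funext k
    rw [Function.update_of_ne (h.ic l).symm, Function.update_of_ne (h.ij l k).symm]
  rw [ctrlSwap, QCircuit.matrix_append, QCircuit.matrix_append, h1, h2, permMat_mul, permMat_mul]
  rfl

theorem ctrlSwapMap_apply_of_ne {i : ι} (hI : ∀ l, I l ≠ i) (hJ : ∀ l, J l ≠ i) (y : ι → Fin 2) :
    ctrlSwapMap I J c y i = y i := by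
  rw [ctrlSwapMap, xorLayer_apply_of_ne hJ, xorLayer_apply_of_ne hI, xorLayer_apply_of_ne hJ]

/-- With `c` set, the three additions `J += I`, `I += J`, `J += I` exchange the registers; with `c`
clear, the middle one is void and the outer two cancel. -/
theorem ctrlSwapMap_apply_left (h : SymWires I J B c) (y : ι → Fin 2) (l : Fin m) :
    ctrlSwapMap I J c y (I l) = if y c = 1 then y (J l) else y (I l) := by
  rw [ctrlSwapMap, xorLayer_apply_of_ne fun k => (h.ij l k).symm, xorLayer_apply_target h.injI,
    xorLayer_apply_target h.injJ, xorLayer_apply_of_ne fun k => (h.ij l k).symm,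
    xorLayer_apply_of_ne h.jc]
  generalize y c = a
  generalize y (I l) = b
  generalize y (J l) = d
  revert a b d; decide

theorem ctrlSwapMap_apply_right (h : SymWires I J B c) (y : ι → Fin 2) (l : Fin m) :
    ctrlSwapMap I J c y (J l) = if y c = 1 then y (I l) else y (J l) := by
  rw [ctrlSwapMap, xorLayer_apply_target h.injJ, xorLayer_apply_target h.injI,
    xorLayer_apply_of_ne fun k => h.ij k l, xorLayer_apply_target h.injJ,
    xorLayer_apply_of_ne fun k => (h.ij l k).symm,
    xorLayer_apply_of_ne h.jc]
  generalize y c = a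
  generalize y (I l) = b
  generalize y (J l) = d
  revert a b d; decide

/-- Each chain of comparison bits is erased right after use, so it enters only as a control on `c`.
-/
theorem matrix_symmetrizer (h : SymWires I J B c) :
    QCircuit.matrix A (symmetrizer I J B c) =
      mux c (fun y => flipM (cmpMap I J B m le_rfl y (B (Fin.last m)))) *
        permMat (ctrlSwapMap I J c) *
        mux c fun y => if cmpMap J I B m le_rfl y (B (Fin.last m)) = 1 then hadM else 1 := by
  rw [symmetrizer, QCircuit.matrix_append, QCircuit.matrix_append, matrix_ctrlSwap A h,
    QCircuit.matrix_conj A (matrix_cmpChain A h.toCmpWires m le_rfl)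
      (cmpMap_update h.ic h.jc h.bc m le_rfl) (matrix_cnot A (h.bc _)),
    QCircuit.matrix_conj A (matrix_cmpChain A h.toCmpWires.symm m le_rfl)
      (cmpMap_update h.jc h.ic h.bc m le_rfl) (matrix_cgate A (h.bc _) (ite_one_mem hadM_mem))]
  rfl

theorem time_symmetrizer_le :
    QCircuit.time (symmetrizer I J B c : QCircuit s m ι) ≤ 75 * m + 2 := by
  have h1 := time_cmpChain_le (s := s) (I := I) (J := J) (B := B) m le_rfl
  have h2 := time_cmpChain_le (s := s) (I := J) (J := I) (B := B) m le_rfl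
  have h3 := time_cgate_le (s := s) (m := m) (B (Fin.last m)) c fun b => if b = 1 then hadM else 1
  have h4 := time_cnot_le (s := s) (m := m) (B (Fin.last m)) c
  have h5 := QCircuit.time_flatMap_le (List.finRange m)
    (fun l => (cnot (I l) (J l) : QCircuit s m ι)) 1 fun _ _ => time_cnot_le _ _
  have h6 := QCircuit.time_flatMap_le (List.finRange m)
    (fun l => (toffoli c (J l) (I l) : QCircuit s m ι)) 5 fun _ _ => time_toffoli_le _ _ _
  rw [List.length_finRange] at h5 h6
  simp only [symmetrizer, ctrlSwap, QCircuit.time_append, QCircuit.time_conj]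
  omega

theorem fixes_symmetrizer (h : SymWires I J B c) {i : ι} (hI : ∀ l, I l ≠ i) (hJ : ∀ l, J l ≠ i)
    (hc : i ≠ c) : Fixes (QCircuit.matrix A (symmetrizer I J B c)) i := by
  rw [matrix_symmetrizer A h]
  exact ((Fixes.mux hc _).mul (Fixes.permMat (ctrlSwapMap_apply_of_ne hI hJ))).mul
    (Fixes.mux hc _)

theorem ctrlSwapMap_update_zero (h : SymWires I J B c) (y : ι → Fin 2) (hc : y c = 0) :
    ctrlSwapMap I J c y = y := by
  funext i
  by_cases hI : ∃ l, I l = i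
  · obtain ⟨l, rfl⟩ := hI
    simp [ctrlSwapMap_apply_left h, hc]
  by_cases hJ : ∃ l, J l = i
  · obtain ⟨l, rfl⟩ := hJ
    simp [ctrlSwapMap_apply_right h, hc]
  push Not at hI hJ
  exact ctrlSwapMap_apply_of_ne hI hJ y

/-- For `j < i` the Hadamard gate splits `c` into two branches, and the branch with `c` set has its
registers exchanged. There the order is now reversed, so the final comparison clears `c` again and
leaves an equal superposition of `y` and its exchange `y'`. For `i < j` there is no splitting and
the final comparison sets `c`; for `i = j` nothing happens. -/
theorem symmetrizer_apply (h : SymWires I J B c) {y y' : ι → Fin 2} (hB : ∀ l, y (B l) = 0)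
    (hc : y c = 0) (hI : ∀ l, y' (I l) = y (J l)) (hJ : ∀ l, y' (J l) = y (I l))
    (hy' : ∀ i, (∀ l, I l ≠ i) → (∀ l, J l ≠ i) → y' i = y i) (z : ι → Fin 2) :
    QCircuit.matrix A (symmetrizer I J B c) z y =
      if (regVal fun l => y (I l)) < (regVal fun l => y (J l)) then
        if z = Function.update y c 1 then 1 else 0
      else if (regVal fun l => y (J l)) < (regVal fun l => y (I l)) then
        ((1 / √2 : ℝ) : ℂ) * ((if z = y then 1 else 0) + if z = y' then 1 else 0)
      else if z = y then 1 else 0 := by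
  have hcI : ∀ (a : Fin 2) l, Function.update y c a (I l) = y (I l) := fun a l =>
    Function.update_of_ne (h.ic l) _ _
  have hcJ : ∀ (a : Fin 2) l, Function.update y c a (J l) = y (J l) := fun a l =>
    Function.update_of_ne (h.jc l) _ _
  have h0 : ctrlSwapMap I J c (Function.update y c 0) = y := by
    rw [ctrlSwapMap_update_zero h _ (Function.update_self _ _ _), ← hc, Function.update_eq_self]
  have hy'c : y' c = 0 := by rw [hy' c h.ic h.jc, hc]
  have hy'B : ∀ l, y' (B l) = 0 := fun l => by
    rw [hy' (B l) (fun k => h.ib k l) (fun k => h.jb k l), hB]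
  have h1 : ctrlSwapMap I J c (Function.update y c 1) = Function.update y' c 1 := by
    funext i
    by_cases hI' : ∃ l, I l = i
    · obtain ⟨l, rfl⟩ := hI'
      simp [ctrlSwapMap_apply_left h, Function.update_of_ne (h.ic l), hI, hcJ]
    by_cases hJ' : ∃ l, J l = i
    · obtain ⟨l, rfl⟩ := hJ'
      simp [ctrlSwapMap_apply_right h, Function.update_of_ne (h.jc l), hJ, hcI]
    push Not at hI' hJ'
    rw [ctrlSwapMap_apply_of_ne hI' hJ']
    by_cases hi : i = c
    · subst hi; simp
    · rw [Function.update_of_ne hi, Function.update_of_ne hi, hy' i hI' hJ']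
  rw [matrix_symmetrizer A h, mul_mux_apply, Fin.sum_univ_two, mul_permMat_apply,
    mul_permMat_apply, h0, h1, mux_eq_permMat, cmpMap_apply_last h.toCmpWires.symm y hB, hc]
  have hy1B : ∀ l, Function.update y' c 1 (B l) = 0 := fun l => by
    rw [Function.update_of_ne (h.bc l), hy'B]
  have hy1I : ∀ l, Function.update y' c 1 (I l) = y (J l) := fun l => by
    rw [Function.update_of_ne (h.ic l), hI]
  have hy1J : ∀ l, Function.update y' c 1 (J l) = y (I l) := fun l => by
    rw [Function.update_of_ne (h.jc l), hJ]
  simp only [permMat, Matrix.of_apply, cmpMap_apply_last h.toCmpWires y hB,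
    cmpMap_apply_last h.toCmpWires _ hy1B, hc, hy1I, hy1J, Function.update_self,
    Function.update_idem, zero_add]
  by_cases h3 : (regVal fun l => y (I l)) < (regVal fun l => y (J l))
  · simp [ltBit, h3, h3.not_gt]
  · rw [if_neg h3]
    have h4 : ltBit (fun l => y (I l)) (fun l => y (J l)) = 0 := if_neg h3
    have h5 : Function.update y c 0 = y := by rw [← hc, Function.update_eq_self]
    have h6 : Function.update y' c 0 = y' := by rw [← hy'c, Function.update_eq_self]
    rw [h4, h5]
    by_cases h7 : (regVal fun l => y (J l)) < (regVal fun l => y (I l))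
    · have h8 : ltBit (fun l => y (J l)) (fun l => y (I l)) = 1 := if_pos h7
      have h9 : (1 : Fin 2) + 1 = 0 := rfl
      rw [if_pos h7, h8, if_pos rfl, h9, h6]
      simp [hadM, mul_add]
    · have h8 : ltBit (fun l => y (J l)) (fun l => y (I l)) = 0 := if_neg h7
      rw [if_neg h7, h8]
      simp

end Symmetrizer

/-! ### Sequences of operators on distinct wires -/

section Sequences

variable {ι : Type} [Fintype ι] [DecidableEq ι]

/-- The product of a list of controlled operators; the head acts first. -/
def seqMat : List (ι × ((ι → Fin 2) → Matrix (Fin 2) (Fin 2) ℂ)) →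
    Matrix (ι → Fin 2) (ι → Fin 2) ℂ
  | [] => 1
  | p :: l => seqMat l * mux p.1 p.2

/-- The targets are distinct, and no operator depends on its own target or on a later one. -/
def SeqOK (l : List (ι × ((ι → Fin 2) → Matrix (Fin 2) (Fin 2) ℂ))) : Prop :=
  l.Pairwise (fun p q => p.1 ≠ q.1 ∧ Ignores p.2 q.1) ∧ ∀ p ∈ l, Ignores p.2 p.1

theorem Ignores.eq_of_forall {α : Type*} {R : (ι → Fin 2) → α} (ws : List ι)
    (h : ∀ w ∈ ws, Ignores R w) {x y : ι → Fin 2} (hxy : ∀ i, i ∉ ws → x i = y i) : R x = R y := by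
  induction ws generalizing x with
  | nil => exact congrArg R (funext fun i => hxy i List.not_mem_nil)
  | cons w ws ih =>
    rw [← h w List.mem_cons_self x (y w)]
    refine ih (fun v hv => h v (List.mem_cons_of_mem _ hv)) fun i hi => ?_
    by_cases hiw : i = w
    · subst hiw; simp
    · rw [Function.update_of_ne hiw]
      exact hxy i (by simp [hi, hiw])

/-- When an operator acts, the current state differs from the final state `x` only on its own target
and on later ones, which it ignores. All controls can therefore be evaluated at `x`, and each target
contributes one 2 × 2 entry. -/
theorem seqMat_apply (l : List (ι × ((ι → Fin 2) → Matrix (Fin 2) (Fin 2) ℂ))) (hl : SeqOK l)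
    (x y : ι → Fin 2) : seqMat l x y =
      if ∀ i, i ∉ l.map Prod.fst → x i = y i then
        (l.map fun p => p.2 x (x p.1) (y p.1)).prod else 0 := by
  induction l generalizing y with
  | nil => simp [seqMat, Matrix.one_apply, funext_iff]
  | cons p l ih =>
    have hl' : SeqOK l := ⟨hl.1.of_cons, fun q hq => hl.2 q (List.mem_cons_of_mem _ hq)⟩
    have hp := (List.pairwise_cons.1 hl.1).1
    have hpl : p.1 ∉ l.map Prod.fst := fun h => by
      obtain ⟨q, hq, hqp⟩ := List.mem_map.1 h
      exact (hp q hq).1 hqp.symm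
    rw [seqMat, mul_mux_apply]
    simp only [ih hl']
    have hy : ∀ b, (l.map fun q => q.2 x (x q.1) (Function.update y p.1 b q.1)) =
        l.map fun q => q.2 x (x q.1) (y q.1) := fun b => List.map_congr_left fun q hq => by
      rw [Function.update_of_ne (hp q hq).1.symm]
    simp only [hy]
    -- No later operator targets `p.1`, so the first one must already give it its final value.
    rw [Finset.sum_eq_single (x p.1)]
    · by_cases h : ∀ i, i ∉ (p :: l).map Prod.fst → x i = y i
      · rw [if_pos h, if_pos, List.map_cons, List.prod_cons, mul_comm]
        · congr 1
          refine congrFun (congrFun ?_ _) _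
          refine (Ignores.eq_of_forall ((p :: l).map Prod.fst) ?_ h).symm
          intro w hw
          obtain ⟨q, hq, rfl⟩ := List.mem_map.1 hw
          rcases List.mem_cons.1 hq with rfl | hq
          · exact hl.2 q List.mem_cons_self
          · exact (hp q hq).2
        · intro i hi
          by_cases hip : i = p.1
          · subst hip; simp
          · rw [Function.update_of_ne hip]
            refine h i ?_
            rw [List.map_cons, List.mem_cons]
            tauto
      · rw [if_neg h, if_neg, zero_mul]
        intro h1
        refine h fun i hi => ?_
        rw [List.map_cons, List.mem_cons, not_or] at hi
        rw [h1 i hi.2, Function.update_of_ne hi.1]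
    · intro b _ hb
      rw [if_neg, zero_mul]
      intro h1
      have := h1 p.1 hpl
      rw [Function.update_self] at this
      exact hb this.symm
    · simp

theorem Fixes.seqMat {l : List (ι × ((ι → Fin 2) → Matrix (Fin 2) (Fin 2) ℂ))} {i : ι}
    (h : i ∉ l.map Prod.fst) : Fixes (seqMat l) i := by
  induction l with
  | nil => exact Fixes.one i
  | cons p l ih =>
    rw [List.map_cons, List.mem_cons, not_or] at h
    exact (ih h.2).mul (Fixes.mux h.1 _)

theorem seqMat_append (l l' : List (ι × ((ι → Fin 2) → Matrix (Fin 2) (Fin 2) ℂ))) :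
    seqMat (l ++ l') = seqMat l' * seqMat l := by
  induction l with
  | nil => simp [seqMat]
  | cons p l ih => rw [List.cons_append, seqMat, seqMat, ih, Matrix.mul_assoc]

theorem matrix_flatMap_eq_seqMat {s : Type} {m : ℕ}
    (A : s → Matrix (Fin (2 ^ m)) (Fin (2 ^ m)) ℝ) {α : Type*} (L : List α)
    (c : α → QCircuit s m ι) (p : α → ι × ((ι → Fin 2) → Matrix (Fin 2) (Fin 2) ℂ))
    (h : ∀ a, QCircuit.matrix A (c a) = mux (p a).1 (p a).2) :
    QCircuit.matrix A (L.flatMap c) = seqMat (L.map p) := by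
  induction L with
  | nil => rfl
  | cons a L ih => rw [List.flatMap_cons, QCircuit.matrix_append, ih, h, List.map_cons, seqMat]

end Sequences

/-! ### Nodes of the trees -/

section Nodes

variable {m : ℕ}

/-- The node at depth `d` above the leaf whose address is held by the register. -/
def nodeVal (p : Fin m → Fin 2) (d : ℕ) : ℕ := (2 ^ m + (regVal p : ℕ)) / 2 ^ (m - d)

theorem regVal_eq_of_bits {k : ℕ} (a : Fin k → Fin 2) (t : ℕ) (ht : t < 2 ^ k)
    (h : ∀ l : Fin k, t / 2 ^ (l : ℕ) % 2 = a l) : (regVal a : ℕ) = t := by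
  have : a = finFunctionFinEquiv.symm ⟨t, ht⟩ := by
    funext l
    exact Fin.ext (h l).symm
  rw [regVal, this, Equiv.apply_symm_apply]

theorem two_pow_add_div_mod {n j e : ℕ} (he : e < n) :
    (2 ^ n + j) / 2 ^ e % 2 = j / 2 ^ e % 2 := by
  obtain ⟨k, rfl⟩ : ∃ k, n = e + (k + 1) := ⟨n - e - 1, by omega⟩
  rw [pow_add, Nat.mul_add_div (by positivity), pow_succ]
  omega

theorem nodeVal_lt (p : Fin m → Fin 2) (d : ℕ) : nodeVal p d < 2 ^ (m + 1) := by
  have := (regVal p).isLt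
  refine lt_of_le_of_lt (Nat.div_le_self _ _) ?_
  rw [pow_succ]
  omega

/-- The binary digits of `nodeVal p d`. -/
def nodeBits (p : Fin m → Fin 2) (d : Fin (m + 1)) (l : Fin (m + 1)) : Fin 2 :=
  if h : l < d then p ⟨m - d + l, by omega⟩ else if l = d then 1 else 0

/-- In heap numbering a node at depth `d` is a leading 1 followed by the `d` highest bits of any
leaf below it. A query can thus use register wires directly as the low address digits, with a single
workspace wire flipped to 1 and zeros above. -/
theorem regVal_nodeBits (p : Fin m → Fin 2) (d : Fin (m + 1)) :
    (regVal (nodeBits p d) : ℕ) = nodeVal p d := by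
  refine regVal_eq_of_bits _ _ (nodeVal_lt p d) fun l => ?_
  have hlt := (regVal p).isLt
  rw [nodeVal, Nat.div_div_eq_div_mul, ← pow_add]
  unfold nodeBits
  by_cases h : l < d
  · rw [dif_pos h, two_pow_add_div_mod (by omega)]
    exact regVal_div_mod p ⟨m - d + l, by omega⟩
  · rw [dif_neg h]
    by_cases h' : l = d
    · subst h'
      rw [if_pos rfl, Nat.sub_add_cancel (by omega), Nat.add_div_left _ (by positivity),
        Nat.div_eq_of_lt hlt]
      rfl
    · rw [if_neg h', Nat.div_eq_of_lt]
      · rfl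
      · have : 2 ^ (m + 1) ≤ 2 ^ (m - d + l) := Nat.pow_le_pow_right (by norm_num) (by omega)
        rw [pow_succ] at this
        omega

theorem nodeVal_zero (p : Fin m → Fin 2) : nodeVal p 0 = 1 := by
  rw [nodeVal, Nat.sub_zero, Nat.add_div_left _ (by positivity), Nat.div_eq_of_lt (regVal p).isLt]

theorem nodeVal_self (p : Fin m → Fin 2) : nodeVal p m = 2 ^ m + regVal p := by
  simp [nodeVal]

/-- Wire `l` has weight `2 ^ l`, so the descent from the root consumes the highest wire first; hence
`d.rev`. -/
theorem nodeVal_succ (p : Fin m → Fin 2) (d : Fin m) :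
    nodeVal p (d + 1) = 2 * nodeVal p d + p d.rev := by
  have h := regVal_div_mod p d.rev
  rw [← two_pow_add_div_mod (n := m) (by omega)] at h
  rw [Fin.val_rev] at h
  have h2 : m - (d : ℕ) = m - (d + 1) + 1 := by omega
  rw [nodeVal, nodeVal, ← h, h2, pow_succ, ← Nat.div_div_eq_div_mul]
  omega

end Nodes

/-! ### Queries to the trees -/

section Queries

variable {s : Type} {m : ℕ} {ι : Type} [Fintype ι] [DecidableEq ι]
variable (A : s → Matrix (Fin (2 ^ m)) (Fin (2 ^ m)) ℝ)

/-- The action on basis states of a NOT on the wire `a` followed by a query. -/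
def notQueryMap {κ : Type} [Fintype κ] {b : ℕ} (a : ι) (q : κ ⊕ Fin b ↪ ι)
    (f : (κ → Fin 2) → Fin b → Fin 2) (y : ι → Fin 2) : ι → Fin 2 :=
  xorLayer (fun l => q (Sum.inr l)) (fun z => f fun c => z (q (Sum.inl c)))
    (Function.update y a (y a + 1))

theorem notQueryMap_update {κ : Type} [Fintype κ] {b : ℕ} {a : ι} {q : κ ⊕ Fin b ↪ ι}
    {f : (κ → Fin 2) → Fin b → Fin 2} {w : ι} (hw : ∀ k, q k ≠ w) (ha : a ≠ w) (y : ι → Fin 2)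
    (e : Fin 2) : notQueryMap a q f (Function.update y w e) =
      Function.update (notQueryMap a q f y) w e := by
  rw [notQueryMap, notQueryMap, Function.update_of_ne ha, Function.update_comm ha.symm,
    xorLayer_update fun l => hw _]
  intro z e'
  simp only [Function.update_of_ne (hw _)]

theorem notQueryMap_apply {κ : Type} [Fintype κ] {b : ℕ} {a : ι} {q : κ ⊕ Fin b ↪ ι}
    {f : (κ → Fin 2) → Fin b → Fin 2} (y : ι → Fin 2) (l : Fin b) (ha : q (Sum.inr l) ≠ a) :
    notQueryMap a q f y (q (Sum.inr l)) = y (q (Sum.inr l)) +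
      f (fun c => Function.update y a (y a + 1) (q (Sum.inl c))) l := by
  have hinj : Function.Injective fun l => q (Sum.inr l) := fun l l' h => by simpa using h
  have := xorLayer_apply_target hinj (f := fun z => f fun c => z (q (Sum.inl c)))
    (Function.update y a (y a + 1)) l
  rwa [Function.update_of_ne ha] at this

/-- The address and the word read are computed, used as controls, and erased; `v` is only the idle
partner of the NOT. -/
theorem matrix_conj_query {κ : Type} [Fintype κ] {b : ℕ} {v a w : ι} {q : κ ⊕ Fin b ↪ ι}
    {f : (κ → Fin 2) → Fin b → Fin 2} {g : QOp s m ι} (hg : g.matrix A = queryMatrix q f)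
    (hv : v ≠ a) (hw : ∀ k, q k ≠ w) (ha : a ≠ w) {c : QCircuit s m ι}
    {R : (ι → Fin 2) → Matrix (Fin 2) (Fin 2) ℂ} (hc : QCircuit.matrix A c = mux w R) :
    QCircuit.matrix A (QCircuit.conj (notGate v a ++ [g]) c) =
      mux w (R ∘ notQueryMap a q f) := by
  refine QCircuit.matrix_conj A ?_ (notQueryMap_update hw ha) hc
  rw [QCircuit.matrix_append, matrix_notGate A hv, QCircuit.matrix_singleton, hg, queryMatrix_eq,
    mux_eq_permMat, permMat_mul]
  rfl

/-- Wires for queries to trees: the index of the row, the register whose highest bits address the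
node, further address wires and data wires. -/
structure QueryWires (ι : Type) (m b : ℕ) where
  row : Fin m → ι
  reg : Fin m → ι
  adr : Fin (m + 1) → ι
  dat : Fin b → ι
  inj : Function.Injective (Sum.elim (Sum.elim row reg) (Sum.elim adr dat))

namespace QueryWires

variable {b : ℕ} (W : QueryWires ι m b)

/-- The address wires for a node at depth `d`. -/
def node (d l : Fin (m + 1)) : (Fin m ⊕ Fin m) ⊕ (Fin (m + 1) ⊕ Fin b) :=
  if h : l < d then Sum.inl (Sum.inr ⟨m - d + l, by omega⟩) else Sum.inr (Sum.inl l)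

/-- All wires. -/
def wire (k : (Fin m ⊕ Fin m) ⊕ (Fin (m + 1) ⊕ Fin b)) : ι :=
  Sum.elim (Sum.elim W.row W.reg) (Sum.elim W.adr W.dat) k

theorem node_injective (d : Fin (m + 1)) : Function.Injective (node (b := b) d) := by
  intro l l' h
  unfold node at h
  split_ifs at h with h1 h2 h2
  · simp only [Sum.inl.injEq, Sum.inr.injEq, Fin.mk.injEq] at h
    omega
  · simpa using h

/-- The wires of a query to a tree of row norms. -/
def normEmb (d : Fin (m + 1)) : Fin (m + 1) ⊕ Fin b ↪ ι where
  toFun k := W.wire (Sum.elim (node d) (fun l => Sum.inr (Sum.inr l)) k)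
  inj' := by
    refine W.inj.comp (Function.Injective.sumElim (node_injective d) (by intro; simp) ?_)
    intro l k
    unfold node
    split_ifs <;> simp

/-- The wires of a query to the tree of a row. -/
def rowEmb (d : Fin (m + 1)) : (Fin m ⊕ Fin (m + 1)) ⊕ Fin b ↪ ι where
  toFun k := W.wire (Sum.elim (Sum.elim (fun l => Sum.inl (Sum.inl l)) (node d))
    (fun l => Sum.inr (Sum.inr l)) k)
  inj' := by
    refine W.inj.comp (Function.Injective.sumElim
      (Function.Injective.sumElim (by intro; simp) (node_injective d) ?_) (by intro; simp) ?_)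
    · intro l k
      unfold node
      split_ifs <;> simp
    · rintro (l | l) k
      · simp
      · simp only [Sum.elim_inr]
        unfold node
        split_ifs <;> simp

/-- `w` is not among the wires of a query to a node at depth `d`. -/
def Free (d : Fin (m + 1)) (w : ι) : Prop :=
  (∀ l, W.row l ≠ w) ∧ (∀ l : Fin m, m ≤ l + d → W.reg l ≠ w) ∧ (∀ l, W.adr l ≠ w) ∧
    ∀ l, W.dat l ≠ w

variable {W}

theorem Free.node_ne {d : Fin (m + 1)} {w : ι} (h : W.Free d w) (l : Fin (m + 1)) :
    W.wire (node d l) ≠ w := by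
  unfold node
  split_ifs with hl
  · refine h.2.1 ⟨m - d + l, by omega⟩ ?_
    simp only
    omega
  · exact h.2.2.1 l

theorem Free.normEmb_ne {d : Fin (m + 1)} {w : ι} (h : W.Free d w) (k : Fin (m + 1) ⊕ Fin b) :
    W.normEmb d k ≠ w := by
  rcases k with l | l
  · exact h.node_ne l
  · exact h.2.2.2 l

theorem Free.rowEmb_ne {d : Fin (m + 1)} {w : ι} (h : W.Free d w)
    (k : (Fin m ⊕ Fin (m + 1)) ⊕ Fin b) : W.rowEmb d k ≠ w := by
  rcases k with (l | l) | l
  · exact h.1 l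
  · exact h.node_ne l
  · exact h.2.2.2 l

variable (W)

/-- A query at depth `d` reads the register at positions at least `m - d`, while step `e ≥ d` acts
on position `m - 1 - e`. So no step of a descent depends on its own target or a later one. -/
theorem free_reg_rev (d : Fin m) (e : Fin m) (h : d ≤ e) : W.Free d.castSucc (W.reg e.rev) := by
  have hne : ∀ k, k ≠ Sum.inl (Sum.inr e.rev) → W.wire k ≠ W.reg e.rev := fun k hk =>
    W.inj.ne (a₂ := Sum.inl (Sum.inr e.rev)) hk
  refine ⟨fun l => hne (Sum.inl (Sum.inl l)) (by simp), fun l hl =>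
    hne (Sum.inl (Sum.inr l)) ?_, fun l => hne (Sum.inr (Sum.inl l)) (by simp),
    fun l => hne (Sum.inr (Sum.inr l)) (by simp)⟩
  simp only [ne_eq, Sum.inl.injEq, Sum.inr.injEq]
  rintro rfl
  rw [Fin.val_rev, Fin.val_castSucc] at hl
  have : (d : ℕ) ≤ e := h
  omega

theorem dat_ne_adr (l : Fin b) (k : Fin (m + 1)) : W.dat l ≠ W.adr k :=
  W.inj.ne (a₁ := Sum.inr (Sum.inr l)) (a₂ := Sum.inr (Sum.inl k)) (by simp)

theorem update_node {y : ι → Fin 2} (hadr : ∀ l, y (W.adr l) = 0) (d l : Fin (m + 1)) :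
    Function.update y (W.adr d) (y (W.adr d) + 1) (W.wire (node d l)) =
      nodeBits (fun k => y (W.reg k)) d l := by
  have hne : ∀ k, k ≠ Sum.inr (Sum.inl d) → W.wire k ≠ W.adr d := fun k hk =>
    W.inj.ne (a₂ := Sum.inr (Sum.inl d)) hk
  unfold node nodeBits
  by_cases hl : l < d
  · rw [dif_pos hl, dif_pos hl, Function.update_of_ne (hne _ (by simp))]
    rfl
  · rw [dif_neg hl, dif_neg hl]
    by_cases hd : l = d
    · subst hd
      rw [if_pos rfl]
      show Function.update y (W.adr l) _ (W.adr l) = 1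
      rw [Function.update_self, hadr, zero_add]
    · rw [if_neg hd, Function.update_of_ne (hne _ (by simp [hd]))]
      exact hadr l

theorem notQueryMap_normEmb {y : ι → Fin 2} (hadr : ∀ l, y (W.adr l) = 0)
    (hdat : ∀ l, y (W.dat l) = 0) (B : Matrix (Fin (2 ^ m)) (Fin (2 ^ m)) ℝ) (fld : NodeField)
    (d : Fin (m + 1)) (l : Fin b) :
    notQueryMap (W.adr d) (W.normEmb d) (normWord B fld b) y (W.dat l) =
      nodeWord (rowNorms B) fld b (nodeVal (fun k => y (W.reg k)) d) l := by
  refine (notQueryMap_apply y l (W.dat_ne_adr l d)).trans ?_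
  have h : (fun c => Function.update y (W.adr d) (y (W.adr d) + 1) (W.normEmb d (Sum.inl c))) =
      nodeBits (fun k => y (W.reg k)) d := funext fun c => W.update_node hadr d c
  rw [h, normWord, regVal_nodeBits]
  show y (W.dat l) + _ = _
  rw [hdat, zero_add]

theorem notQueryMap_rowEmb {y : ι → Fin 2} (hadr : ∀ l, y (W.adr l) = 0)
    (hdat : ∀ l, y (W.dat l) = 0) (B : Matrix (Fin (2 ^ m)) (Fin (2 ^ m)) ℝ) (fld : NodeField)
    (d : Fin (m + 1)) (l : Fin b) :
    notQueryMap (W.adr d) (W.rowEmb d) (rowWord B fld b) y (W.dat l) =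
      nodeWord (B (regVal fun k => y (W.row k))) fld b (nodeVal (fun k => y (W.reg k)) d) l := by
  refine (notQueryMap_apply y l (W.dat_ne_adr l d)).trans ?_
  have h : (fun c => Function.update y (W.adr d) (y (W.adr d) + 1)
      (W.rowEmb d (Sum.inl (Sum.inr c)))) = nodeBits (fun k => y (W.reg k)) d :=
    funext fun c => W.update_node hadr d c
  have h' : (fun c => Function.update y (W.adr d) (y (W.adr d) + 1)
      (W.rowEmb d (Sum.inl (Sum.inl c)))) = fun k => y (W.row k) := funext fun c =>
    Function.update_of_ne (W.inj.ne (a₁ := Sum.inl (Sum.inl c)) (a₂ := Sum.inr (Sum.inl d))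
      (by simp)) _ _
  rw [rowWord, h, h', regVal_nodeBits]
  show y (W.dat l) + _ = _
  rw [hdat, zero_add]

/-- The value of the bit `l` of an angle. -/
def bitAngle (b : ℕ) (l : Fin b) : ℝ := Real.pi * 2 ^ (l : ℕ) / 2 ^ b

/-- One step of the preparation of the vector of row norms. -/
def normLevel (r : s) (d : Fin m) : QCircuit s m ι :=
  QCircuit.conj (notGate (W.reg d.rev) (W.adr d.castSucc) ++
      [QOp.normQuery r NodeField.angle b (W.normEmb d.castSucc)])
    (wordRot W.dat (W.reg d.rev) (bitAngle b))

/-- One step of the preparation of a row. -/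
def rowLevel (r : s) (d : Fin m) : QCircuit s m ι :=
  QCircuit.conj (notGate (W.reg d.rev) (W.adr d.castSucc) ++
      [QOp.rowQuery r NodeField.angle b (W.rowEmb d.castSucc)])
    (wordRot W.dat (W.reg d.rev) (bitAngle b))

/-- The rotation that `normLevel` performs. -/
def normRot (B : Matrix (Fin (2 ^ m)) (Fin (2 ^ m)) ℝ) (d : Fin m) (y : ι → Fin 2) :
    Matrix (Fin 2) (Fin 2) ℂ :=
  rotM (∑ l, if notQueryMap (W.adr d.castSucc) (W.normEmb d.castSucc)
    (normWord B NodeField.angle b) y (W.dat l) = 1 then bitAngle b l else 0)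

/-- The rotation that `rowLevel` performs. -/
def rowRot (B : Matrix (Fin (2 ^ m)) (Fin (2 ^ m)) ℝ) (d : Fin m) (y : ι → Fin 2) :
    Matrix (Fin 2) (Fin 2) ℂ :=
  rotM (∑ l, if notQueryMap (W.adr d.castSucc) (W.rowEmb d.castSucc)
    (rowWord B NodeField.angle b) y (W.dat l) = 1 then bitAngle b l else 0)

theorem matrix_normLevel (r : s) (d : Fin m) : QCircuit.matrix A (W.normLevel r d) =
    mux (W.reg d.rev) (W.normRot (A r) d) := by
  have h := W.free_reg_rev d d le_rfl
  exact matrix_conj_query A (QOp.matrix_normQuery A r _ b _) (h.2.2.1 _).symm h.normEmb_ne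
    (h.2.2.1 _) (matrix_wordRot A h.2.2.2 _)

theorem matrix_rowLevel (r : s) (d : Fin m) : QCircuit.matrix A (W.rowLevel r d) =
    mux (W.reg d.rev) (W.rowRot (A r) d) := by
  have h := W.free_reg_rev d d le_rfl
  exact matrix_conj_query A (QOp.matrix_rowQuery A r _ b _) (h.2.2.1 _).symm h.rowEmb_ne
    (h.2.2.1 _) (matrix_wordRot A h.2.2.2 _)

theorem ignores_normRot (B : Matrix (Fin (2 ^ m)) (Fin (2 ^ m)) ℝ) {d : Fin m} {w : ι}
    (h : W.Free d.castSucc w) : Ignores (W.normRot B d) w := by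
  intro y e
  simp only [normRot, notQueryMap_update h.normEmb_ne (h.2.2.1 _),
    Function.update_of_ne (h.2.2.2 _)]

theorem ignores_rowRot (B : Matrix (Fin (2 ^ m)) (Fin (2 ^ m)) ℝ) {d : Fin m} {w : ι}
    (h : W.Free d.castSucc w) : Ignores (W.rowRot B d) w := by
  intro y e
  simp only [rowRot, notQueryMap_update h.rowEmb_ne (h.2.2.1 _),
    Function.update_of_ne (h.2.2.2 _)]

/-- Multiplies by the sign of an entry; the wire `w` plays no role. -/
def rowSign (W : QueryWires ι m 1) (w : ι) (r : s) : QCircuit s m ι :=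
  QCircuit.conj (notGate w (W.adr (Fin.last m)) ++
      [QOp.rowQuery r NodeField.sign 1 (W.rowEmb (Fin.last m))])
    (cgate (W.dat 0) w fun x => (if x = 1 then (-1 : ℂ) else 1) • 1)

/-- The phase that `rowSign` applies. -/
def signPhase (W : QueryWires ι m 1) (B : Matrix (Fin (2 ^ m)) (Fin (2 ^ m)) ℝ) (y : ι → Fin 2) :
    Matrix (Fin 2) (Fin 2) ℂ :=
  (if notQueryMap (W.adr (Fin.last m)) (W.rowEmb (Fin.last m))
    (rowWord B NodeField.sign 1) y (W.dat 0) = 1 then (-1 : ℂ) else 1) • 1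

theorem matrix_rowSign (W : QueryWires ι m 1) {w : ι} (h : W.Free (Fin.last m) w) (r : s) :
    QCircuit.matrix A (W.rowSign w r) = mux w (W.signPhase (A r)) :=
  matrix_conj_query A (QOp.matrix_rowQuery A r _ 1 _) (h.2.2.1 _).symm h.rowEmb_ne
    (h.2.2.1 _) (matrix_cgate A (h.2.2.2 0) fun x => smul_one_mem (by split_ifs <;> simp))

theorem ignores_signPhase (W : QueryWires ι m 1) (B : Matrix (Fin (2 ^ m)) (Fin (2 ^ m)) ℝ)
    {w : ι} (h : W.Free (Fin.last m) w) : Ignores (W.signPhase B) w := by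
  intro y e
  simp only [signPhase, notQueryMap_update h.rowEmb_ne (h.2.2.1 _),
    Function.update_of_ne (h.2.2.2 _)]

theorem time_normLevel_le (r : s) (d : Fin m) :
    QCircuit.time (W.normLevel r d : QCircuit s m ι) ≤ 2 * m + 3 * b + 4 := by
  have h1 := time_notGate_le (s := s) (m := m) (W.reg d.rev) (W.adr d.castSucc)
  have h2 := time_wordRot_le (s := s) (m := m) W.dat (W.reg d.rev) (bitAngle b)
  rw [normLevel, QCircuit.time_conj, QCircuit.time_append, QCircuit.time_cons, QCircuit.time_nil]
  simp only [QOp.time]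
  omega

theorem time_rowLevel_le (r : s) (d : Fin m) :
    QCircuit.time (W.rowLevel r d : QCircuit s m ι) ≤ 4 * m + 3 * b + 4 := by
  have h1 := time_notGate_le (s := s) (m := m) (W.reg d.rev) (W.adr d.castSucc)
  have h2 := time_wordRot_le (s := s) (m := m) W.dat (W.reg d.rev) (bitAngle b)
  rw [rowLevel, QCircuit.time_conj, QCircuit.time_append, QCircuit.time_cons, QCircuit.time_nil]
  simp only [QOp.time]
  omega

theorem time_rowSign_le (W : QueryWires ι m 1) (w : ι) (r : s) :
    QCircuit.time (W.rowSign w r : QCircuit s m ι) ≤ 4 * m + 7 := by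
  have h1 := time_notGate_le (s := s) (m := m) w (W.adr (Fin.last m))
  have h2 := time_cgate_le (s := s) (m := m) (W.dat 0) w
    fun x => (if x = 1 then (-1 : ℂ) else 1) • 1
  rw [rowSign, QCircuit.time_conj, QCircuit.time_append, QCircuit.time_cons, QCircuit.time_nil]
  simp only [QOp.time]
  omega

end QueryWires

end Queries

/-! ### Amplitudes of the tree states -/

section Amplitudes

open Finset

variable {m : ℕ}

/-- Factors are exchanged one at a time, the others being bounded by one. -/
theorem abs_prod_sub_prod_le {α : Type*} (s : Finset α) (f g : α → ℝ) (hf : ∀ i, |f i| ≤ 1)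
    (hg : ∀ i, |g i| ≤ 1) : |∏ i ∈ s, f i - ∏ i ∈ s, g i| ≤ ∑ i ∈ s, |f i - g i| := by
  classical
  induction s using Finset.induction_on with
  | empty => simp
  | insert a s ha ih =>
    rw [prod_insert ha, prod_insert ha, sum_insert ha]
    have h1 : |∏ i ∈ s, f i| ≤ 1 := by
      rw [abs_prod]
      exact prod_le_one (fun i _ => abs_nonneg _) fun i _ => hf i
    calc |f a * ∏ i ∈ s, f i - g a * ∏ i ∈ s, g i|
        = |(f a - g a) * ∏ i ∈ s, f i + g a * (∏ i ∈ s, f i - ∏ i ∈ s, g i)| := by ring_nf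
      _ ≤ |f a - g a| * |∏ i ∈ s, f i| + |g a| * |∏ i ∈ s, f i - ∏ i ∈ s, g i| := by
        rw [← abs_mul, ← abs_mul]; exact abs_add_le _ _
      _ ≤ |f a - g a| + ∑ i ∈ s, |f i - g i| :=
        add_le_add (mul_le_of_le_one_right (abs_nonneg _) h1)
          ((mul_le_of_le_one_left (abs_nonneg _) (hg a)).trans ih)

theorem abs_mul_sub_mul_le {a b c d : ℝ} (ha : |a| ≤ 1) (hd : |d| ≤ 1) :
    |a * c - b * d| ≤ |a - b| + |c - d| := by
  calc |a * c - b * d| = |(a - b) * d + a * (c - d)| := by ring_nf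
    _ ≤ |a - b| * |d| + |a| * |c - d| := by
      rw [← abs_mul, ← abs_mul]; exact abs_add_le _ _
    _ ≤ |a - b| + |c - d| := add_le_add (mul_le_of_le_one_right (abs_nonneg _) hd)
      (mul_le_of_le_one_left (abs_nonneg _) ha)

/-! #### Masses -/

variable (v : Fin (2 ^ m) → ℝ)

theorem treeMass_nonneg (h : ℕ) : 0 ≤ treeMass v h := by
  refine sum_nonneg fun j _ => ?_
  split_ifs
  · exact sq_nonneg _
  · exact le_rfl

theorem treeMass_children {h : ℕ} (h1 : 1 ≤ h) (h2 : h < 2 ^ m) :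
    treeMass v h = treeMass v (2 * h) + treeMass v (2 * h + 1) := by
  rw [treeMass, treeMass, treeMass, ← sum_add_distrib]
  refine sum_congr rfl fun j _ => ?_
  have hdiv : ∀ e, (2 ^ m + (j : ℕ)) / 2 ^ (e + 1) = (2 ^ m + (j : ℕ)) / 2 ^ e / 2 := fun e => by
    rw [pow_succ, Nat.div_div_eq_div_mul]
  -- Halving a leaf number more than `m` times gives zero, so a positive ancestor stays within the
  -- range of `e`.
  have hup : ∀ e ∈ range (m + 1), 1 ≤ (2 ^ m + (j : ℕ)) / 2 ^ (e + 1) → e + 1 ∈ range (m + 1) := by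
    intro e he h
    rw [mem_range] at he ⊢
    by_contra hc
    have : e = m := by omega
    subst this
    have hj := j.isLt
    rw [Nat.div_eq_of_lt (by rw [pow_succ]; omega)] at h
    omega
  have hiff : (∃ e ∈ range (m + 1), (2 ^ m + (j : ℕ)) / 2 ^ e = h) ↔
      (∃ e ∈ range (m + 1), (2 ^ m + (j : ℕ)) / 2 ^ e = 2 * h) ∨
        ∃ e ∈ range (m + 1), (2 ^ m + (j : ℕ)) / 2 ^ e = 2 * h + 1 := by
    constructor
    · rintro ⟨e, he, hh⟩
      obtain _ | e := e
      · simp only [pow_zero, Nat.div_one] at hh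
        omega
      · rw [hdiv] at hh
        have he' : e ∈ range (m + 1) := by rw [mem_range] at he ⊢; omega
        rcases Nat.mod_two_eq_zero_or_one ((2 ^ m + (j : ℕ)) / 2 ^ e) with h0 | h0
        · exact Or.inl ⟨e, he', by omega⟩
        · exact Or.inr ⟨e, he', by omega⟩
    · rintro (⟨e, he, hh⟩ | ⟨e, he, hh⟩) <;>
        exact ⟨e + 1, hup e he (by rw [hdiv]; omega), by rw [hdiv]; omega⟩
  -- Ancestors on different levels differ at least by a factor of two, so siblings cannot both lie
  -- above one leaf.
  have hexcl : (∃ e ∈ range (m + 1), (2 ^ m + (j : ℕ)) / 2 ^ e = 2 * h) →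
      ¬ ∃ e ∈ range (m + 1), (2 ^ m + (j : ℕ)) / 2 ^ e = 2 * h + 1 := by
    rintro ⟨e, -, hh⟩ ⟨e', -, hh'⟩
    have hlt : ∀ a b, a < b → (2 ^ m + (j : ℕ)) / 2 ^ b ≤ (2 ^ m + (j : ℕ)) / 2 ^ a / 2 := by
      intro a b hab
      rw [← hdiv]
      exact Nat.div_le_div_left (Nat.pow_le_pow_right (by norm_num) hab) (by positivity)
    rcases lt_trichotomy e e' with h0 | h0 | h0
    · have := hlt _ _ h0
      omega
    · subst h0
      omega
    · have := hlt _ _ h0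
      omega
  by_cases ha : ∃ e ∈ range (m + 1), (2 ^ m + (j : ℕ)) / 2 ^ e = 2 * h
  · rw [if_pos (hiff.2 (Or.inl ha)), if_pos ha, if_neg (hexcl ha), add_zero]
  · by_cases hb : ∃ e ∈ range (m + 1), (2 ^ m + (j : ℕ)) / 2 ^ e = 2 * h + 1
    · rw [if_pos (hiff.2 (Or.inr hb)), if_neg ha, if_pos hb, zero_add]
    · rw [if_neg (fun h => (hiff.1 h).elim ha hb), if_neg ha, if_neg hb, zero_add]

theorem treeMass_one : treeMass v 1 = ∑ j, v j ^ 2 := by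
  refine sum_congr rfl fun j _ => if_pos ⟨m, by simp, ?_⟩
  rw [Nat.add_div_left _ (by positivity), Nat.div_eq_of_lt j.isLt]

theorem treeMass_leaf (i : Fin (2 ^ m)) : treeMass v (2 ^ m + i) = v i ^ 2 := by
  rw [treeMass, sum_eq_single i]
  · exact if_pos ⟨0, by simp, by simp⟩
  · intro j _ hj
    refine if_neg ?_
    rintro ⟨e, -, he⟩
    obtain _ | e := e
    · simp only [pow_zero, Nat.div_one] at he
      exact hj (Fin.ext (by omega))
    · have h1 : (2 ^ m + (j : ℕ)) / 2 ^ (e + 1) ≤ (2 ^ m + (j : ℕ)) / 2 ^ 1 :=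
        Nat.div_le_div_left (Nat.pow_le_pow_right (by norm_num) (by omega)) (by positivity)
      have := j.isLt
      omega
  · simp

theorem one_le_nodeVal (p : Fin m → Fin 2) (d : ℕ) : 1 ≤ nodeVal p d := by
  rw [nodeVal, Nat.one_le_div_iff (by positivity)]
  exact (Nat.pow_le_pow_right (by norm_num) (Nat.sub_le _ _)).trans (Nat.le_add_right _ _)

theorem nodeVal_lt_of_lt (p : Fin m → Fin 2) {d : ℕ} (hd : d < m) : nodeVal p d < 2 ^ m := by
  rw [nodeVal, Nat.div_lt_iff_lt_mul (by positivity)]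
  have h1 := (regVal p).isLt
  have h2 : 2 ^ 1 ≤ 2 ^ (m - d) := Nat.pow_le_pow_right (by norm_num) (by omega)
  nlinarith

/-- The product of the cosines and sines along the path to a leaf. -/
def treeAmp (θ : ℕ → ℝ) (p : Fin m → Fin 2) : ℝ :=
  ∏ d ∈ range m, if nodeVal p (d + 1) = 2 * nodeVal p d then Real.cos (θ (nodeVal p d))
    else Real.sin (θ (nodeVal p d))

theorem abs_treeAmp_le_one (θ : ℕ → ℝ) (p : Fin m → Fin 2) : |treeAmp θ p| ≤ 1 := by
  rw [treeAmp, abs_prod]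
  refine prod_le_one (fun i _ => abs_nonneg _) fun i _ => ?_
  split_ifs
  · exact Real.abs_cos_le_one _
  · exact Real.abs_sin_le_one _

/-- Cosine and sine are 1-Lipschitz and bounded by one, so errors add along the `m` levels. -/
theorem abs_treeAmp_sub_le (θ θ' : ℕ → ℝ) (p : Fin m → Fin 2) {ε : ℝ}
    (h : ∀ k, |θ k - θ' k| ≤ ε) : |treeAmp θ p - treeAmp θ' p| ≤ m * ε := by
  refine (abs_prod_sub_prod_le _ _ _ (fun i => ?_) (fun i => ?_)).trans ?_
  · split_ifs
    · exact Real.abs_cos_le_one _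
    · exact Real.abs_sin_le_one _
  · split_ifs
    · exact Real.abs_cos_le_one _
    · exact Real.abs_sin_le_one _
  · refine (sum_le_card_nsmul _ _ ε fun d _ => ?_).trans (by simp)
    split_ifs
    · exact (Real.abs_cos_sub_cos_le _ _).trans (h _)
    · exact (Real.abs_sin_sub_sin_le _ _).trans (h _)

theorem cos_treeAngle {h : ℕ} (h1 : 1 ≤ h) (h2 : h < 2 ^ m) :
    Real.cos (treeAngle v h) = √(treeMass v (2 * h) / treeMass v h) := by
  have h3 := treeMass_children v h1 h2
  have h4 := treeMass_nonneg v (2 * h + 1)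
  refine Real.cos_arccos (by linarith [Real.sqrt_nonneg (treeMass v (2 * h) / treeMass v h)]) ?_
  rw [Real.sqrt_le_left zero_le_one, one_pow]
  exact div_le_one_of_le₀ (by linarith) (treeMass_nonneg v h)

/-- The mass must be nonzero: division by zero yields the angle `π / 2` with sine one, whereas the
right side would be zero. -/
theorem sin_treeAngle {h : ℕ} (h1 : 1 ≤ h) (h2 : h < 2 ^ m) (h0 : treeMass v h ≠ 0) :
    Real.sin (treeAngle v h) = √(treeMass v (2 * h + 1) / treeMass v h) := by
  have h3 := treeMass_children v h1 h2
  rw [treeAngle, Real.sin_arccos, Real.sq_sqrt (div_nonneg (treeMass_nonneg v _)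
    (treeMass_nonneg v _))]
  congr 1
  rw [eq_div_iff h0, sub_mul, div_mul_cancel₀ _ h0]
  linarith

/-- Each factor is the square root of the mass ratio of a child and its parent, so the product
telescopes from the root to the leaf. -/
theorem treeAmp_treeAngle (h0 : treeMass v 1 ≠ 0) (p : Fin m → Fin 2) :
    treeAmp (treeAngle v) p = |v (regVal p)| / √(∑ j, v j ^ 2) := by
  have key : ∀ k ≤ m, (∏ d ∈ range k, if nodeVal p (d + 1) = 2 * nodeVal p d then
      Real.cos (treeAngle v (nodeVal p d)) else Real.sin (treeAngle v (nodeVal p d))) =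
      √(treeMass v (nodeVal p k) / treeMass v 1) := by
    intro k hk
    induction k with
    | zero => simp [nodeVal_zero, div_self h0]
    | succ k ih =>
      have h1 := one_le_nodeVal p k
      have h2 := nodeVal_lt_of_lt p (d := k) hk
      rw [prod_range_succ, ih (by omega)]
      have h3 := treeMass_children v h1 h2
      have h4 := treeMass_nonneg v (2 * nodeVal p k)
      have h5 := treeMass_nonneg v (2 * nodeVal p k + 1)
      have h6 := nodeVal_succ p ⟨k, hk⟩
      simp only at h6
      -- Below a node without mass the angles are meaningless, but the partial product has already
      -- vanished there.
      by_cases hz : treeMass v (nodeVal p k) = 0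
      · have h7 : treeMass v (nodeVal p (k + 1)) = 0 := by
          rw [h6]
          have : ((p (Fin.rev ⟨k, hk⟩) : Fin 2) : ℕ) < 2 := Fin.isLt _
          generalize ((p (Fin.rev ⟨k, hk⟩) : Fin 2) : ℕ) = e at *
          interval_cases e
          · rw [add_zero]; linarith
          · linarith
        rw [hz, h7]
        simp
      · have h8 : ∀ x, √(treeMass v (nodeVal p k) / treeMass v 1) *
            √(x / treeMass v (nodeVal p k)) = √(x / treeMass v 1) := fun x => by
          rw [← Real.sqrt_mul (div_nonneg (treeMass_nonneg v _) (treeMass_nonneg v _))]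
          congr 1
          field_simp
        split_ifs with h9
        · rw [cos_treeAngle v h1 h2, h8, h9]
        · rw [sin_treeAngle v h1 h2 hz, h8]
          have : nodeVal p (k + 1) = 2 * nodeVal p k + 1 := by
            have := (p (Fin.rev ⟨k, hk⟩)).isLt
            omega
          rw [this]
  rw [treeAmp, key m le_rfl, nodeVal_self, treeMass_leaf, treeMass_one,
    Real.sqrt_div (sq_nonneg _), Real.sqrt_sq_eq_abs]

/-! #### Words read from the trees -/

/-- The angle described by the word read from a node. -/
def readAngle (b h : ℕ) : ℝ :=
  ∑ l, if nodeWord v NodeField.angle b h l = 1 then QueryWires.bitAngle b l else 0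

theorem abs_readAngle_sub_le (b h : ℕ) :
    |readAngle v b h - treeAngle v h| ≤ Real.pi / 2 ^ b := by
  have hpi := Real.pi_pos
  have h2 : (0 : ℝ) < 2 ^ b := by positivity
  set N : ℕ := ⌊(2 : ℝ) ^ b * (treeAngle v h / Real.pi)⌋₊ with hN
  have hθ0 : 0 ≤ treeAngle v h := Real.arccos_nonneg _
  have hθ1 : treeAngle v h ≤ Real.pi / 2 := Real.arccos_le_pi_div_two.2 (Real.sqrt_nonneg _)
  have hx0 : 0 ≤ (2 : ℝ) ^ b * (treeAngle v h / Real.pi) := by positivity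
  -- Angles are at most `π / 2`, so the scaled value fits into `b` bits and only rounding is lost.
  have hlt : N < 2 ^ b := by
    have : (N : ℝ) < 2 ^ b := by
      refine (Nat.floor_le hx0).trans_lt ?_
      have : treeAngle v h / Real.pi < 1 := by
        rw [div_lt_one hpi]; linarith
      nlinarith
    exact_mod_cast this
  have hsum : (regVal (nodeWord v NodeField.angle b h) : ℕ) = N :=
    regVal_eq_of_bits _ N hlt fun l => rfl
  rw [regVal, finFunctionFinEquiv_apply] at hsum
  have hread : readAngle v b h = Real.pi / 2 ^ b * N := by
    rw [← hsum, readAngle, Nat.cast_sum, mul_sum]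
    refine sum_congr rfl fun l _ => ?_
    generalize nodeWord v NodeField.angle b h l = x
    revert x
    simp only [Fin.forall_fin_two, QueryWires.bitAngle]
    constructor
    · simp
    · simp; ring
  have h3 := Nat.floor_le hx0
  have h4 := Nat.lt_floor_add_one ((2 : ℝ) ^ b * (treeAngle v h / Real.pi))
  rw [← hN] at h3 h4
  have h5 : treeAngle v h = Real.pi / 2 ^ b * ((2 : ℝ) ^ b * (treeAngle v h / Real.pi)) := by
    field_simp
  rw [hread]
  generalize (2 : ℝ) ^ b * (treeAngle v h / Real.pi) = x at *
  rw [h5, ← mul_sub, abs_mul, abs_of_pos (by positivity)]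
  refine mul_le_of_le_one_right (by positivity) ?_
  rw [abs_le]
  constructor <;> linarith

/-- The sign described by the word read from a leaf. -/
def readSign (h : ℕ) : ℝ := if nodeWord v NodeField.sign 1 h 0 = 1 then -1 else 1

theorem abs_readSign (h : ℕ) : |readSign v h| = 1 := by
  unfold readSign
  split_ifs <;> simp

theorem readSign_leaf (p : Fin m → Fin 2) :
    readSign v (nodeVal p m) * |v (regVal p)| = v (regVal p) := by
  have h : (∃ j : Fin (2 ^ m), nodeVal p m = 2 ^ m + (j : ℕ) ∧ v j < 0) ↔ v (regVal p) < 0 := by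
    rw [nodeVal_self]
    constructor
    · rintro ⟨j, hj, hv⟩
      have : regVal p = j := Fin.ext (by omega)
      rwa [this]
    · exact fun hv => ⟨regVal p, rfl, hv⟩
  unfold readSign nodeWord treeSign
  simp only [h]
  by_cases hv : v (regVal p) < 0
  · simp [hv, abs_of_neg hv]
  · simp [hv, abs_of_nonneg (not_lt.1 hv)]

/-- The amplitude of an entry of a matrix in the state prepared from its trees. -/
def entryAmp (b : ℕ) (B : Matrix (Fin (2 ^ m)) (Fin (2 ^ m)) ℝ) (p q : Fin m → Fin 2) : ℝ :=
  treeAmp (readAngle (rowNorms B) b) p *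
    (readSign (B (regVal p)) (nodeVal q m) * treeAmp (readAngle (B (regVal p)) b) q)

theorem abs_entryAmp_le_one (b : ℕ) (B : Matrix (Fin (2 ^ m)) (Fin (2 ^ m)) ℝ)
    (p q : Fin m → Fin 2) : |entryAmp b B p q| ≤ 1 := by
  rw [entryAmp, abs_mul, abs_mul, abs_readSign, one_mul]
  exact mul_le_one₀ (abs_treeAmp_le_one _ _) (abs_nonneg _) (abs_treeAmp_le_one _ _)

theorem sum_rowNorms_sq (B : Matrix (Fin (2 ^ m)) (Fin (2 ^ m)) ℝ) :
    ∑ i, rowNorms B i ^ 2 = ∑ i, ∑ j, B i j ^ 2 :=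
  sum_congr rfl fun _ _ => Real.sq_sqrt (sum_nonneg fun _ _ => sq_nonneg _)

/-- The amplitude of the row, its norm over `‖B‖_F`, cancels the normalization of the row. -/
theorem exact_entry (B : Matrix (Fin (2 ^ m)) (Fin (2 ^ m)) ℝ) (hB : frobNorm B ≠ 0)
    (p q : Fin m → Fin 2) : treeAmp (treeAngle (rowNorms B)) p *
      (readSign (B (regVal p)) (nodeVal q m) * treeAmp (treeAngle (B (regVal p))) q) =
      B (regVal p) (regVal q) / frobNorm B := by
  have h1 : frobNorm B = √(∑ j, rowNorms B j ^ 2) := by rw [sum_rowNorms_sq]; rfl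
  have h2 : treeMass (rowNorms B) 1 ≠ 0 := by
    rw [treeMass_one]
    intro h
    rw [h1, h, Real.sqrt_zero] at hB
    exact hB rfl
  rw [treeAmp_treeAngle _ h2, ← h1, abs_of_nonneg (show 0 ≤ rowNorms B _ from Real.sqrt_nonneg _)]
  -- A zero row cannot be normalized, but then its own amplitude vanishes and so does the entry.
  by_cases h3 : rowNorms B (regVal p) = 0
  · have h4 : B (regVal p) (regVal q) = 0 := by
      rw [rowNorms, Real.sqrt_eq_zero (sum_nonneg fun _ _ => sq_nonneg _),
        sum_eq_zero_iff_of_nonneg fun _ _ => sq_nonneg _] at h3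
      exact pow_eq_zero_iff (two_ne_zero) |>.1 (h3 _ (mem_univ _))
    rw [h3, h4]
    simp
  · have h4 : rowNorms B (regVal p) = √(∑ j, B (regVal p) j ^ 2) := rfl
    have h5 : treeMass (B (regVal p)) 1 ≠ 0 := by
      rw [treeMass_one]
      intro h
      rw [h4, h, Real.sqrt_zero] at h3
      exact h3 rfl
    rw [treeAmp_treeAngle _ h5, ← h4, ← mul_div_assoc, readSign_leaf]
    field_simp

theorem abs_entryAmp_sub_le (b : ℕ) (B : Matrix (Fin (2 ^ m)) (Fin (2 ^ m)) ℝ)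
    (hB : frobNorm B ≠ 0) (p q : Fin m → Fin 2) :
    |entryAmp b B p q - B (regVal p) (regVal q) / frobNorm B| ≤ 2 * m * (Real.pi / 2 ^ b) := by
  rw [← exact_entry B hB, entryAmp]
  refine (abs_mul_sub_mul_le (abs_treeAmp_le_one _ _) ?_).trans ?_
  · rw [abs_mul, abs_readSign, one_mul]
    exact abs_treeAmp_le_one _ _
  · rw [← mul_sub, abs_mul, abs_readSign, one_mul]
    have h1 := abs_treeAmp_sub_le (readAngle (rowNorms B) b) (treeAngle (rowNorms B)) p
      (abs_readAngle_sub_le (rowNorms B) b)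
    have h2 := abs_treeAmp_sub_le (readAngle (B (regVal p)) b) (treeAngle (B (regVal p))) q
      (abs_readAngle_sub_le (B (regVal p)) b)
    linarith

theorem frobNorm_kronecker (G K : Matrix (Fin (2 ^ m)) (Fin (2 ^ m)) ℝ) :
    frobNorm (G ⊗ₖ K) = frobNorm G * frobNorm K := by
  have h0 : 0 ≤ ∑ i, ∑ j, G i j ^ 2 := sum_nonneg fun _ _ => sum_nonneg fun _ _ => sq_nonneg _
  rw [frobNorm, frobNorm, frobNorm, ← Real.sqrt_mul h0]
  congr 1
  simp only [Fintype.sum_prod_type, Matrix.kroneckerMap_apply, mul_pow, sum_mul_sum]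

/-- Four trees of depth `m` are descended, two for each matrix, and each rotation errs by at most `π
/ 2 ^ b`. -/
theorem abs_entryAmp_mul_sub_le (b : ℕ) {G K : Matrix (Fin (2 ^ m)) (Fin (2 ^ m)) ℝ}
    (h : frobNorm (G ⊗ₖ K) ≠ 0) (p q p' q' : Fin m → Fin 2) :
    |entryAmp b G p p' * entryAmp b K q q' -
      G (regVal p) (regVal p') * K (regVal q) (regVal q') / frobNorm (G ⊗ₖ K)| ≤
      4 * m * (Real.pi / 2 ^ b) := by
  rw [frobNorm_kronecker] at h ⊢
  have hG := left_ne_zero_of_mul h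
  have hK := right_ne_zero_of_mul h
  rw [mul_div_mul_comm]
  refine (abs_mul_sub_mul_le (abs_entryAmp_le_one _ _ _ _) ?_).trans ?_
  · rw [← exact_entry K hK, abs_mul, abs_mul, abs_readSign, one_mul]
    exact mul_le_one₀ (abs_treeAmp_le_one _ _) (abs_nonneg _) (abs_treeAmp_le_one _ _)
  · linarith [abs_entryAmp_sub_le b G hG p p', abs_entryAmp_sub_le b K hK q q']

end Amplitudes

/-! ### The wires and the parts of the circuit -/

section Assembly

/-- Names of the wires: ancillas, system, and workspace. -/
abbrev WireName (m b : ℕ) : Type :=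
  (((Fin m ⊕ Fin m) ⊕ Fin 5) ⊕ (Fin m ⊕ Fin m)) ⊕
    (Fin (m + 1) ⊕ (Fin (m + 1) ⊕ (Fin b ⊕ Fin 1)))

variable {m b : ℕ} {ι : Type} [Fintype ι] [DecidableEq ι] (e : WireName m b ≃ ι)

/-- The ancilla register `k`. -/
def ancReg (k : Fin 2) (l : Fin m) : ι :=
  e (Sum.inl (Sum.inl (Sum.inl (if k = 0 then Sum.inl l else Sum.inr l))))

/-- The system register `k`. -/
def sysReg (k : Fin 2) (l : Fin m) : ι :=
  e (Sum.inl (Sum.inr (if k = 0 then Sum.inl l else Sum.inr l)))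

/-- The ancilla qubits outside the registers. -/
def ancBit (k : Fin 5) : ι := e (Sum.inl (Sum.inl (Sum.inr k)))

/-- Workspace for comparisons. -/
def cmpWire (l : Fin (m + 1)) : ι := e (Sum.inr (Sum.inl l))

/-- Workspace for addresses. -/
def adrWire (l : Fin (m + 1)) : ι := e (Sum.inr (Sum.inr (Sum.inl l)))

/-- Workspace for words. -/
def datWire (l : Fin b) : ι := e (Sum.inr (Sum.inr (Sum.inr (Sum.inl l))))

/-- Workspace for signs. -/
def sgnWire (l : Fin 1) : ι := e (Sum.inr (Sum.inr (Sum.inr (Sum.inr l))))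

theorem ite_sum_inj (k k' : Fin 2) (l l' : Fin m) :
    ((if k = 0 then Sum.inl l else Sum.inr l : Fin m ⊕ Fin m) =
      if k' = 0 then Sum.inl l' else Sum.inr l') ↔ k = k' ∧ l = l' := by
  revert k k'
  simp [Fin.forall_fin_two]

/-- Wires to prepare the row norms of the matrix `k` in an ancilla register. -/
def normWires (k : Fin 2) : QueryWires ι m b where
  -- Norm queries have no row index; any register disjoint from the other wires can stand here.
  row := sysReg e k
  reg := ancReg e k
  adr := adrWire e
  dat := datWire e
  inj := by
    rintro ((i | i) | (i | i)) ((j | j) | (j | j)) <;>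
      simp [sysReg, ancReg, adrWire, datWire, ite_sum_inj]

/-- Wires to prepare a row of the matrix `k` in a system register. -/
def rowWires (k : Fin 2) : QueryWires ι m b where
  row := ancReg e k
  reg := sysReg e k
  adr := adrWire e
  dat := datWire e
  inj := by
    rintro ((i | i) | (i | i)) ((j | j) | (j | j)) <;>
      simp [sysReg, ancReg, adrWire, datWire, ite_sum_inj]

/-- Wires to read the sign of an entry of the matrix `k`. -/
def signWires (k : Fin 2) : QueryWires ι m 1 where
  row := ancReg e k
  reg := sysReg e k
  adr := adrWire e
  dat := sgnWire e
  inj := by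
    rintro ((i | i) | (i | i)) ((j | j) | (j | j)) <;>
      simp [sysReg, ancReg, adrWire, sgnWire, ite_sum_inj]

/-- Prepares the row norms of both matrices and rotates an ancilla by the angle `φ`. -/
def prepNorms (φ : ℝ) : QCircuit (Fin 2) m ι :=
  (List.finRange m).flatMap ((normWires e 0).normLevel 0) ++
    ((List.finRange m).flatMap ((normWires e 1).normLevel 1) ++
      cgate (ancBit e 3) (ancBit e 2) fun _ => rotM φ)

/-- Prepares a row of each matrix. -/
def prepRows : QCircuit (Fin 2) m ι :=
  (List.finRange m).flatMap ((rowWires e 0).rowLevel 0) ++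
    ((signWires e 0).rowSign (ancBit e 3) 0 ++
      ((List.finRange m).flatMap ((rowWires e 1).rowLevel 1) ++
        (signWires e 1).rowSign (ancBit e 4) 1))

/-- Moves the system register `k` to the ancillas. -/
def moveReg (k : Fin 2) : QCircuit (Fin 2) m ι :=
  (List.finRange m).flatMap (fun l => cnot (sysReg e k l) (ancReg e k l)) ++
    (List.finRange m).flatMap (fun l => cnot (ancReg e k l) (sysReg e k l))

/-- The whole circuit. -/
def symKronCircuit (φ : ℝ) : QCircuit (Fin 2) m ι :=
  symmetrizer (sysReg e 0) (sysReg e 1) (cmpWire e) (ancBit e 0) ++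
    (prepNorms e φ ++
      QCircuit.inv (symmetrizer (sysReg e 0) (sysReg e 1) (cmpWire e) (ancBit e 1) ++
        ((moveReg e 0 ++ moveReg e 1) ++ prepRows e)))

theorem time_symKronCircuit_le (φ : ℝ) : QCircuit.time (symKronCircuit e φ) ≤
    12 * (m * m) + 12 * (m * b) + 178 * m + 19 := by
  have h1 := time_symmetrizer_le (s := Fin 2) (I := sysReg e 0) (J := sysReg e 1)
    (B := cmpWire e) (c := ancBit e 0)
  have h2 := time_symmetrizer_le (s := Fin 2) (I := sysReg e 0) (J := sysReg e 1)
    (B := cmpWire e) (c := ancBit e 1)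
  have h3 : ∀ k, QCircuit.time ((List.finRange m).flatMap ((normWires e k).normLevel k)) ≤
      m * (2 * m + 3 * b + 4) := fun k => by
    simpa using QCircuit.time_flatMap_le (List.finRange m) ((normWires e k).normLevel k) _
      fun d _ => (normWires e k).time_normLevel_le k d
  have h4 : ∀ k, QCircuit.time ((List.finRange m).flatMap ((rowWires e k).rowLevel k)) ≤
      m * (4 * m + 3 * b + 4) := fun k => by
    simpa using QCircuit.time_flatMap_le (List.finRange m) ((rowWires e k).rowLevel k) _
      fun d _ => (rowWires e k).time_rowLevel_le k d
  have h5 := time_cgate_le (s := Fin 2) (m := m) (ancBit e 3) (ancBit e 2) fun _ => rotM φ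
  have h6 : ∀ f g : Fin m → ι, QCircuit.time ((List.finRange m).flatMap fun l =>
      (cnot (f l) (g l) : QCircuit (Fin 2) m ι)) ≤ m := fun f g => by
    simpa using QCircuit.time_flatMap_le (List.finRange m)
      (fun l => (cnot (f l) (g l) : QCircuit (Fin 2) m ι)) 1 fun _ _ => time_cnot_le _ _
  have h7 := QueryWires.time_rowSign_le (signWires e 0) (ancBit e 3) (0 : Fin 2)
  have h8 := QueryWires.time_rowSign_le (signWires e 1) (ancBit e 4) (1 : Fin 2)
  have h9 := h3 0
  have h10 := h3 1
  have h11 := h4 0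
  have h12 := h4 1
  have h13 := h6 (sysReg e 0) (ancReg e 0)
  have h14 := h6 (sysReg e 1) (ancReg e 1)
  have h15 := h6 (ancReg e 0) (sysReg e 0)
  have h16 := h6 (ancReg e 1) (sysReg e 1)
  simp only [symKronCircuit, prepNorms, prepRows, moveReg, QCircuit.time_append, QCircuit.time_inv]
  nlinarith

/-! #### Operators of the parts -/

/-- The steps of `prepNorms`. -/
def normSeq (A : Fin 2 → Matrix (Fin (2 ^ m)) (Fin (2 ^ m)) ℝ) (φ : ℝ) :
    List (ι × ((ι → Fin 2) → Matrix (Fin 2) (Fin 2) ℂ)) :=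
  (List.finRange m).map (fun d => (ancReg e 0 d.rev, (normWires e 0).normRot (A 0) d)) ++
    ((List.finRange m).map (fun d => (ancReg e 1 d.rev, (normWires e 1).normRot (A 1) d)) ++
      [(ancBit e 2, fun _ => rotM φ)])

/-- The steps of `prepRows`. -/
def rowSeq (A : Fin 2 → Matrix (Fin (2 ^ m)) (Fin (2 ^ m)) ℝ) :
    List (ι × ((ι → Fin 2) → Matrix (Fin 2) (Fin 2) ℂ)) :=
  (List.finRange m).map (fun d => (sysReg e 0 d.rev, (rowWires e 0).rowRot (A 0) d)) ++
    ([(ancBit e 3, (signWires e 0).signPhase (A 0))] ++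
      ((List.finRange m).map (fun d => (sysReg e 1 d.rev, (rowWires e 1).rowRot (A 1) d)) ++
        [(ancBit e 4, (signWires e 1).signPhase (A 1))]))

theorem free_normWires_ancReg {k k' : Fin 2} (h : k ≠ k') (d : Fin (m + 1)) (l : Fin m) :
    (normWires e k).Free d (ancReg e k' l) := by
  refine ⟨fun l => ?_, fun l _ => ?_, fun l => ?_, fun l => ?_⟩ <;>
    simp [normWires, sysReg, ancReg, adrWire, datWire, ite_sum_inj, h]

theorem free_normWires_ancBit (k : Fin 2) (d : Fin (m + 1)) (j : Fin 5) :
    (normWires e k).Free d (ancBit e j) := by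
  refine ⟨fun l => ?_, fun l _ => ?_, fun l => ?_, fun l => ?_⟩ <;>
    simp [normWires, sysReg, ancReg, ancBit, adrWire, datWire]

theorem free_rowWires_sysReg {k k' : Fin 2} (h : k ≠ k') (d : Fin (m + 1)) (l : Fin m) :
    (rowWires e k).Free d (sysReg e k' l) := by
  refine ⟨fun l => ?_, fun l _ => ?_, fun l => ?_, fun l => ?_⟩ <;>
    simp [rowWires, sysReg, ancReg, adrWire, datWire, ite_sum_inj, h]

theorem free_rowWires_ancBit (k : Fin 2) (d : Fin (m + 1)) (j : Fin 5) :
    (rowWires e k).Free d (ancBit e j) := by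
  refine ⟨fun l => ?_, fun l _ => ?_, fun l => ?_, fun l => ?_⟩ <;>
    simp [rowWires, sysReg, ancReg, ancBit, adrWire, datWire]

theorem free_signWires_sysReg {k k' : Fin 2} (h : k ≠ k') (d : Fin (m + 1)) (l : Fin m) :
    (signWires e k).Free d (sysReg e k' l) := by
  refine ⟨fun l => ?_, fun l _ => ?_, fun l => ?_, fun l => ?_⟩ <;>
    simp [signWires, sysReg, ancReg, adrWire, sgnWire, ite_sum_inj, h]

theorem free_signWires_ancBit (k : Fin 2) (d : Fin (m + 1)) (j : Fin 5) :
    (signWires e k).Free d (ancBit e j) := by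
  refine ⟨fun l => ?_, fun l _ => ?_, fun l => ?_, fun l => ?_⟩ <;>
    simp [signWires, sysReg, ancReg, ancBit, adrWire, sgnWire]

theorem ancReg_ne_ancReg {k k' : Fin 2} (h : k ≠ k') (l l' : Fin m) :
    ancReg e k l ≠ ancReg e k' l' := by
  simp [ancReg, ite_sum_inj, h]

theorem sysReg_ne_sysReg {k k' : Fin 2} (h : k ≠ k') (l l' : Fin m) :
    sysReg e k l ≠ sysReg e k' l' := by
  simp [sysReg, ite_sum_inj, h]

theorem ancReg_injective (k : Fin 2) : Function.Injective (ancReg e k) := by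
  intro l l' h
  simpa [ancReg, ite_sum_inj] using h

theorem sysReg_injective (k : Fin 2) : Function.Injective (sysReg e k) := by
  intro l l' h
  simpa [sysReg, ite_sum_inj] using h

theorem sysReg_ne_ancReg (k k' : Fin 2) (l l' : Fin m) : sysReg e k l ≠ ancReg e k' l' := by
  simp [sysReg, ancReg]

theorem ancReg_ne_ancBit (k : Fin 2) (l : Fin m) (j : Fin 5) : ancReg e k l ≠ ancBit e j := by
  simp [ancReg, ancBit]

theorem sysReg_ne_ancBit (k : Fin 2) (l : Fin m) (j : Fin 5) : sysReg e k l ≠ ancBit e j := by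
  simp [sysReg, ancBit]

theorem ancBit_injective : Function.Injective (ancBit e) := by
  intro l l' h
  simpa [ancBit] using h

/-- Each tree is descended from the root, and the two trees and the extra rotation have separate
targets. -/
theorem seqOK_normSeq (A : Fin 2 → Matrix (Fin (2 ^ m)) (Fin (2 ^ m)) ℝ) (φ : ℝ) :
    SeqOK (normSeq e A φ) := by
  have hp : ∀ k, ((List.finRange m).map (fun d =>
      (ancReg e k d.rev, (normWires e k).normRot (A k) d))).Pairwise
      fun p q => p.1 ≠ q.1 ∧ Ignores p.2 q.1 := by
    intro k
    rw [List.pairwise_map]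
    refine List.Pairwise.imp ?_ (List.pairwise_lt_finRange m)
    intro d d' h
    exact ⟨(ancReg_injective e k).ne (fun h' => h.ne (Fin.rev_injective h')),
      (normWires e k).ignores_normRot _ ((normWires e k).free_reg_rev d d' h.le)⟩
  have hi : ∀ k, ∀ p ∈ ((List.finRange m).map (fun d =>
      (ancReg e k d.rev, (normWires e k).normRot (A k) d))), Ignores p.2 p.1 := by
    intro k p h
    obtain ⟨d, -, rfl⟩ := List.mem_map.1 h
    exact (normWires e k).ignores_normRot _ ((normWires e k).free_reg_rev d d le_rfl)
  constructor
  · rw [normSeq, List.pairwise_append, List.pairwise_append]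
    refine ⟨hp 0, ⟨hp 1, List.pairwise_singleton _ _, ?_⟩, ?_⟩
    · intro p h q hq
      obtain ⟨d, -, rfl⟩ := List.mem_map.1 h
      obtain rfl := List.mem_singleton.1 hq
      exact ⟨ancReg_ne_ancBit e _ _ _,
        (normWires e 1).ignores_normRot _ (free_normWires_ancBit e _ _ _)⟩
    · intro p h q hq
      obtain ⟨d, -, rfl⟩ := List.mem_map.1 h
      rcases List.mem_append.1 hq with hq | hq
      · obtain ⟨d', -, rfl⟩ := List.mem_map.1 hq
        exact ⟨ancReg_ne_ancReg e (by simp) _ _,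
          (normWires e 0).ignores_normRot _ (free_normWires_ancReg e (by simp) _ _)⟩
      · obtain rfl := List.mem_singleton.1 hq
        exact ⟨ancReg_ne_ancBit e _ _ _,
          (normWires e 0).ignores_normRot _ (free_normWires_ancBit e _ _ _)⟩
  · intro p h
    rcases List.mem_append.1 h with h | h
    · exact hi 0 p h
    rcases List.mem_append.1 h with h | h
    · exact hi 1 p h
    · obtain rfl := List.mem_singleton.1 h
      exact fun y a => rfl

/-- The row indices lie in ancilla registers that no step targets, and each sign is read once its
column register is complete. The phases are scalars; they are assigned to two ancillas of their own
only to keep the targets distinct. -/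
theorem seqOK_rowSeq (A : Fin 2 → Matrix (Fin (2 ^ m)) (Fin (2 ^ m)) ℝ) :
    SeqOK (rowSeq e A) := by
  have hp : ∀ k, ((List.finRange m).map (fun d =>
      (sysReg e k d.rev, (rowWires e k).rowRot (A k) d))).Pairwise
      fun p q => p.1 ≠ q.1 ∧ Ignores p.2 q.1 := by
    intro k
    rw [List.pairwise_map]
    refine List.Pairwise.imp ?_ (List.pairwise_lt_finRange m)
    intro d d' h
    exact ⟨(sysReg_injective e k).ne (fun h' => h.ne (Fin.rev_injective h')),
      (rowWires e k).ignores_rowRot _ ((rowWires e k).free_reg_rev d d' h.le)⟩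
  have hi : ∀ k, ∀ p ∈ ((List.finRange m).map (fun d =>
      (sysReg e k d.rev, (rowWires e k).rowRot (A k) d))), Ignores p.2 p.1 := by
    intro k p h
    obtain ⟨d, -, rfl⟩ := List.mem_map.1 h
    exact (rowWires e k).ignores_rowRot _ ((rowWires e k).free_reg_rev d d le_rfl)
  constructor
  · rw [rowSeq, List.pairwise_append, List.pairwise_append, List.pairwise_append]
    refine ⟨hp 0, ⟨List.pairwise_singleton _ _, ⟨hp 1, List.pairwise_singleton _ _, ?_⟩, ?_⟩, ?_⟩
    · intro p h q hq
      obtain ⟨d, -, rfl⟩ := List.mem_map.1 h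
      obtain rfl := List.mem_singleton.1 hq
      exact ⟨sysReg_ne_ancBit e _ _ _,
        (rowWires e 1).ignores_rowRot _ (free_rowWires_ancBit e _ _ _)⟩
    · intro p h q hq
      obtain rfl := List.mem_singleton.1 h
      rcases List.mem_append.1 hq with hq | hq
      · obtain ⟨d', -, rfl⟩ := List.mem_map.1 hq
        exact ⟨(sysReg_ne_ancBit e _ _ _).symm,
          (signWires e 0).ignores_signPhase _ (free_signWires_sysReg e (by simp) _ _)⟩
      · obtain rfl := List.mem_singleton.1 hq
        exact ⟨(ancBit_injective e).ne (by simp),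
          (signWires e 0).ignores_signPhase _ (free_signWires_ancBit e _ _ _)⟩
    · intro p h q hq
      obtain ⟨d, -, rfl⟩ := List.mem_map.1 h
      rcases List.mem_append.1 hq with hq | hq
      · obtain rfl := List.mem_singleton.1 hq
        exact ⟨sysReg_ne_ancBit e _ _ _,
          (rowWires e 0).ignores_rowRot _ (free_rowWires_ancBit e _ _ _)⟩
      rcases List.mem_append.1 hq with hq | hq
      · obtain ⟨d', -, rfl⟩ := List.mem_map.1 hq
        exact ⟨sysReg_ne_sysReg e (by simp) _ _,
          (rowWires e 0).ignores_rowRot _ (free_rowWires_sysReg e (by simp) _ _)⟩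
      · obtain rfl := List.mem_singleton.1 hq
        exact ⟨sysReg_ne_ancBit e _ _ _,
          (rowWires e 0).ignores_rowRot _ (free_rowWires_ancBit e _ _ _)⟩
  · intro p h
    rcases List.mem_append.1 h with h | h
    · exact hi 0 p h
    rcases List.mem_append.1 h with h | h
    · obtain rfl := List.mem_singleton.1 h
      exact (signWires e 0).ignores_signPhase _ (free_signWires_ancBit e _ _ _)
    rcases List.mem_append.1 h with h | h
    · exact hi 1 p h
    · obtain rfl := List.mem_singleton.1 h
      exact (signWires e 1).ignores_signPhase _ (free_signWires_ancBit e _ _ _)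

variable (A : Fin 2 → Matrix (Fin (2 ^ m)) (Fin (2 ^ m)) ℝ)

theorem matrix_prepNorms (φ : ℝ) :
    QCircuit.matrix A (prepNorms e φ) = seqMat (normSeq e A φ) := by
  have h : ∀ k, QCircuit.matrix A ((List.finRange m).flatMap ((normWires e k).normLevel k)) =
      seqMat ((List.finRange m).map fun d =>
        (ancReg e k d.rev, (normWires e k).normRot (A k) d)) := fun k =>
    matrix_flatMap_eq_seqMat A _ _ _ ((normWires e k).matrix_normLevel A k)
  rw [prepNorms, normSeq, seqMat_append, seqMat_append, QCircuit.matrix_append,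
    QCircuit.matrix_append, matrix_cgate A ((ancBit_injective e).ne (by simp)) fun _ => rotM_mem φ,
    h 0, h 1]
  simp only [seqMat, Matrix.one_mul]

theorem matrix_prepRows : QCircuit.matrix A (prepRows e) = seqMat (rowSeq e A) := by
  have h : ∀ k, QCircuit.matrix A ((List.finRange m).flatMap ((rowWires e k).rowLevel k)) =
      seqMat ((List.finRange m).map fun d =>
        (sysReg e k d.rev, (rowWires e k).rowRot (A k) d)) := fun k =>
    matrix_flatMap_eq_seqMat A _ _ _ ((rowWires e k).matrix_rowLevel A k)
  rw [prepRows, rowSeq, seqMat_append, seqMat_append, seqMat_append, QCircuit.matrix_append,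
    QCircuit.matrix_append, QCircuit.matrix_append,
    (signWires e 0).matrix_rowSign A (free_signWires_ancBit e 0 _ 3),
    (signWires e 1).matrix_rowSign A (free_signWires_ancBit e 1 _ 4),
    h 0, h 1]
  simp only [seqMat, Matrix.one_mul]

/-- The action of `moveReg` on basis states. -/
def moveMap (k : Fin 2) (y : ι → Fin 2) : ι → Fin 2 :=
  xorLayer (sysReg e k) (fun y l => y (ancReg e k l))
    (xorLayer (ancReg e k) (fun y l => y (sysReg e k l)) y)

/-- The third layer of a full swap is unnecessary because the ancilla register is zero where the
move is used. -/
theorem matrix_moveReg (k : Fin 2) :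
    QCircuit.matrix A (moveReg e k) = permMat (moveMap e k) := by
  rw [moveReg, QCircuit.matrix_append,
    matrix_flatMap_flip A (T := ancReg e k) (f := fun y l => y (sysReg e k l)) (fun l y a =>
      funext fun l' => Function.update_of_ne (sysReg_ne_ancReg e k k l' l) _ _)
      fun l => matrix_cnot A (sysReg_ne_ancReg e k k l l),
    matrix_flatMap_flip A (T := sysReg e k) (f := fun y l => y (ancReg e k l)) (fun l y a =>
      funext fun l' => Function.update_of_ne (sysReg_ne_ancReg e k k l l').symm _ _)
      fun l => matrix_cnot A (sysReg_ne_ancReg e k k l l).symm, permMat_mul]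
  rfl

theorem moveMap_apply_of_ne (k : Fin 2) {i : ι} (h1 : ∀ l, ancReg e k l ≠ i)
    (h2 : ∀ l, sysReg e k l ≠ i) (y : ι → Fin 2) : moveMap e k y i = y i := by
  rw [moveMap, xorLayer_apply_of_ne h2, xorLayer_apply_of_ne h1]

theorem moveMap_apply_ancReg (k : Fin 2) (y : ι → Fin 2) (l : Fin m) :
    moveMap e k y (ancReg e k l) = y (ancReg e k l) + y (sysReg e k l) := by
  rw [moveMap, xorLayer_apply_of_ne fun l' => sysReg_ne_ancReg e k k l' l,
    xorLayer_apply_target (ancReg_injective e k)]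

theorem moveMap_apply_sysReg (k : Fin 2) (y : ι → Fin 2) (l : Fin m) :
    moveMap e k y (sysReg e k l) = y (ancReg e k l) := by
  rw [moveMap, xorLayer_apply_target (sysReg_injective e k),
    xorLayer_apply_target (ancReg_injective e k),
    xorLayer_apply_of_ne fun l' => (sysReg_ne_ancReg e k k l l').symm]
  generalize y (sysReg e k l) = a
  generalize y (ancReg e k l) = c
  revert a c; decide

theorem symWires {j : Fin 5} :
    SymWires (sysReg e 0) (sysReg e 1) (cmpWire e) (ancBit e j) where
  ij := sysReg_ne_sysReg e (by simp)
  ib := by simp [sysReg, cmpWire]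
  jb := by simp [sysReg, cmpWire]
  inj := by intro l l' h; simpa [cmpWire] using h
  injI := sysReg_injective e 0
  injJ := sysReg_injective e 1
  ic := fun l => sysReg_ne_ancBit e 0 l j
  jc := fun l => sysReg_ne_ancBit e 1 l j
  bc := by simp [cmpWire, ancBit]

end Assembly

/-! ### Matrix entries of the circuit -/

section Entries

variable {m b : ℕ} {ι : Type} [Fintype ι] [DecidableEq ι] (e : WireName m b ≃ ι)
variable (A : Fin 2 → Matrix (Fin (2 ^ m)) (Fin (2 ^ m)) ℝ)

/-- The qubit `l` of the register `k`. -/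
def side (k : Fin 2) (l : Fin m) : Fin m ⊕ Fin m := if k = 0 then Sum.inl l else Sum.inr l

/-- The basis state with `P` in the ancilla registers, `S` in the system registers, and all other
qubits zero. -/
def fullState (P S : Fin m ⊕ Fin m → Fin 2) : ι → Fin 2 := fun i =>
  Sum.elim (Sum.elim (Sum.elim P fun _ => 0) S) (fun _ => 0) (e.symm i)

section FullState

variable (P S : Fin m ⊕ Fin m → Fin 2)

theorem fullState_ancReg (k : Fin 2) (l : Fin m) :
    fullState e P S (ancReg e k l) = P (side k l) := by
  simp [fullState, ancReg, side]

theorem fullState_sysReg (k : Fin 2) (l : Fin m) :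
    fullState e P S (sysReg e k l) = S (side k l) := by
  simp [fullState, sysReg, side]

theorem fullState_ancBit (j : Fin 5) : fullState e P S (ancBit e j) = 0 := by
  simp [fullState, ancBit]

theorem fullState_work (j) : fullState e P S (e (Sum.inr j)) = 0 := by
  simp [fullState]

end FullState

theorem fin_two_cases (k : Fin 2) : k = 0 ∨ k = 1 := by
  revert k; decide

/-- A case distinction over the wires. -/
theorem wire_cases {p : ι → Prop} (h1 : ∀ k l, p (ancReg e k l)) (h2 : ∀ k l, p (sysReg e k l))
    (h3 : ∀ j, p (ancBit e j)) (h4 : ∀ j, p (e (Sum.inr j))) (i : ι) : p i := by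
  obtain ⟨n, rfl⟩ := e.surjective i
  rcases n with (((l | l) | j) | (l | l)) | j
  · exact h1 0 l
  · exact h1 1 l
  · exact h3 j
  · exact h2 0 l
  · exact h2 1 l
  · exact h4 j

theorem moveMap_fullState (x : Fin m ⊕ Fin m → Fin 2) :
    moveMap e 1 (moveMap e 0 (fullState e (fun _ => 0) x)) = fullState e x fun _ => 0 := by
  have h01 : (0 : Fin 2) ≠ 1 := by simp
  funext i
  revert i
  refine wire_cases e (fun k l => ?_) (fun k l => ?_) (fun j => ?_) (fun j => ?_)
  · rw [fullState_ancReg]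
    obtain rfl | rfl : k = 0 ∨ k = 1 := fin_two_cases k
    · rw [moveMap_apply_of_ne e 1 (fun _ => (ancReg_ne_ancReg e h01 _ _).symm)
        (fun _ => sysReg_ne_ancReg e _ _ _ _), moveMap_apply_ancReg, fullState_ancReg,
        fullState_sysReg, zero_add]
    · rw [moveMap_apply_ancReg, moveMap_apply_of_ne e 0 (fun _ => ancReg_ne_ancReg e h01 _ _)
        (fun _ => sysReg_ne_ancReg e _ _ _ _), moveMap_apply_of_ne e 0
        (fun _ => (sysReg_ne_ancReg e _ _ _ _).symm) (fun _ => sysReg_ne_sysReg e h01 _ _),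
        fullState_ancReg, fullState_sysReg, zero_add]
  · rw [fullState_sysReg]
    obtain rfl | rfl : k = 0 ∨ k = 1 := fin_two_cases k
    · rw [moveMap_apply_of_ne e 1 (fun _ => (sysReg_ne_ancReg e _ _ _ _).symm)
        (fun _ => (sysReg_ne_sysReg e h01 _ _).symm), moveMap_apply_sysReg, fullState_ancReg]
    · rw [moveMap_apply_sysReg, moveMap_apply_of_ne e 0 (fun _ => ancReg_ne_ancReg e h01 _ _)
        (fun _ => sysReg_ne_ancReg e _ _ _ _), fullState_ancReg]
  · have h1 : ∀ k l, ancReg e k l ≠ ancBit e j := fun k l => ancReg_ne_ancBit e k l j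
    have h2 : ∀ k l, sysReg e k l ≠ ancBit e j := fun k l => sysReg_ne_ancBit e k l j
    rw [moveMap_apply_of_ne e 1 (h1 1) (h2 1), moveMap_apply_of_ne e 0 (h1 0) (h2 0),
      fullState_ancBit, fullState_ancBit]
  · have h1 : ∀ k l, ancReg e k l ≠ e (Sum.inr j) := by simp [ancReg]
    have h2 : ∀ k l, sysReg e k l ≠ e (Sum.inr j) := by simp [sysReg]
    rw [moveMap_apply_of_ne e 1 (h1 1) (h2 1), moveMap_apply_of_ne e 0 (h1 0) (h2 0),
      fullState_work, fullState_work]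

theorem normRot_fullState (P S : Fin m ⊕ Fin m → Fin 2) (k : Fin 2) (d : Fin m)
    (B : Matrix (Fin (2 ^ m)) (Fin (2 ^ m)) ℝ) :
    (normWires e k).normRot B d (fullState e P S) =
      rotM (readAngle (rowNorms B) b (nodeVal (fun l => P (side k l)) d)) := by
  have h := (normWires e k).notQueryMap_normEmb (y := fullState e P S)
    (fun l => fullState_work e P S _) (fun l => fullState_work e P S _) B NodeField.angle
    d.castSucc
  simp only [QueryWires.normRot, h, readAngle]
  have h' : (fun l => fullState e P S ((normWires e k).reg l)) = fun l => P (side k l) :=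
    funext fun l => fullState_ancReg e P S k l
  rw [h']
  rfl

theorem rowRot_fullState (P S : Fin m ⊕ Fin m → Fin 2) (k : Fin 2) (d : Fin m)
    (B : Matrix (Fin (2 ^ m)) (Fin (2 ^ m)) ℝ) :
    (rowWires e k).rowRot B d (fullState e P S) =
      rotM (readAngle (B (regVal fun l => P (side k l))) b
        (nodeVal (fun l => S (side k l)) d)) := by
  have h := (rowWires e k).notQueryMap_rowEmb (y := fullState e P S)
    (fun l => fullState_work e P S _) (fun l => fullState_work e P S _) B NodeField.angle
    d.castSucc
  simp only [QueryWires.rowRot, h, readAngle]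
  have h' : (fun l => fullState e P S ((rowWires e k).reg l)) = fun l => S (side k l) :=
    funext fun l => fullState_sysReg e P S k l
  have h'' : (fun l => fullState e P S ((rowWires e k).row l)) = fun l => P (side k l) :=
    funext fun l => fullState_ancReg e P S k l
  rw [h', h'']
  rfl

theorem signPhase_fullState (P S : Fin m ⊕ Fin m → Fin 2) (k : Fin 2)
    (B : Matrix (Fin (2 ^ m)) (Fin (2 ^ m)) ℝ) :
    (signWires e k).signPhase B (fullState e P S) =
      ((readSign (B (regVal fun l => P (side k l)))
        (nodeVal (fun l => S (side k l)) m) : ℝ) : ℂ) • 1 := by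
  have h := (signWires e k).notQueryMap_rowEmb (y := fullState e P S)
    (fun l => fullState_work e P S _) (fun l => fullState_work e P S _) B NodeField.sign
    (Fin.last m) 0
  have h' : (fun l => fullState e P S ((signWires e k).reg l)) = fun l => S (side k l) :=
    funext fun l => fullState_sysReg e P S k l
  have h'' : (fun l => fullState e P S ((signWires e k).row l)) = fun l => P (side k l) :=
    funext fun l => fullState_ancReg e P S k l
  rw [h', h'', Fin.val_last] at h
  rw [QueryWires.signPhase, h, readSign]
  congr 1
  split_ifs <;> simp

/-- A register starting in zero selects the first column of each rotation: the cosine for the left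
child, bit 0, and the sine for the right one. -/
theorem prod_rotM (θ : ℕ → ℝ) (p : Fin m → Fin 2) :
    ((List.finRange m).map fun d : Fin m => rotM (θ (nodeVal p d)) (p d.rev) 0).prod =
      ((treeAmp θ p : ℝ) : ℂ) := by
  rw [treeAmp, Finset.prod_range, Complex.ofReal_prod, Fin.prod_univ_def]
  congr 1
  refine List.map_congr_left fun d _ => ?_
  rw [nodeVal_succ]
  generalize p d.rev = x
  revert x
  simp [Fin.forall_fin_two, rotM]

theorem normSeq_fullState (φ : ℝ) (P S : Fin m ⊕ Fin m → Fin 2) :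
    seqMat (normSeq e A φ) (fullState e P S) (fullState e (fun _ => 0) S) =
      ((treeAmp (readAngle (rowNorms (A 0)) b) (fun l => P (side 0 l)) *
        (treeAmp (readAngle (rowNorms (A 1)) b) (fun l => P (side 1 l)) * Real.cos φ) : ℝ) : ℂ) := by
  rw [seqMat_apply _ (seqOK_normSeq e A φ), if_pos]
  · simp only [normSeq, List.map_append, List.map_map, List.prod_append, Function.comp_def,
      normRot_fullState, fullState_ancReg, prod_rotM, List.map_cons, List.map_nil,
      fullState_ancBit, List.prod_singleton]
    simp [rotM]
  · refine wire_cases e (fun k l h => ?_) (fun k l _ => ?_) (fun j _ => ?_) (fun j _ => ?_)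
    · refine absurd ?_ h
      obtain rfl | rfl : k = 0 ∨ k = 1 := fin_two_cases k
      · simp only [normSeq, List.map_append, List.mem_append, List.map_map, List.mem_map]
        exact Or.inl ⟨l.rev, List.mem_finRange _, by simp⟩
      · simp only [normSeq, List.map_append, List.mem_append, List.map_map, List.mem_map]
        exact Or.inr (Or.inl ⟨l.rev, List.mem_finRange _, by simp⟩)
    · rw [fullState_sysReg, fullState_sysReg]
    · rw [fullState_ancBit, fullState_ancBit]
    · rw [fullState_work, fullState_work]

theorem rowSeq_fullState (P S : Fin m ⊕ Fin m → Fin 2) :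
    seqMat (rowSeq e A) (fullState e P S) (fullState e P fun _ => 0) =
      ((treeAmp (readAngle (A 0 (regVal fun l => P (side 0 l))) b) (fun l => S (side 0 l)) *
        (readSign (A 0 (regVal fun l => P (side 0 l))) (nodeVal (fun l => S (side 0 l)) m) *
        (treeAmp (readAngle (A 1 (regVal fun l => P (side 1 l))) b) (fun l => S (side 1 l)) *
        readSign (A 1 (regVal fun l => P (side 1 l))) (nodeVal (fun l => S (side 1 l)) m))) :
        ℝ) : ℂ) := by
  rw [seqMat_apply _ (seqOK_rowSeq e A), if_pos]
  · simp only [rowSeq, List.map_append, List.map_map, List.prod_append, Function.comp_def,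
      rowRot_fullState, signPhase_fullState, fullState_sysReg, prod_rotM, List.map_cons,
      List.map_nil, fullState_ancBit, List.prod_singleton]
    simp
  · refine wire_cases e (fun k l _ => ?_) (fun k l h => ?_) (fun j _ => ?_) (fun j _ => ?_)
    · rw [fullState_ancReg, fullState_ancReg]
    · refine absurd ?_ h
      obtain rfl | rfl : k = 0 ∨ k = 1 := fin_two_cases k
      · simp only [rowSeq, List.map_append, List.mem_append, List.map_map, List.mem_map]
        exact Or.inl ⟨l.rev, List.mem_finRange _, by simp⟩
      · simp only [rowSeq, List.map_append, List.mem_append, List.map_map, List.mem_map]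
        exact Or.inr (Or.inr (Or.inl ⟨l.rev, List.mem_finRange _, by simp⟩))
    · rw [fullState_ancBit, fullState_ancBit]
    · rw [fullState_work, fullState_work]

theorem fixes_normSeq (φ : ℝ) {i : ι} (h1 : ∀ k l, i ≠ ancReg e k l) (h2 : i ≠ ancBit e 2) :
    Fixes (seqMat (normSeq e A φ)) i := by
  refine Fixes.seqMat ?_
  simp only [normSeq, List.map_append, List.mem_append, List.map_map, List.mem_map, not_or,
    not_exists, not_and, List.map_cons, List.map_nil, List.mem_singleton, Function.comp]
  exact ⟨fun d _ => (h1 _ _).symm, fun d _ => (h1 _ _).symm, h2⟩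

theorem fixes_rowSeq {i : ι} (h1 : ∀ k l, i ≠ sysReg e k l) (h2 : i ≠ ancBit e 3)
    (h3 : i ≠ ancBit e 4) : Fixes (seqMat (rowSeq e A)) i := by
  refine Fixes.seqMat ?_
  simp only [rowSeq, List.map_append, List.mem_append, List.map_map, List.mem_map, not_or,
    not_exists, not_and, List.map_cons, List.map_nil, List.mem_singleton, Function.comp]
  exact ⟨fun d _ => (h1 _ _).symm, h2, fun d _ => (h1 _ _).symm, h3⟩

theorem matrix_move : QCircuit.matrix A (moveReg e 0 ++ moveReg e 1) =
    permMat (moveMap e 1 ∘ moveMap e 0) := by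
  rw [QCircuit.matrix_append, matrix_moveReg, matrix_moveReg, permMat_mul]

/-- The overlap of the state prepared for a row pair with the state prepared for a column pair. -/
theorem overlap (φ : ℝ) (x y : Fin m ⊕ Fin m → Fin 2) :
    ∑ z, star (QCircuit.matrix A ((moveReg e 0 ++ moveReg e 1) ++ prepRows e) z
        (fullState e (fun _ => 0) x)) *
      QCircuit.matrix A (prepNorms e φ) z (fullState e (fun _ => 0) y) =
      ((Real.cos φ * (entryAmp b (A 0) (fun l => x (side 0 l)) (fun l => y (side 0 l)) *
        entryAmp b (A 1) (fun l => x (side 1 l)) (fun l => y (side 1 l))) : ℝ) : ℂ) := by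
  rw [QCircuit.matrix_append, matrix_move, matrix_prepRows, matrix_prepNorms]
  simp only [mul_permMat_apply, Function.comp, moveMap_fullState]
  -- The row side changes only the system registers and ancilla bits 3 and 4; the norm side changes
  -- only the ancilla registers and bit 2. Both are nonzero only with `x` in the ancilla registers,
  -- `y` in the system registers and zeros elsewhere.
  rw [Finset.sum_eq_single (fullState e x y)]
  · rw [rowSeq_fullState, normSeq_fullState, Complex.star_def, Complex.conj_ofReal,
      ← Complex.ofReal_mul]
    congr 1
    simp only [entryAmp]
    ring
  · intro z _ hz
    obtain ⟨i, hi⟩ := Function.ne_iff.1 hz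
    have hA : Fixes (seqMat (rowSeq e A)) i → z i ≠ fullState e x (fun _ => 0) i →
        star (seqMat (rowSeq e A) z (fullState e x fun _ => 0)) *
          seqMat (normSeq e A φ) z (fullState e (fun _ => 0) y) = 0 := fun h h' => by
      rw [h _ _ h', star_zero, zero_mul]
    have hB : Fixes (seqMat (normSeq e A φ)) i → z i ≠ fullState e (fun _ => 0) y i →
        star (seqMat (rowSeq e A) z (fullState e x fun _ => 0)) *
          seqMat (normSeq e A φ) z (fullState e (fun _ => 0) y) = 0 := fun h h' => by
      rw [h _ _ h', mul_zero]
    revert i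
    refine wire_cases e (fun k l hi hA hB => ?_) (fun k l hi hA hB => ?_) (fun j hi hA hB => ?_)
      (fun j hi hA hB => ?_)
    · refine hA (fixes_rowSeq e A (fun _ _ => (sysReg_ne_ancReg e _ _ _ _).symm)
        (ancReg_ne_ancBit e _ _ _) (ancReg_ne_ancBit e _ _ _)) ?_
      rwa [fullState_ancReg] at hi ⊢
    · refine hB (fixes_normSeq e A φ (fun _ _ => sysReg_ne_ancReg e _ _ _ _)
        (sysReg_ne_ancBit e _ _ _)) ?_
      rwa [fullState_sysReg] at hi ⊢
    · rw [fullState_ancBit] at hi hA hB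
      -- The rotated bit 2 is pinned to zero by the row side, which leaves the factor `cos φ`; the
      -- norm side pins the other bits.
      by_cases hj : j = 2
      · subst hj
        exact hA (fixes_rowSeq e A (fun _ _ => (sysReg_ne_ancBit e _ _ _).symm)
          ((ancBit_injective e).ne (by simp)) ((ancBit_injective e).ne (by simp))) hi
      · exact hB (fixes_normSeq e A φ (fun _ _ => (ancReg_ne_ancBit e _ _ _).symm)
          ((ancBit_injective e).ne hj)) hi
    · rw [fullState_work] at hi hB
      exact hB (fixes_normSeq e A φ (by simp [ancReg]) (by simp [ancBit])) hi
  · simp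

/-! #### Pairs of indices -/

/-- The basis state of two registers that hold the integers of a pair. -/
def pairState (k : Fin (2 ^ m) × Fin (2 ^ m)) : Fin m ⊕ Fin m → Fin 2 :=
  Sum.elim (finFunctionFinEquiv.symm k.1) (finFunctionFinEquiv.symm k.2)

theorem regVal_pairState_zero (k : Fin (2 ^ m) × Fin (2 ^ m)) :
    (regVal fun l => pairState k (side 0 l)) = k.1 :=
  finFunctionFinEquiv.apply_symm_apply k.1

theorem regVal_pairState_one (k : Fin (2 ^ m) × Fin (2 ^ m)) :
    (regVal fun l => pairState k (side 1 l)) = k.2 :=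
  finFunctionFinEquiv.apply_symm_apply k.2

theorem pairState_regVal (x : Fin m ⊕ Fin m → Fin 2) :
    pairState (regVal fun l => x (Sum.inl l), regVal fun l => x (Sum.inr l)) = x := by
  funext i
  rcases i with l | l
  · exact congrFun (finFunctionFinEquiv.symm_apply_apply fun l => x (Sum.inl l)) l
  · exact congrFun (finFunctionFinEquiv.symm_apply_apply fun l => x (Sum.inr l)) l

/-- The basis state with a pair of integers in the system registers and zero elsewhere. -/
def sysState (k : Fin (2 ^ m) × Fin (2 ^ m)) : ι → Fin 2 :=
  fullState e (fun _ => 0) (pairState k)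

/-- In this form a row of `V` is visibly the list of amplitudes produced by the symmetrizer. -/
theorem symKronV_apply {n : ℕ} (p : LowerPair n) (k : Fin n × Fin n) : symKronV n p k =
    if p.1.2 < p.1.1 then
      1 / √2 * ((if k = (p.1.1, p.1.2) then 1 else 0) + if k = (p.1.2, p.1.1) then 1 else 0)
    else if k = (p.1.1, p.1.2) then 1 else 0 := by
  obtain ⟨⟨i, j⟩, h⟩ := p
  obtain ⟨a, c⟩ := k
  simp only [symKronV, Matrix.of_apply, Prod.mk.injEq]
  simp only at h
  rcases h.lt_or_eq with h' | rfl
  · have h1 : i ≠ j := h'.ne'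
    simp only [h1, h', false_and, if_false, if_true, ne_eq, not_false_eq_true, and_true]
    by_cases h2 : i = a ∧ j = c
    · obtain ⟨rfl, rfl⟩ := h2
      simp [h1]
    · by_cases h3 : i = c ∧ j = a
      · obtain ⟨rfl, rfl⟩ := h3
        simp [h1.symm]
      · have h4 : ¬ (a = i ∧ c = j) := fun h => h2 ⟨h.1.symm, h.2.symm⟩
        have h5 : ¬ (a = j ∧ c = i) := fun h => h3 ⟨h.2.symm, h.1.symm⟩
        simp [h2, h3, h4, h5]
  · simp only [lt_irrefl, if_false, ne_eq, not_true_eq_false, and_false, or_self, true_and]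
    refine if_congr ⟨?_, ?_⟩ rfl rfl
    · rintro ⟨rfl, rfl⟩; exact ⟨rfl, rfl⟩
    · rintro ⟨rfl, rfl⟩; exact ⟨rfl, rfl⟩

theorem symmetrizer_sysState (j : Fin 5) (k : Fin (2 ^ m) × Fin (2 ^ m)) (z : ι → Fin 2) :
    QCircuit.matrix A (symmetrizer (sysReg e 0) (sysReg e 1) (cmpWire e) (ancBit e j)) z
      (sysState e k) =
      if h : k.2 ≤ k.1 then
        ∑ l, ((symKronV (2 ^ m) ⟨k, h⟩ l : ℝ) : ℂ) * if z = sysState e l then 1 else 0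
      else if z = Function.update (sysState e k) (ancBit e j) 1 then 1 else 0 := by
  have h1 : (regVal fun l => sysState e k (sysReg e 0 l)) = k.1 := by
    simp only [sysState, fullState_sysReg]
    exact regVal_pairState_zero k
  have h2 : (regVal fun l => sysState e k (sysReg e 1 l)) = k.2 := by
    simp only [sysState, fullState_sysReg]
    exact regVal_pairState_one k
  rw [symmetrizer_apply A (symWires e) (y := sysState e k) (y' := sysState e k.swap)
    (fun l => fullState_work e _ _ _) (fullState_ancBit e _ _ j)
    (fun l => (fullState_sysReg e _ _ 0 l).trans (fullState_sysReg e (fun _ => 0) (pairState k) 1 l).symm)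
    (fun l => (fullState_sysReg e _ _ 1 l).trans (fullState_sysReg e (fun _ => 0) (pairState k) 0 l).symm) ?_, h1, h2]
  · by_cases h : k.2 ≤ k.1
    · rw [if_neg h.not_gt, dif_pos h]
      simp only [symKronV_apply]
      by_cases h3 : k.2 < k.1
      · simp only [h3, if_true, Complex.ofReal_mul, Complex.ofReal_add, mul_assoc, add_mul,
          apply_ite Complex.ofReal, Complex.ofReal_one, Complex.ofReal_zero, ← Finset.mul_sum,
          Finset.sum_add_distrib, ite_mul, one_mul, zero_mul, Finset.sum_ite_eq',
          Finset.mem_univ]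
        rfl
      · simp only [h3, if_false, apply_ite Complex.ofReal, Complex.ofReal_one,
          Complex.ofReal_zero, ite_mul, one_mul, zero_mul, Finset.sum_ite_eq', Finset.mem_univ]
        rfl
    · rw [if_pos (not_le.1 h), dif_neg h]
  · refine wire_cases e (fun k' l _ _ => ?_) (fun k' l h3 h4 => ?_) (fun j _ _ => ?_)
      (fun j _ _ => ?_)
    · rw [sysState, sysState, fullState_ancReg, fullState_ancReg]
    · obtain rfl | rfl : k' = 0 ∨ k' = 1 := fin_two_cases k'
      · exact absurd rfl (h3 l)
      · exact absurd rfl (h4 l)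
    · rw [sysState, sysState, fullState_ancBit, fullState_ancBit]
    · rw [sysState, sysState, fullState_work, fullState_work]

end Entries

/-! ### The block of the circuit -/

section Block

variable {m b : ℕ} {ι : Type} [Fintype ι] [DecidableEq ι] (e : WireName m b ≃ ι)
variable (A : Fin 2 → Matrix (Fin (2 ^ m)) (Fin (2 ^ m)) ℝ)

theorem fixes_symmetrizer_wires (j : Fin 5) {i : ι} (h1 : ∀ k l, sysReg e k l ≠ i)
    (h2 : i ≠ ancBit e j) : Fixes (QCircuit.matrix A
      (symmetrizer (sysReg e 0) (sysReg e 1) (cmpWire e) (ancBit e j))) i :=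
  fixes_symmetrizer A (symWires e) (h1 0) (h1 1) h2

theorem fixes_prepNorms (φ : ℝ) {i : ι} (h1 : ∀ k l, i ≠ ancReg e k l) (h2 : i ≠ ancBit e 2) :
    Fixes (QCircuit.matrix A (prepNorms e φ)) i := by
  rw [matrix_prepNorms]
  exact fixes_normSeq e A φ h1 h2

theorem fixes_movePrepRows {i : ι} (h0 : ∀ k l, ancReg e k l ≠ i) (h1 : ∀ k l, sysReg e k l ≠ i)
    (h2 : i ≠ ancBit e 3) (h3 : i ≠ ancBit e 4) :
    Fixes (QCircuit.matrix A ((moveReg e 0 ++ moveReg e 1) ++ prepRows e)) i := by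
  rw [QCircuit.matrix_append, matrix_move, matrix_prepRows]
  refine (fixes_rowSeq e A (fun k l => (h1 k l).symm) h2 h3).mul (Fixes.permMat fun y => ?_)
  rw [Function.comp, moveMap_apply_of_ne e 1 (h0 1) (h1 1), moveMap_apply_of_ne e 0 (h0 0) (h1 0)]

/-- The shape `star R * L`: entries of the circuit are overlaps of the row side with the norm side.
-/
theorem matrix_symKronCircuit (φ : ℝ) : QCircuit.matrix A (symKronCircuit e φ) =
    star (QCircuit.matrix A ((moveReg e 0 ++ moveReg e 1) ++ prepRows e) *
      QCircuit.matrix A (symmetrizer (sysReg e 0) (sysReg e 1) (cmpWire e) (ancBit e 1))) *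
      (QCircuit.matrix A (prepNorms e φ) *
        QCircuit.matrix A (symmetrizer (sysReg e 0) (sysReg e 1) (cmpWire e) (ancBit e 0))) := by
  rw [symKronCircuit, QCircuit.matrix_append, QCircuit.matrix_append, QCircuit.matrix_inv,
    QCircuit.matrix_append A (symmetrizer _ _ _ _), Matrix.mul_assoc]

/-- Workspace wires are preserved for every content, not only zero; this is what makes the clean
block unitary. -/
theorem fixes_symKronCircuit (φ : ℝ) (j) :
    Fixes (QCircuit.matrix A (symKronCircuit e φ)) (e (Sum.inr j)) := by
  have h0 : ∀ k l, ancReg e k l ≠ e (Sum.inr j) := by simp [ancReg]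
  have h1 : ∀ k l, sysReg e k l ≠ e (Sum.inr j) := by simp [sysReg]
  have h2 : ∀ k, e (Sum.inr j) ≠ ancBit e k := by simp [ancBit]
  rw [matrix_symKronCircuit]
  exact ((fixes_movePrepRows e A h0 h1 (h2 _) (h2 _)).mul
    (fixes_symmetrizer_wires e A 1 h1 (h2 _))).star.mul
    ((fixes_prepNorms e A φ (fun k l => (h0 k l).symm) (h2 _)).mul
      (fixes_symmetrizer_wires e A 0 h1 (h2 _)))

theorem mul_symmetrizer_sysState (M : Matrix (ι → Fin 2) (ι → Fin 2) ℂ) (j : Fin 5)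
    (k : Fin (2 ^ m) × Fin (2 ^ m)) (z : ι → Fin 2) :
    (M * QCircuit.matrix A (symmetrizer (sysReg e 0) (sysReg e 1) (cmpWire e) (ancBit e j))) z
      (sysState e k) =
      if h : k.2 ≤ k.1 then
        ∑ l, ((symKronV (2 ^ m) ⟨k, h⟩ l : ℝ) : ℂ) * M z (sysState e l)
      else M z (Function.update (sysState e k) (ancBit e j) 1) := by
  rw [Matrix.mul_apply]
  simp only [symmetrizer_sysState]
  split_ifs with h
  · simp only [Finset.mul_sum]
    rw [Finset.sum_comm]
    refine Finset.sum_congr rfl fun l _ => ?_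
    rw [Finset.sum_eq_single (sysState e l)]
    · simp [mul_comm]
    · intro z' _ hz'
      simp [hz']
    · simp
  · simp

/-- For legal pairs the overlaps are summed against two rows of `V`. An illegal pair raises a flag
that the opposite side leaves at zero, so the two states are orthogonal. -/
theorem symKronCircuit_apply (φ : ℝ) (k l : Fin (2 ^ m) × Fin (2 ^ m)) :
    QCircuit.matrix A (symKronCircuit e φ) (sysState e k) (sysState e l) =
      if hk : k.2 ≤ k.1 then if hl : l.2 ≤ l.1 then
        ((∑ k', ∑ l', symKronV (2 ^ m) ⟨k, hk⟩ k' * symKronV (2 ^ m) ⟨l, hl⟩ l' *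
          (Real.cos φ * (entryAmp b (A 0) (finFunctionFinEquiv.symm k'.1)
            (finFunctionFinEquiv.symm l'.1) * entryAmp b (A 1) (finFunctionFinEquiv.symm k'.2)
            (finFunctionFinEquiv.symm l'.2))) : ℝ) : ℂ)
      else 0 else 0 := by
  have hc : ∀ k' : Fin (2 ^ m) × Fin (2 ^ m), ∀ j, sysState e k' (ancBit e j) = 0 := fun k' j =>
    fullState_ancBit e _ _ j
  have hM : ∀ j : Fin 5, (j = 0 ∨ j = 1) →
      Fixes (QCircuit.matrix A ((moveReg e 0 ++ moveReg e 1) ++ prepRows e)) (ancBit e j) := by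
    intro j hj
    refine fixes_movePrepRows e A (fun _ _ => ancReg_ne_ancBit e _ _ _)
      (fun _ _ => sysReg_ne_ancBit e _ _ _) ((ancBit_injective e).ne ?_)
      ((ancBit_injective e).ne ?_) <;> rcases hj with rfl | rfl <;> decide
  have hN : ∀ j : Fin 5, (j = 0 ∨ j = 1) →
      Fixes (QCircuit.matrix A (prepNorms e φ)) (ancBit e j) := by
    intro j hj
    refine fixes_prepNorms e A φ (fun _ _ => (ancReg_ne_ancBit e _ _ _).symm)
      ((ancBit_injective e).ne ?_)
    rcases hj with rfl | rfl <;> decide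
  have hW1 := fixes_symmetrizer_wires e A 1 (i := ancBit e 0)
    (fun _ _ => sysReg_ne_ancBit e _ _ _) ((ancBit_injective e).ne (by decide))
  have hW0 := fixes_symmetrizer_wires e A 0 (i := ancBit e 1)
    (fun _ _ => sysReg_ne_ancBit e _ _ _) ((ancBit_injective e).ne (by decide))
  rw [matrix_symKronCircuit, Matrix.mul_apply]
  simp only [Matrix.star_apply]
  by_cases hk : k.2 ≤ k.1
  · by_cases hl : l.2 ≤ l.1
    · rw [dif_pos hk, dif_pos hl]
      simp only [mul_symmetrizer_sysState, dif_pos hk, dif_pos hl, star_sum, star_mul',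
        Complex.star_def, Complex.conj_ofReal, Finset.sum_mul_sum]
      rw [Finset.sum_comm, Complex.ofReal_sum]
      refine Finset.sum_congr rfl fun k' _ => ?_
      rw [Finset.sum_comm, Complex.ofReal_sum]
      refine Finset.sum_congr rfl fun l' _ => ?_
      have h := overlap e A φ (pairState k') (pairState l')
      rw [Complex.ofReal_mul]
      refine Eq.trans ?_ (congrArg (HMul.hMul _) h)
      rw [Finset.mul_sum, Complex.ofReal_mul]
      refine Finset.sum_congr rfl fun z _ => ?_
      rw [mul_mul_mul_comm]
      rfl
    · rw [dif_pos hk, dif_neg hl]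
      refine Finset.sum_eq_zero fun z _ => ?_
      -- The column side has set bit 0, while the row side keeps it at zero.
      by_cases hz : z (ancBit e 0) = 0
      · rw [mul_symmetrizer_sysState e A _ 0 l, dif_neg hl, hN 0 (Or.inl rfl), mul_zero]
        rw [hz, Function.update_self]
        decide
      · rw [(hM 0 (Or.inl rfl)).mul hW1, star_zero, zero_mul]
        rwa [hc]
  · rw [dif_neg hk]
    refine Finset.sum_eq_zero fun z _ => ?_
    -- The row side has set bit 1, which the column side never touches, whether or not `l` is legal;
    -- one shared flag would fail when both pairs are illegal.
    by_cases hz : z (ancBit e 1) = 0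
    · rw [mul_symmetrizer_sysState e A _ 1 k, dif_neg hk, hM 1 (Or.inr rfl), star_zero, zero_mul]
      rw [hz, Function.update_self]
      decide
    · rw [(hN 1 (Or.inr rfl)).mul hW0, mul_zero]
      rwa [hc]

end Block

/-! ### The symmetric Kronecker product as a double sum -/

theorem symKronV_swap {n : ℕ} (p : LowerPair n) (k : Fin n × Fin n) :
    symKronV n p k.swap = symKronV n p k := by
  obtain ⟨⟨i, j⟩, h⟩ := p
  obtain ⟨a, c⟩ := k
  have h1 : (c, a) = (i, j) ↔ (a, c) = (j, i) := by simp [and_comm]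
  have h2 : (c, a) = (j, i) ↔ (a, c) = (i, j) := by simp [and_comm]
  simp only [symKronV_apply, Prod.swap_prod_mk, h1, h2]
  simp only at h
  rcases h.lt_or_eq with h' | rfl
  · simp only [h', if_true]
    rw [add_comm]
  · simp

theorem abs_symKronV_le_one {n : ℕ} (p : LowerPair n) (k : Fin n × Fin n) :
    |symKronV n p k| ≤ 1 := by
  have h : |1 / √2| ≤ (1 : ℝ) := by
    rw [abs_of_nonneg (by positivity)]
    exact div_le_one_of_le₀ (Real.one_le_sqrt.2 (by norm_num)) (Real.sqrt_nonneg _)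
  simp only [symKronV, Matrix.of_apply]
  split_ifs
  · simp
  · exact h
  · simp

/-- Swapping the components of both summation pairs turns `K ⊗ G` into `G ⊗ K` and leaves `V`
unchanged, so the two halves coincide. -/
theorem symKron_apply {n : ℕ} (G K : Matrix (Fin n) (Fin n) ℝ) (p q : LowerPair n) :
    symKron G K p q = ∑ k, ∑ l, symKronV n p k * symKronV n q l * (G k.1 l.1 * K k.2 l.2) := by
  have h : ∑ k, ∑ l, symKronV n p k * symKronV n q l * (K k.1 l.1 * G k.2 l.2) =
      ∑ k, ∑ l, symKronV n p k * symKronV n q l * (G k.1 l.1 * K k.2 l.2) := by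
    rw [← (Equiv.prodComm (Fin n) (Fin n)).sum_comp]
    refine Finset.sum_congr rfl fun k _ => ?_
    rw [← (Equiv.prodComm (Fin n) (Fin n)).sum_comp]
    refine Finset.sum_congr rfl fun l _ => ?_
    rw [Equiv.prodComm_apply, Equiv.prodComm_apply, symKronV_swap, symKronV_swap, Prod.fst_swap,
      Prod.fst_swap, Prod.snd_swap, Prod.snd_swap, mul_comm (K _ _)]
  have h' : symKron G K p q = 1 / 2 *
      (∑ k, ∑ l, symKronV n p k * symKronV n q l * (G k.1 l.1 * K k.2 l.2) +
        ∑ k, ∑ l, symKronV n p k * symKronV n q l * (K k.1 l.1 * G k.2 l.2)) := by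
    simp only [symKron, Matrix.smul_apply, smul_eq_mul, Matrix.mul_apply, Matrix.transpose_apply,
      Matrix.add_apply, Matrix.kroneckerMap_apply, Finset.sum_mul, ← Finset.sum_add_distrib]
    rw [Finset.sum_comm]
    congr 1
    exact Finset.sum_congr rfl fun k _ => Finset.sum_congr rfl fun l _ => by ring
  rw [h', h]
  ring

/-! ### Block-encodings from clean circuits -/

section Clean

-- Triangle inequality over matrix units. The loss of a power of the dimension is affordable, since
-- precision is exponential in `b`.
open scoped Matrix Matrix.Norms.L2Operator in
theorem l2_opNorm_le_sum {α : Type*} [Fintype α] [DecidableEq α] (M : Matrix α α ℂ) :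
    ‖M‖ ≤ ∑ i, ∑ j, ‖M i j‖ := by
  have h : ∀ (i j : α) (z : ℂ), ‖Matrix.single i j z‖ ≤ ‖z‖ := by
    intro i j z
    -- By the C*-identity the norm of a matrix unit follows from that of a diagonal matrix.
    have h1 : (Matrix.single i j z)ᴴ * Matrix.single i j z =
        Matrix.diagonal (Pi.single j (star z * z)) := by
      rw [Matrix.conjTranspose_single, Matrix.single_mul_single_same, Matrix.diagonal_single]
    have h2 := Matrix.l2_opNorm_conjTranspose_mul_self (Matrix.single i j z)
    rw [h1, Matrix.l2_opNorm_diagonal, Pi.norm_single, norm_mul, norm_star] at h2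
    exact (mul_self_inj (norm_nonneg _) (norm_nonneg _)).1 h2.symm |>.le
  conv_lhs => rw [Matrix.matrix_eq_sum_single M]
  refine (norm_sum_le _ _).trans (Finset.sum_le_sum fun i _ => ?_)
  exact (norm_sum_le _ _).trans (Finset.sum_le_sum fun j _ => h i j _)

variable {ι : Type} [Fintype ι] [DecidableEq ι] {t : ℕ}

/-- The part of an operator on which the workspace is zero. -/
def cleanBlock (M : Matrix (ι ⊕ Fin t → Fin 2) (ι ⊕ Fin t → Fin 2) ℂ) :
    Matrix (ι → Fin 2) (ι → Fin 2) ℂ :=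
  Matrix.of fun x y => M (Sum.elim x fun _ => 0) (Sum.elim y fun _ => 0)

variable {M : Matrix (ι ⊕ Fin t → Fin 2) (ι ⊕ Fin t → Fin 2) ℂ}

theorem apply_eq_zero_of_fixes (hM : ∀ j, Fixes M (Sum.inr j)) (x y : ι → Fin 2)
    {z z' : Fin t → Fin 2} (hz : z ≠ z') : M (Sum.elim x z) (Sum.elim y z') = 0 := by
  obtain ⟨j, hj⟩ := Function.ne_iff.1 hz
  exact hM j _ _ hj

theorem implementsClean_cleanBlock (hM : ∀ j, Fixes M (Sum.inr j)) :
    ImplementsClean M (cleanBlock M) := by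
  intro x y z
  split_ifs with h
  · rw [h]; rfl
  · exact apply_eq_zero_of_fixes hM x y h

/-- `M` is block diagonal with respect to the workspace content, and diagonal blocks of such a
unitary are unitary. -/
theorem cleanBlock_mem_unitaryGroup (hM : ∀ j, Fixes M (Sum.inr j))
    (hU : M ∈ Matrix.unitaryGroup (ι ⊕ Fin t → Fin 2) ℂ) :
    cleanBlock M ∈ Matrix.unitaryGroup (ι → Fin 2) ℂ := by
  rw [Matrix.mem_unitaryGroup_iff] at hU ⊢
  ext x y
  have h := congrFun (congrFun hU (Sum.elim x fun _ => 0)) (Sum.elim y fun _ => 0)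
  rw [Matrix.mul_apply, ← (Equiv.sumArrowEquivProdArrow ι (Fin t) (Fin 2)).symm.sum_comp,
    Fintype.sum_prod_type] at h
  have h1 : (1 : Matrix (ι ⊕ Fin t → Fin 2) (ι ⊕ Fin t → Fin 2) ℂ) (Sum.elim x fun _ => 0)
      (Sum.elim y fun _ => 0) = (1 : Matrix (ι → Fin 2) (ι → Fin 2) ℂ) x y := by
    simp only [Matrix.one_apply]
    refine if_congr ⟨fun h => ?_, fun h => by rw [h]⟩ rfl rfl
    funext i
    exact congrFun h (Sum.inl i)
  rw [h1] at h
  rw [← h, Matrix.mul_apply]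
  refine Finset.sum_congr rfl fun u _ => ?_
  rw [Finset.sum_eq_single fun _ => 0]
  · rfl
  · intro z _ hz
    exact mul_eq_zero_of_left (apply_eq_zero_of_fixes hM x u hz.symm) _
  · simp

end Clean

/-! ### The block-encoding -/

section Main

variable {m b a t : ℕ}

/-- The wires of the circuit, sorted into ancillas, system and workspace. -/
def wireEquiv (eA : (Fin m ⊕ Fin m) ⊕ Fin 5 ≃ Fin a)
    (eT : Fin (m + 1) ⊕ (Fin (m + 1) ⊕ (Fin b ⊕ Fin 1)) ≃ Fin t) :
    WireName m b ≃ (Fin a ⊕ (Fin m ⊕ Fin m)) ⊕ Fin t :=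
  Equiv.sumCongr (Equiv.sumCongr eA (Equiv.refl _)) eT

variable (eA : (Fin m ⊕ Fin m) ⊕ Fin 5 ≃ Fin a)
variable (eT : Fin (m + 1) ⊕ (Fin (m + 1) ⊕ (Fin b ⊕ Fin 1)) ≃ Fin t)

theorem sysState_wireEquiv (k : Fin (2 ^ m) × Fin (2 ^ m)) :
    sysState (wireEquiv eA eT) k =
      Sum.elim (Sum.elim (fun _ => 0) (pairState k)) fun _ => 0 := by
  funext i
  rcases i with (i | i) | i
  · obtain ⟨(j | j), rfl⟩ := eA.surjective i <;> simp [sysState, fullState, wireEquiv]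
  · simp [sysState, fullState, wireEquiv]
  · simp [sysState, fullState, wireEquiv]

theorem fixes_work_symKronCircuit (A : Fin 2 → Matrix (Fin (2 ^ m)) (Fin (2 ^ m)) ℝ) (φ : ℝ)
    (j : Fin t) :
    Fixes (QCircuit.matrix A (symKronCircuit (wireEquiv eA eT) φ)) (Sum.inr j) := by
  have h := fixes_symKronCircuit (wireEquiv eA eT) A φ (eT.symm j)
  have h' : wireEquiv eA eT (Sum.inr (eT.symm j)) = Sum.inr j := by simp [wireEquiv]
  rwa [h'] at h

/-- There are `2 ^ (4 * m)` index quadruples, each weighted by entries of `V` of modulus at most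
one; the factor `N` is what remains of `N ^ 2 * cos φ`. -/
theorem norm_block_sub_le {N φ : ℝ} (hN : 1 ≤ N) (hφ : Real.cos φ = 1 / N)
    (G K : Matrix (Fin (2 ^ m)) (Fin (2 ^ m)) ℝ) (hGK : frobNorm (G ⊗ₖ K) = N)
    (x y : Fin m ⊕ Fin m → Fin 2) :
    ‖(((N ^ 2 : ℝ) : ℂ) • ancillaBlock (cleanBlock (QCircuit.matrix ![G, K]
      (symKronCircuit (wireEquiv eA eT) φ))) - padLower (symKron G K)) x y‖ ≤
      2 ^ (4 * m) * (N * (4 * m * (Real.pi / 2 ^ b))) := by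
  have hN0 : N ≠ 0 := by positivity
  have hb0 : (0 : ℝ) ≤ N * (4 * m * (Real.pi / 2 ^ b)) := by positivity
  set k : Fin (2 ^ m) × Fin (2 ^ m) :=
    (regVal fun l => x (Sum.inl l), regVal fun l => x (Sum.inr l)) with hk
  set l : Fin (2 ^ m) × Fin (2 ^ m) :=
    (regVal fun l => y (Sum.inl l), regVal fun l => y (Sum.inr l)) with hl
  have hentry : ancillaBlock (cleanBlock (QCircuit.matrix ![G, K]
      (symKronCircuit (wireEquiv eA eT) φ))) x y = QCircuit.matrix ![G, K]
      (symKronCircuit (wireEquiv eA eT) φ) (sysState (wireEquiv eA eT) k)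
      (sysState (wireEquiv eA eT) l) := by
    rw [sysState_wireEquiv, sysState_wireEquiv, hk, hl, pairState_regVal, pairState_regVal]
    rfl
  have hpad : padLower (symKron G K) x y = if hk : k.2 ≤ k.1 then if hl : l.2 ≤ l.1 then
      ((symKron G K ⟨k, hk⟩ ⟨l, hl⟩ : ℝ) : ℂ) else 0 else 0 := rfl
  rw [Matrix.sub_apply, Matrix.smul_apply, hentry, hpad, symKronCircuit_apply, smul_eq_mul]
  by_cases h1 : k.2 ≤ k.1
  swap
  · rw [dif_neg h1, dif_neg h1, mul_zero, sub_zero, norm_zero]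
    positivity
  by_cases h2 : l.2 ≤ l.1
  swap
  · rw [dif_pos h1, dif_pos h1, dif_neg h2, dif_neg h2, mul_zero, sub_zero, norm_zero]
    positivity
  rw [dif_pos h1, dif_pos h1, dif_pos h2, dif_pos h2, ← Complex.ofReal_mul, ← Complex.ofReal_sub,
    Complex.norm_real, Real.norm_eq_abs, symKron_apply, hφ, Finset.mul_sum,
    ← Finset.sum_sub_distrib]
  have hterm : ∀ k' l' : Fin (2 ^ m) × Fin (2 ^ m),
      |N ^ 2 * (symKronV (2 ^ m) ⟨k, h1⟩ k' * symKronV (2 ^ m) ⟨l, h2⟩ l' *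
        (1 / N * (entryAmp b (![G, K] 0) (finFunctionFinEquiv.symm k'.1)
          (finFunctionFinEquiv.symm l'.1) * entryAmp b (![G, K] 1) (finFunctionFinEquiv.symm k'.2)
          (finFunctionFinEquiv.symm l'.2)))) -
        symKronV (2 ^ m) ⟨k, h1⟩ k' * symKronV (2 ^ m) ⟨l, h2⟩ l' *
          (G k'.1 l'.1 * K k'.2 l'.2)| ≤ N * (4 * m * (Real.pi / 2 ^ b)) := by
    intro k' l'
    have h := abs_entryAmp_mul_sub_le b (G := G) (K := K) (by rw [hGK]; exact hN0)
      (finFunctionFinEquiv.symm k'.1) (finFunctionFinEquiv.symm k'.2)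
      (finFunctionFinEquiv.symm l'.1) (finFunctionFinEquiv.symm l'.2)
    simp only [regVal, Equiv.apply_symm_apply, hGK] at h
    have hv1 := abs_symKronV_le_one ⟨k, h1⟩ k'
    have hv2 := abs_symKronV_le_one ⟨l, h2⟩ l'
    simp only [Matrix.cons_val_zero, Matrix.cons_val_one]
    generalize entryAmp b G (finFunctionFinEquiv.symm k'.1) (finFunctionFinEquiv.symm l'.1) *
      entryAmp b K (finFunctionFinEquiv.symm k'.2) (finFunctionFinEquiv.symm l'.2) = r at h ⊢
    generalize G k'.1 l'.1 * K k'.2 l'.2 = r' at h ⊢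
    generalize symKronV (2 ^ m) ⟨k, h1⟩ k' = v1 at hv1 ⊢
    generalize symKronV (2 ^ m) ⟨l, h2⟩ l' = v2 at hv2 ⊢
    have he : N ^ 2 * (v1 * v2 * (1 / N * r)) - v1 * v2 * r' =
        (v1 * v2) * (N * (r - r' / N)) := by
      field_simp
    rw [he, abs_mul, abs_mul, abs_mul N, abs_of_pos (by positivity : 0 < N)]
    calc |v1| * |v2| * (N * |r - r' / N|) ≤ 1 * (N * |r - r' / N|) :=
          mul_le_mul_of_nonneg_right (mul_le_one₀ hv1 (abs_nonneg _) hv2) (by positivity)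
      _ ≤ N * (4 * m * (Real.pi / 2 ^ b)) := by
          rw [one_mul]
          exact mul_le_mul_of_nonneg_left h (by positivity)
  have hcard : (Fintype.card (Fin (2 ^ m) × Fin (2 ^ m)) : ℝ) = 2 ^ (2 * m) := by
    rw [Fintype.card_prod, Fintype.card_fin]
    push_cast
    ring
  refine (Finset.abs_sum_le_sum_abs _ _).trans
    ((Finset.sum_le_card_nsmul _ _ (2 ^ (2 * m) * (N * (4 * m * (Real.pi / 2 ^ b))))
      fun k' _ => ?_).trans ?_)
  · rw [Finset.mul_sum, ← Finset.sum_sub_distrib]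
    refine (Finset.abs_sum_le_sum_abs _ _).trans
      ((Finset.sum_le_card_nsmul _ _ _ fun l' _ => hterm k' l').trans ?_)
    rw [Finset.card_univ, nsmul_eq_mul, hcard]
  · rw [Finset.card_univ, nsmul_eq_mul, hcard, ← mul_assoc, ← pow_add]
    refine le_of_eq ?_
    congr 2
    ring

/-- The exponent `9 * m + 4` collects `4 * m` from the sums inside an entry, `4 * m` from the number
of entries, and `m + 4` from `4 * m * π ≤ 2 ^ (m + 4)`. -/
theorem isBlockEncoding_symKronCircuit {N ξ φ : ℝ} (hN : 1 ≤ N) (hφ : Real.cos φ = 1 / N)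
    (hb : N * 2 ^ (9 * m + 4) ≤ ξ * 2 ^ b) (G K : Matrix (Fin (2 ^ m)) (Fin (2 ^ m)) ℝ)
    (hGK : frobNorm (G ⊗ₖ K) = N) :
    IsBlockEncoding (frobNorm (G ⊗ₖ K) ^ 2) a ξ (cleanBlock (QCircuit.matrix ![G, K]
      (symKronCircuit (wireEquiv eA eT) φ))) (padLower (symKron G K)) := by
  refine ⟨cleanBlock_mem_unitaryGroup (fixes_work_symKronCircuit eA eT _ φ)
    (QCircuit.matrix_mem_unitaryGroup _ _), ?_⟩
  rw [hGK]
  refine (l2_opNorm_le_sum _).trans ?_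
  have hcard : (Fintype.card (Fin m ⊕ Fin m → Fin 2) : ℝ) = 2 ^ (2 * m) := by
    rw [Fintype.card_fun, Fintype.card_sum, Fintype.card_fin, Fintype.card_fin]
    push_cast
    ring
  have h : ∑ x, ∑ y, ‖(((N ^ 2 : ℝ) : ℂ) • ancillaBlock (cleanBlock (QCircuit.matrix ![G, K]
      (symKronCircuit (wireEquiv eA eT) φ))) - padLower (symKron G K)) x y‖ ≤
      2 ^ (2 * m) * (2 ^ (2 * m) * (2 ^ (4 * m) * (N * (4 * m * (Real.pi / 2 ^ b))))) := by
    refine (Finset.sum_le_card_nsmul _ _ _ fun x _ => (Finset.sum_le_card_nsmul _ _ _ fun y _ =>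
      norm_block_sub_le eA eT hN hφ G K hGK x y)).trans ?_
    rw [Finset.card_univ, nsmul_eq_mul, nsmul_eq_mul, hcard]
  refine h.trans ?_
  have hm : (m : ℝ) ≤ 2 ^ m := by exact_mod_cast Nat.lt_two_pow_self.le
  have hpi := Real.pi_le_four
  have h2 : (0 : ℝ) < 2 ^ b := by positivity
  have h3 : (2 : ℝ) ^ (2 * m) * (2 ^ (2 * m) * (2 ^ (4 * m) * (N * (4 * m * (Real.pi / 2 ^ b))))) =
      N * (2 ^ (8 * m) * (4 * m * Real.pi)) / 2 ^ b := by
    field_simp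
    ring
  rw [h3, div_le_iff₀ h2]
  refine le_trans (mul_le_mul_of_nonneg_left ?_ (by positivity)) hb
  have h4 : (2 : ℝ) ^ (9 * m + 4) = 2 ^ (8 * m) * (4 * 2 ^ m * 4) := by ring
  rw [h4]
  gcongr

end Main

end

/-! ### Choice of the precision and the constants -/

theorem mainTheorem10 :
    ∃ C k : ℕ, ∀ (m : ℕ) (ξ N : ℝ), 0 < ξ → 1 ≤ N →
      ∃ (a t : ℕ) (c : QCircuit (Fin 2) m ((Fin a ⊕ (Fin m ⊕ Fin m)) ⊕ Fin t)),
        a ≤ C * (m + 1) ∧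
        (t : ℝ) ≤ C * (1 + m + Real.logb 2 (1 + N / ξ)) ^ k ∧
        (c.time : ℝ) ≤ C * (1 + m + Real.logb 2 (1 + N / ξ)) ^ k ∧
        ∀ G K : Matrix (Fin (2 ^ m)) (Fin (2 ^ m)) ℝ, frobNorm (G ⊗ₖ K) = N →
          ∃ U : Matrix (Fin a ⊕ (Fin m ⊕ Fin m) → Fin 2) (Fin a ⊕ (Fin m ⊕ Fin m) → Fin 2) ℂ,
            ImplementsClean (c.matrix ![G, K]) U ∧
            IsBlockEncoding (frobNorm (G ⊗ₖ K) ^ 2) a ξ U (padLower (symKron G K)) := by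
  -- With `X = 1 + m + L`, `m ≤ X` and `b ≤ 9 * X`, the time is at most `(12 + 108 + 178 + 19) * X ^
  -- 2`, below `330 * X ^ 2`.
  refine ⟨330, 2, fun m ξ N hξ hN => ?_⟩
  have hN0 : 0 < N := by linarith
  have hq : 0 < N / ξ := by positivity
  have hL : 0 ≤ Real.logb 2 (1 + N / ξ) := Real.logb_nonneg (by norm_num) (by linarith)
  set L := Real.logb 2 (1 + N / ξ) with hLdef
  -- The first summand pays for `N / ξ`, the second for the losses in the dimension.
  set b : ℕ := ⌈L⌉₊ + (9 * m + 4) with hb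
  let eA : (Fin m ⊕ Fin m) ⊕ Fin 5 ≃ Fin (m + m + 5) :=
    (Equiv.sumCongr finSumFinEquiv (Equiv.refl _)).trans finSumFinEquiv
  let eT : Fin (m + 1) ⊕ (Fin (m + 1) ⊕ (Fin b ⊕ Fin 1)) ≃
      Fin ((m + 1) + ((m + 1) + (b + 1))) :=
    (Equiv.sumCongr (Equiv.refl _)
      ((Equiv.sumCongr (Equiv.refl _) finSumFinEquiv).trans finSumFinEquiv)).trans finSumFinEquiv
  have hm0 : (0 : ℝ) ≤ m := Nat.cast_nonneg m
  have hbX : (b : ℝ) ≤ 9 * (1 + m + L) := by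
    have := (Nat.ceil_lt_add_one hL).le
    rw [hb]
    push_cast
    linarith
  have hb0 : (0 : ℝ) ≤ b := Nat.cast_nonneg b
  have hX : 1 ≤ 1 + m + L := by linarith
  have hmX : (m : ℝ) ≤ 1 + m + L := by linarith
  generalize hXdef : 1 + (m : ℝ) + L = X at hbX hX hmX
  have hXX : X ≤ X ^ 2 := by nlinarith
  refine ⟨m + m + 5, _, symKronCircuit (wireEquiv eA eT) (Real.arccos (1 / N)), by omega, ?_, ?_,
    fun G K hGK => ⟨_, implementsClean_cleanBlock (fixes_work_symKronCircuit eA eT _ _),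
      isBlockEncoding_symKronCircuit eA eT hN ?_ ?_ G K hGK⟩⟩
  · push_cast
    linarith
  · have h1 : (QCircuit.time (symKronCircuit (wireEquiv eA eT) (Real.arccos (1 / N))) : ℝ) ≤
        12 * (m * m) + 12 * (m * b) + 178 * m + 19 := by
      exact_mod_cast time_symKronCircuit_le (wireEquiv eA eT) (Real.arccos (1 / N))
    have h2 : (m : ℝ) * m ≤ X ^ 2 := by nlinarith
    have h3 : (m : ℝ) * b ≤ 9 * X ^ 2 := by nlinarith
    push_cast
    linarith
  · refine Real.cos_arccos ?_ ((div_le_one hN0).2 hN)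
    have : 0 < 1 / N := by positivity
    linarith
  · have h1 : 1 + N / ξ ≤ (2 : ℝ) ^ ⌈L⌉₊ := by
      rw [← Real.rpow_natCast, ← Real.logb_le_iff_le_rpow (by norm_num) (by linarith)]
      exact Nat.le_ceil L
    have h2 : N ≤ ξ * 2 ^ ⌈L⌉₊ := by
      have : N / ξ ≤ 2 ^ ⌈L⌉₊ := by linarith
      rwa [div_le_iff₀' hξ] at this
    rw [hb, pow_add (2 : ℝ) ⌈L⌉₊, ← mul_assoc]
    exact mul_le_mul_of_nonneg_right h2 (by positivity)
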